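/- Throughout, algorithms run on a deterministic word RAM: a single fixed program, unit-cost addition, truncated subtraction, multiplication, integer division, comparison and indirect memory access, on words of $O(\log(nM))$ bits. An undirected simple graph on $n$ nodes is given by $n$, $M$ and its weighted $n\times n$ adjacency matrix, and output graphs are written out in the same way. A cycle is a simple cycle (at least three nodes), and its weight $w(\cdot)$ is the sum of its edge weights. Theorem. For every constant $K\ge 0$ there is a deterministic algorithm with the following property. Let $G=(V,E,w)$ be an undirected simple graph on $n$ nodes with weights $w:E\to\{1,\dots,M\}$ that contains a cycle, and let $C$ be a minimum weight cycle of $G$. Given $G$ and $M$, the algorithm halts within $O(n^2\log(nM)\log n)$ steps and outputs a cycle $\hat C$ of $G$, an integer $\tau\ge 0$, and $O(\log n)$ undirected simple graphs $G'_1,\dots,G'_k$, each on $\Theta(n)$ nodes and with edge weights in $\{1,\dots,O(M)\}$, such that - either $w(\hat C)=w(C)$, or the graphs $G'_1,\dots,G'_k$ contain a triangle and the minimum weight of a triangle in them is exactly $w(C)-\tau$; and - $\tau=0$ whenever $w(C)\le KM$, so that in this case either $w(\hat C)=w(C)$ or the minimum triangle weight is exactly $w(C)$. All implied constants depend only on $K$.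 -/

import Mathlib

namespace MinCycle

/-! ### The machine: a deterministic structured word RAM

A state has word variables (registers) and a word-addressed memory.  Programs are finite and
fixed; they use only the arithmetic below, memory reads and writes by computed address, and
structured control.  Every variable, constant, address and operation costs one step. -/

/-- A machine state: the registers and the memory, each cell holding a natural number. -/
structure State where
  var : ℕ → ℕ
  mem : ℕ → ℕ

/-- The word operations. -/
inductive Op where
  | add | sub | mul | div | lt | eq

/-- Subtraction is truncated, division rounds down (and division by zero gives zero),
comparisons return `1` for true and `0` for false. -/
def Op.apply : Op → ℕ → ℕ → ℕ
  | .add, a, b => a + b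
  | .sub, a, b => a - b
  | .mul, a, b => a * b
  | .div, a, b => a / b
  | .lt, a, b => if a < b then 1 else 0
  | .eq, a, b => if a = b then 1 else 0

/-- Expressions: constants, registers, memory reads, and operations. -/
inductive Expr where
  | const (k : ℕ)
  | var (x : ℕ)
  | load (a : Expr)
  | op (o : Op) (a b : Expr)

/-- The value of an expression in a state. -/
def Expr.eval (s : State) : Expr → ℕ
  | .const k => k
  | .var x => s.var x
  | .load a => s.mem (a.eval s)
  | .op o a b => o.apply (a.eval s) (b.eval s)

/-- The number of elementary steps needed to evaluate an expression. -/
def Expr.cost : Expr → ℕ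
  | .const _ => 1
  | .var _ => 1
  | .load a => a.cost + 1
  | .op _ a b => a.cost + b.cost + 1

/-- No overflow: every value (and every address) met in the evaluation is a word, that is,
a natural number below `W`. -/
def Expr.Fits (W : ℕ) (s : State) : Expr → Prop
  | .const k => k < W
  | .var x => s.var x < W
  | .load a => a.Fits W s ∧ s.mem (a.eval s) < W
  | .op o a b => a.Fits W s ∧ b.Fits W s ∧ o.apply (a.eval s) (b.eval s) < W

/-- Programs. -/
inductive Cmd where
  | skip
  | assign (x : ℕ) (e : Expr)
  | store (a e : Expr)
  | seq (p q : Cmd)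
  | ite (e : Expr) (p q : Cmd)
  | loop (e : Expr) (p : Cmd)

/-- `Exec W p s T s'`: on words below `W`, the program `p` started in state `s` halts after
exactly `T` steps in state `s'`, and no overflow ever occurs.  (A program that overflows or
diverges has no execution.) -/
inductive Exec (W : ℕ) : Cmd → State → ℕ → State → Prop where
  | skip (s : State) : Exec W .skip s 1 s
  | assign (x : ℕ) (e : Expr) (s : State) (he : e.Fits W s) :
      Exec W (.assign x e) s (e.cost + 1) { s with var := Function.update s.var x (e.eval s) }
  | store (a e : Expr) (s : State) (ha : a.Fits W s) (he : e.Fits W s) :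
      Exec W (.store a e) s (a.cost + e.cost + 1)
        { s with mem := Function.update s.mem (a.eval s) (e.eval s) }
  | seq {p q : Cmd} {s s' s'' : State} {T T' : ℕ}
      (hp : Exec W p s T s') (hq : Exec W q s' T' s'') : Exec W (.seq p q) s (T + T') s''
  | ite_true {e : Expr} {p q : Cmd} {s s' : State} {T : ℕ}
      (he : e.Fits W s) (h : e.eval s ≠ 0) (hp : Exec W p s T s') :
      Exec W (.ite e p q) s (e.cost + 1 + T) s'
  | ite_false {e : Expr} {p q : Cmd} {s s' : State} {T : ℕ}
      (he : e.Fits W s) (h : e.eval s = 0) (hq : Exec W q s T s') :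
      Exec W (.ite e p q) s (e.cost + 1 + T) s'
  | loop_true {e : Expr} {p : Cmd} {s s' s'' : State} {T T' : ℕ}
      (he : e.Fits W s) (h : e.eval s ≠ 0) (hp : Exec W p s T s')
      (hl : Exec W (.loop e p) s' T' s'') :
      Exec W (.loop e p) s (e.cost + 1 + T + T') s''
  | loop_false {e : Expr} {p : Cmd} {s : State}
      (he : e.Fits W s) (h : e.eval s = 0) : Exec W (.loop e p) s (e.cost + 1) s

/-- The machine is deterministic: running time and final state are unique. -/
theorem Exec.unique {W : ℕ} {p : Cmd} {s s₁ s₂ : State} {T₁ T₂ : ℕ}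
    (h₁ : Exec W p s T₁ s₁) (h₂ : Exec W p s T₂ s₂) : T₁ = T₂ ∧ s₁ = s₂ := by
  induction h₁ generalizing T₂ s₂ with
  | skip | assign | store => cases h₂; exact ⟨rfl, rfl⟩
  | seq _ _ ih ih' =>
    cases h₂ with
    | seq hp hq =>
      obtain ⟨rfl, rfl⟩ := ih hp
      obtain ⟨rfl, rfl⟩ := ih' hq
      exact ⟨rfl, rfl⟩
  | ite_true _ h _ ih =>
    cases h₂ with
    | ite_true _ _ hp => obtain ⟨rfl, rfl⟩ := ih hp; exact ⟨rfl, rfl⟩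
    | ite_false _ h' _ => exact absurd h' h
  | ite_false _ h _ ih =>
    cases h₂ with
    | ite_true _ h' _ => exact absurd h h'
    | ite_false _ _ hp => obtain ⟨rfl, rfl⟩ := ih hp; exact ⟨rfl, rfl⟩
  | loop_true _ h _ _ ih ih' =>
    cases h₂ with
    | loop_true _ _ hp hl =>
      obtain ⟨rfl, rfl⟩ := ih hp
      obtain ⟨rfl, rfl⟩ := ih' hl
      exact ⟨rfl, rfl⟩
    | loop_false _ h' => exact absurd h' h
  | loop_false _ h =>
    cases h₂ with
    | loop_true _ h' _ _ => exact absurd h h'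
    | loop_false => exact ⟨rfl, rfl⟩

/-! ### Weighted graphs, cycles, triangles -/

/-- A simple undirected graph on the nodes `0, …, n - 1` with natural edge weights
(the weight of a non-edge is never used). -/
structure WGraph (n : ℕ) where
  graph : SimpleGraph (Fin n)
  weight : Sym2 (Fin n) → ℕ

/-- All edge weights lie in `{1, …, B}`. -/
def WGraph.WeightsIn {n : ℕ} (G : WGraph n) (B : ℕ) : Prop :=
  ∀ e ∈ G.graph.edgeSet, 1 ≤ G.weight e ∧ G.weight e ≤ B

/-- The weight of a walk: the sum of the weights of its edges. -/
def WGraph.walkWeight {n : ℕ} (G : WGraph n) {u v : Fin n} (p : G.graph.Walk u v) : ℕ :=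
  (p.edges.map G.weight).sum

/-- `C` is a minimum weight (simple) cycle of `G`. -/
def WGraph.IsMinCycle {n : ℕ} (G : WGraph n) {r : Fin n} (C : G.graph.Walk r r) : Prop :=
  C.IsCycle ∧ ∀ (r' : Fin n) (C' : G.graph.Walk r' r'), C'.IsCycle →
    G.walkWeight C ≤ G.walkWeight C'

/-- The weights of all triangles in all graphs of a list. -/
def triangleWeights (Gs : List (Σ N : ℕ, WGraph N)) : Set ℕ :=
  {m | ∃ H ∈ Gs, ∃ x y z : Fin H.1, H.2.graph.Adj x y ∧ H.2.graph.Adj y z ∧ H.2.graph.Adj z x ∧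
    m = H.2.weight s(x, y) + H.2.weight s(y, z) + H.2.weight s(z, x)}

/-! ### Input and output conventions -/

open Classical in
/-- An entry of the weighted adjacency matrix; `0` marks a non-edge. -/
noncomputable def WGraph.entry {n : ℕ} (G : WGraph n) (u v : Fin n) : ℕ :=
  if G.graph.Adj u v then G.weight s(u, v) else 0

/-- The weighted adjacency matrix in row-major order. -/
noncomputable def WGraph.matrix {n : ℕ} (G : WGraph n) : List ℕ :=
  List.ofFn fun i : Fin (n * n) => G.entry i.divNat i.modNat

/-- The initial state: `n` and `M` in registers `0` and `1`, the matrix of `G` in the memory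
cells `0, …, n * n - 1`, and zero everywhere else. -/
noncomputable def inputState {n : ℕ} (G : WGraph n) (M : ℕ) : State where
  var x := if x = 0 then n else if x = 1 then M else 0
  mem a := G.matrix.getD a 0

/-- The output as a sequence of words: the number of nodes of the cycle, its nodes in cyclic
order, the offset, the number of graphs, and for each graph its number of nodes followed by
its matrix. -/
noncomputable def outputList {n : ℕ} {G : WGraph n} {r : Fin n} (C : G.graph.Walk r r) (τ : ℕ)
    (Gs : List (Σ N : ℕ, WGraph N)) : List ℕ :=
  C.length :: C.support.tail.map Fin.val ++
    τ :: Gs.length :: Gs.flatMap fun H => H.1 :: H.2.matrix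

/-- The list `L` is stored in the memory cells from address `a` on. -/
def StoredAt (s : State) (a : ℕ) (L : List ℕ) : Prop :=
  ∀ (i : ℕ) (h : i < L.length), s.mem (a + i) = L[i]

end MinCycle

open MinCycle

namespace MinCycle

open SimpleGraph

/-! ### Walk weights and splitting a cycle at its heaviest edge -/

namespace WGraph

variable {n : ℕ} (G : WGraph n)

/-! From every node `s` grow a tree of radius `t`. The graph is `Clear` at `t` if every root has a
tree in which each edge completely traversed within distance `t` is a tree edge; otherwise an
exploration meets a `Clash`, a traversed non-tree edge. Binary search finds `t` such that the graph
is clear at `t` and some root has a clash at `t + 1`.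

The clash closes a walk of weight at most `2 * (t + 1)`. It is a simple cycle because its ends lie
below different children of the root: inside the subtree of one child `f`, the edge would already
contradict the closed tree of radius `t` rooted at `f` (`TreeData.IsTree.below_subset`,
`TreeData.IsTree.fst_ne_of_clash`). This is the cycle that is output. If the minimum weight is not
below `2 * (t + 1)`, it is optimal.

Otherwise a minimum cycle has weight at most `2 * t + 1`. Removing a heaviest edge `uv` and walking
to the middle of what remains splits any cycle into `uv` and two paths from a common node `s`, each
of at most half the weight (`WGraph.exists_balanced_split`). Both paths then have length at most
`t`, so they are tree paths of the closed tree at `s`, and the weight of the cycle is `d(s,u) +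
w(u,v) + d(s,v)`. A triangle on three copies of the nodes carries this sum. To exclude triangles
whose two tree paths overlap, one demands that the first hops of `u` and `v` below `s` differ. Two
numbers below `n` differ in one of `n.size` binary digits, so there is one graph for each digit: `u`
must have digit `0` and `v` digit `1`. Then every triangle comes from a simple cycle, and the
minimum cycle occurs among them (`isLeast_triangleWeights`).

Distances can be as large as `n * M`, so a common offset `σ` is subtracted from both legs. The
splitting also shows that clearness at `t` forces every cycle to weigh more than `2 * t - M`
(`Clear.lt_walkWeight`). Hence the legs of a minimum cycle lie in a window of width `O(M)` below
`t`, and `σ = t + 1 - (K + 3) * M` leaves them positive and of size `O(M)`. If the minimum is at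
most `K * M`, then `t` is so small that `σ = 0`.

For the running time, each row of the matrix is radix sorted by weight. An exploration then takes
`O(n)` steps: each examined edge discovers a node, is the one edge to the parent, ends its row, or
is the clash that ends everything. Sorting and searching cost `O(n^2 log(nM))`, and writing the
graphs costs `O(n^2 log n)`. The programs are verified with a small total-correctness logic that
keeps stored words below `B` and intermediate values below `B ^ 16`. -/

@[simp] theorem walkWeight_nil (u : Fin n) : G.walkWeight (Walk.nil : G.graph.Walk u u) = 0 := rfl

@[simp] theorem walkWeight_cons {u v w : Fin n} (h : G.graph.Adj u v) (p : G.graph.Walk v w) :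
    G.walkWeight (Walk.cons h p) = G.weight s(u, v) + G.walkWeight p := by
  simp [walkWeight]

@[simp] theorem walkWeight_append {u v w : Fin n} (p : G.graph.Walk u v) (q : G.graph.Walk v w) :
    G.walkWeight (p.append q) = G.walkWeight p + G.walkWeight q := by
  simp [walkWeight, Walk.edges_append]

@[simp] theorem walkWeight_reverse {u v : Fin n} (p : G.graph.Walk u v) :
    G.walkWeight p.reverse = G.walkWeight p := by
  simp [walkWeight, Walk.edges_reverse, List.sum_reverse]

variable {G}

theorem walkWeight_le_length_mul {B : ℕ} (hG : G.WeightsIn B) {u v : Fin n}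
    (p : G.graph.Walk u v) : G.walkWeight p ≤ p.length * B := by
  induction p with
  | nil => simp
  | cons h p ih =>
    have := (hG _ ((SimpleGraph.mem_edgeSet _).2 h)).2
    simp only [walkWeight_cons, Walk.length_cons]
    nlinarith

/-- A cycle can be rotated and reversed so that a prescribed edge comes first. -/
theorem exists_cons_of_mem_edges {r : Fin n} {C : G.graph.Walk r r} (hC : C.IsCycle)
    {e : Sym2 (Fin n)} (he : e ∈ C.edges) :
    ∃ (a b : Fin n) (h : G.graph.Adj a b) (p : G.graph.Walk b a), s(a, b) = e ∧
      (Walk.cons h p).IsCycle ∧ (Walk.cons h p).edges.Perm C.edges := by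
  induction e using Sym2.ind with
  | _ a b =>
  have ha : a ∈ C.support := Walk.fst_mem_support_of_mem_edges _ he
  have hper := (C.rotate_edges a ha).perm
  have hcyc : (C.rotate a ha).IsCycle := hC.rotate ha
  have he' : s(a, b) ∈ (C.rotate a ha).edges := hper.mem_iff.2 he
  generalize C.rotate a ha = D at *
  cases D with
  | nil => simp at hcyc
  | @cons _ x _ h p =>
    by_cases hx : s(a, b) = s(a, x)
    · exact ⟨a, x, h, p, hx.symm, hcyc, hper⟩
    have hep : s(a, b) ∈ p.reverse.edges := by
      rw [Walk.edges_reverse, List.mem_reverse]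
      simpa [hx] using he'
    have hpp : p.reverse.IsPath := (Walk.isPath_reverse_iff _).2
      ((Walk.cons_isCycle_iff _ _).1 hcyc).1
    have hrev := hcyc.reverse
    rw [Walk.reverse_cons] at hrev
    have hper' : (p.reverse.append (Walk.cons h.symm Walk.nil)).edges.Perm C.edges := by
      rw [← Walk.reverse_cons h p, Walk.edges_reverse]
      exact (List.reverse_perm _).trans hper
    generalize p.reverse = q at *
    cases q with
    | nil => simp at hep
    | @cons _ y _ h' q =>
      -- A path has only one edge at its start, so an edge at `a` on the reversed path must be its
      -- first edge.
      have hby := hpp.eq_snd_of_mem_edges hep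
      simp only [Walk.snd_cons] at hby
      subst hby
      exact ⟨a, b, h', _, rfl, hrev, hper'⟩

/-- Walk along `p` as long as the accumulated weight `α` stays within half of `W`. When the next
edge would exceed half, the part after that edge together with the removed edge, of weight `w`, is
less than half. No edge of `p` is heavier than `w`, so exchanging the removed edge for the next one
keeps the remainder within half. -/
theorem exists_balanced_vertex {W w : ℕ} {a x : Fin n} (p : G.graph.Walk x a) (α : ℕ)
    (hw : ∀ e ∈ p.edges, G.weight e ≤ w) (hp : p.IsPath) (hx : x ≠ a) (hα : 2 * α ≤ W)
    (hW : α + G.walkWeight p + w = W) :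
    ∃ (s : Fin n) (p₁ : G.graph.Walk x s) (p₂ : G.graph.Walk s a), p = p₁.append p₂ ∧ s ≠ a ∧
      2 * (α + G.walkWeight p₁) ≤ W ∧ 2 * G.walkWeight p₂ ≤ W := by
  induction p generalizing α with
  | nil => exact absurd rfl hx
  | @cons x y a h p ih =>
    simp only [walkWeight_cons] at hW
    have he : G.weight s(x, y) ≤ w := hw _ (by simp)
    have hp' := (Walk.cons_isPath_iff h p).1 hp
    by_cases hy : y = a
    · subst hy
      rw [Walk.isPath_iff_nil.1 hp'.1 |>.eq_nil] at *
      refine ⟨x, Walk.nil, Walk.cons h Walk.nil, rfl, hx, by simpa using hα, ?_⟩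
      simp at hW ⊢
      omega
    by_cases hα' : 2 * (α + G.weight s(x, y)) ≤ W
    · obtain ⟨s, p₁, p₂, h1, h2, h3, h4⟩ := ih (α + G.weight s(x, y))
        (fun e he => hw e (by simp [he])) hp'.1 hy hα' (by omega)
      refine ⟨s, Walk.cons h p₁, p₂, by simp [h1], h2, ?_, h4⟩
      simp only [walkWeight_cons]
      omega
    · exact ⟨x, Walk.nil, Walk.cons h p, rfl, hx, by simpa using hα, by simp; omega⟩

/-- Every cycle consists of an edge `uv` and two internally disjoint paths from `u` and `v` to a
third vertex `s`, each of at most half the total weight. -/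
theorem exists_balanced_split {r : Fin n} {C : G.graph.Walk r r} (hC : C.IsCycle) :
    ∃ (s u v : Fin n) (p : G.graph.Walk u s) (q : G.graph.Walk v s), p.IsPath ∧ q.IsPath ∧
      G.graph.Adj u v ∧ u ≠ s ∧ v ≠ s ∧ (∀ x ∈ p.support, x ∈ q.support → x = s) ∧
      G.walkWeight p + G.weight s(u, v) + G.walkWeight q = G.walkWeight C ∧
      2 * G.walkWeight p ≤ G.walkWeight C ∧ 2 * G.walkWeight q ≤ G.walkWeight C := by
  have hne : C.edges.toFinset.Nonempty := by
    rw [List.toFinset_nonempty_iff]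
    intro h0
    have := hC.three_le_length
    rw [← Walk.length_edges, h0] at this
    simp at this
  obtain ⟨e, he, hmax⟩ := Finset.exists_max_image C.edges.toFinset G.weight hne
  rw [List.mem_toFinset] at he
  obtain ⟨a, b, h, p, rfl, hcyc, hper⟩ := exists_cons_of_mem_edges hC he
  have hwt : G.weight s(a, b) + G.walkWeight p = G.walkWeight C := by
    rw [← walkWeight_cons (h := h)]
    exact (hper.map _).sum_eq
  have hlen := hcyc.three_le_length
  have hpath := ((Walk.cons_isCycle_iff _ _).1 hcyc).1
  have hmax' : ∀ e ∈ p.edges, G.weight e ≤ G.weight s(a, b) := fun e he =>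
    hmax e (List.mem_toFinset.2 (hper.mem_iff.1 (by simp [he])))
  cases p with
  | nil => simp at hlen
  | @cons _ x _ h' p =>
    have hp' := (Walk.cons_isPath_iff h' p).1 hpath
    have hxa : x ≠ a := by
      rintro rfl
      rw [Walk.isPath_iff_nil.1 hp'.1 |>.eq_nil] at hlen
      simp at hlen
    have h1 : G.weight s(b, x) ≤ G.weight s(a, b) := hmax' _ (by simp)
    simp only [walkWeight_cons] at hwt
    -- The walk starts one node after `b`, with `α` the weight of the edge `bx`, so that `s` differs
    -- from `b`. This start is within half because the removed edge `ab` is at least as heavy as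
    -- `bx`.
    obtain ⟨s, p₁, p₂, rfl, hs, hw1, hw2⟩ := exists_balanced_vertex
      (W := G.walkWeight C) p (G.weight s(b, x))
      (fun e he => hmax' e (by simp [he])) hp'.1 hxa (by omega) (by omega)
    simp only [walkWeight_append] at hwt
    have hsplit : (Walk.cons h' (p₁.append p₂)) = (Walk.cons h' p₁).append p₂ := rfl
    rw [hsplit] at hpath
    refine ⟨s, a, b, p₂.reverse, Walk.cons h' p₁, ?_, hpath.of_append_left, h, hs.symm, ?_, ?_,
      ?_, by simpa using hw2, by simpa using hw1⟩
    · exact (Walk.isPath_reverse_iff _).2 hpath.of_append_right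
    · rintro rfl
      exact hp'.2 (Walk.support_subset_support_append_left _ _ (Walk.end_mem_support _))
    · intro y hy hy'
      by_contra hys
      rw [Walk.support_reverse, List.mem_reverse] at hy
      exact Walk.IsPath.ne_of_mem_support_of_append hpath hys hy' hy rfl
    · simp only [walkWeight_reverse, walkWeight_cons]
      omega

end WGraph

/-! ### Exploration trees -/

/-- The data recorded while exploring from a root: the visited nodes and for each of them its
parent, its distance and its depth below the root, and the child of the root above it. -/
structure TreeData where
  vis : ℕ → Prop
  par : ℕ → ℕ
  dist : ℕ → ℕ
  dep : ℕ → ℕ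
  fst : ℕ → ℕ

/-- `D` is a tree of radius at most `t` on nodes below `n`, rooted at `s`. -/
structure TreeData.IsTree (D : TreeData) (n : ℕ) (key : ℕ → ℕ → ℕ) (s t : ℕ) : Prop where
  lt : ∀ v, D.vis v → v < n
  vis_root : D.vis s
  par_root : D.par s = s
  dist_root : D.dist s = 0
  dep_root : D.dep s = 0
  fst_root : D.fst s = s
  vis_par : ∀ v, D.vis v → v ≠ s → D.vis (D.par v)
  dist_eq : ∀ v, D.vis v → v ≠ s → D.dist v = D.dist (D.par v) + key (D.par v) v
  dep_eq : ∀ v, D.vis v → v ≠ s → D.dep v = D.dep (D.par v) + 1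
  fst_eq : ∀ v, D.vis v → v ≠ s → D.fst v = if D.par v = s then v else D.fst (D.par v)
  dist_le : ∀ v, D.vis v → D.dist v ≤ t

/-- Every edge that is completely traversed within distance `t` is a tree edge. -/
def TreeData.Closed (D : TreeData) (n : ℕ) (key : ℕ → ℕ → ℕ) (t : ℕ) : Prop :=
  ∀ u v, D.vis u → v < n → D.dist u + key u v ≤ t → D.vis v ∧ (v = D.par u ∨ D.par v = u)

/-- The edge `uv` is traversed within distance `t` although it is not a tree edge. -/
structure TreeData.Clash (D : TreeData) (key : ℕ → ℕ → ℕ) (t u v : ℕ) : Prop where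
  vis_left : D.vis u
  vis_right : D.vis v
  le : D.dist u + key u v ≤ t
  ne_par_left : v ≠ D.par u
  ne_par_right : u ≠ D.par v

/-- No exploration of radius `t` meets a cycle. -/
def Clear (n : ℕ) (key : ℕ → ℕ → ℕ) (t : ℕ) : Prop :=
  ∀ s < n, ∃ D : TreeData, D.IsTree n key s t ∧ D.Closed n key t

/-! ### Comparing exploration trees with different roots -/

namespace TreeData.IsTree

variable {D E : TreeData} {n s t f : ℕ} {key : ℕ → ℕ → ℕ}

theorem fst_ne_root (hD : D.IsTree n key s t) : ∀ k v, D.dep v = k → D.vis v → v ≠ s →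
    D.fst v ≠ s := by
  intro k
  induction k with
  | zero =>
    intro v hk hv hvs
    have := hD.dep_eq v hv hvs
    omega
  | succ k ih =>
    intro v hk hv hvs
    rw [hD.fst_eq v hv hvs]
    have := hD.dep_eq v hv hvs
    split_ifs with h
    · exact hvs
    · exact ih _ (by omega) (hD.vis_par v hv hvs) h

theorem vis_fst (hD : D.IsTree n key s t) : ∀ k v, D.dep v = k → D.vis v → v ≠ s →
    D.vis (D.fst v) ∧ D.fst v ≠ s ∧ D.par (D.fst v) = s := by
  intro k
  induction k with
  | zero =>
    intro v hk hv hvs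
    have := hD.dep_eq v hv hvs
    omega
  | succ k ih =>
    intro v hk hv hvs
    rw [hD.fst_eq v hv hvs]
    have := hD.dep_eq v hv hvs
    split_ifs with h
    · exact ⟨hv, hvs, h⟩
    · exact ih _ (by omega) (hD.vis_par v hv hvs) h

theorem dep_pos (hD : D.IsTree n key s t) {v : ℕ} (hv : D.vis v) (hvs : v ≠ s) :
    0 < D.dep v := by
  have := hD.dep_eq v hv hvs
  omega

/-- The part of a tree below `f` is contained in every closed tree rooted at `f` whose radius is
large enough. -/
theorem below_subset (hD : D.IsTree n key s t) {t' : ℕ} (hE : E.IsTree n key f t')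
    (hcl : E.Closed n key t') (hf : D.vis f) (hfs : f = s ∨ D.par f = s)
    (ht : t ≤ t' + D.dist f) : ∀ k v, D.dep v = k → D.vis v → (f = s ∨ D.fst v = f) →
      E.vis v ∧ E.dist v + D.dist f = D.dist v ∧ (v ≠ f → E.par v = D.par v) := by
  intro k
  induction k using Nat.strong_induction_on with
  | _ k ih =>
  intro v hk hv hvf
  by_cases hvf' : v = f
  · subst hvf'
    exact ⟨hE.vis_root, by simp [hE.dist_root], fun h => absurd rfl h⟩
  have hvs : v ≠ s := by
    rintro rfl
    rcases hvf with h | h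
    · exact hvf' h.symm
    · exact hvf' (hD.fst_root ▸ h)
  have hdep := hD.dep_eq v hv hvs
  have hpar : f = s ∨ D.fst (D.par v) = f := by
    rcases hvf with h | h
    · exact Or.inl h
    · right
      rw [hD.fst_eq v hv hvs] at h
      split_ifs at h with h'
      · exact absurd h hvf'
      · exact h
  obtain ⟨h1, h2, h3⟩ := ih _ (by omega) (D.par v) rfl (hD.vis_par v hv hvs) hpar
  have hdist := hD.dist_eq v hv hvs
  have hle := hD.dist_le v hv
  obtain ⟨h4, h5⟩ := hcl _ v h1 (hD.lt v hv) (by omega)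
  -- The other alternative, that `v` is the parent of `D.par v` in `E`, would make `v` the root of
  -- `E` or its own grandparent in `D`.
  have hpv : E.par v = D.par v := by
    rcases h5 with h5 | h5
    · exfalso
      by_cases hpf : D.par v = f
      · rw [hpf, hE.par_root] at h5
        exact hvf' h5
      · rw [h3 hpf] at h5
        have hps : D.par v ≠ s := by
          intro hps
          rw [hps, hD.par_root] at h5
          exact hvs h5
        have := hD.dep_eq _ (hD.vis_par v hv hvs) hps
        rw [← h5] at this
        omega
    · exact h5
  refine ⟨h4, ?_, fun _ => hpv⟩
  have := hE.dist_eq v h4 hvf'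
  rw [hpv] at this
  omega

/-- A closed tree rooted at `f` of sufficient radius excludes clashes below `f`. -/
theorem not_clash_below (hD : D.IsTree n key s t) {t' : ℕ} (hE : E.IsTree n key f t')
    (hcl : E.Closed n key t') (hf : D.vis f) (hfs : f = s ∨ D.par f = s)
    (ht : t ≤ t' + D.dist f) {u v : ℕ} (huv : D.Clash key t u v) (hne : u ≠ v)
    (hu : f = s ∨ D.fst u = f) (hv : f = s ∨ D.fst v = f) : False := by
  have hb := hD.below_subset hE hcl hf hfs ht
  obtain ⟨h1, h2, h3⟩ := hb _ u rfl huv.vis_left hu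
  obtain ⟨h4, h5, h6⟩ := hb _ v rfl huv.vis_right hv
  have hle := huv.le
  rcases (hcl u v h1 (hD.lt v huv.vis_right) (by omega)).2 with h | h
  · by_cases huf : u = f
    · subst huf
      rw [hE.par_root] at h
      exact hne h.symm
    · exact huv.ne_par_left (h.trans (h3 huf))
  · by_cases hvf : v = f
    · subst hvf
      rw [hE.par_root] at h
      exact hne h.symm
    · exact huv.ne_par_right (h.symm.trans (h6 hvf))

/-- A clash in one tree rules out every closed tree with the same root: such a tree would have to
agree with the given one on all its nodes. So the outcome of an exploration does not depend on the
order in which nodes are discovered. -/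
theorem not_clear_of_clash (hD : D.IsTree n key s t) {u v : ℕ} (huv : D.Clash key t u v)
    (hne : u ≠ v) : ¬ Clear n key t := by
  intro h
  obtain ⟨E, hE, hcl⟩ := h s (hD.lt s hD.vis_root)
  exact hD.not_clash_below hE hcl hD.vis_root (Or.inl rfl) (by omega) huv hne (Or.inl rfl)
    (Or.inl rfl)

/-- At the smallest radius with a clash, the two ends of the clash lie below different children
of the root. -/
theorem fst_ne_of_clash (hD : D.IsTree n key s (t + 1)) {u v : ℕ}
    (huv : D.Clash key (t + 1) u v) (hne : u ≠ v) (hpos : ∀ x y, 1 ≤ key x y)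
    (hclear : Clear n key t) : D.fst u ≠ D.fst v := by
  intro hf
  by_cases hus : u = s
  · subst hus
    rw [hD.fst_root] at hf
    exact hD.fst_ne_root _ v rfl huv.vis_right hne.symm hf.symm
  obtain ⟨h1, h2, h3⟩ := hD.vis_fst _ u rfl huv.vis_left hus
  obtain ⟨E, hE, hcl⟩ := hclear _ (hD.lt _ h1)
  have hd := hD.dist_eq _ h1 h2
  -- The child is at distance at least `1` from the root, so a tree of radius `t + 1` extends at
  -- most `t` below it. This is where the minimality of the radius enters.
  have := hpos (D.par (D.fst u)) (D.fst u)
  exact hD.not_clash_below hE hcl h1 (Or.inr h3) (by omega) huv hne (Or.inr rfl) (Or.inr hf.symm)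

end TreeData.IsTree

/-! ### Keys: edge weights, with a large value for non-edges -/

/-- The weight of the edge `uv`, or `I` if there is no such edge. -/
noncomputable def WGraph.key {n : ℕ} (G : WGraph n) (I u v : ℕ) : ℕ :=
  if h : u < n ∧ v < n then
    if G.entry ⟨u, h.1⟩ ⟨v, h.2⟩ = 0 then I else G.entry ⟨u, h.1⟩ ⟨v, h.2⟩
  else I

namespace WGraph

variable {n M I t : ℕ} {G : WGraph n}

theorem key_of_adj (hG : G.WeightsIn M) {u v : Fin n} (h : G.graph.Adj u v) :
    G.key I u v = G.weight s(u, v) := by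
  have := (hG _ ((SimpleGraph.mem_edgeSet _).2 h)).1
  simp [key, entry, h]
  omega

theorem entry_comm (u v : Fin n) : G.entry u v = G.entry v u := by
  unfold entry
  by_cases h : G.graph.Adj u v
  · rw [if_pos h, if_pos h.symm, Sym2.eq_swap]
  · rw [if_neg h, if_neg (fun h' => h h'.symm)]

theorem key_comm (u v : ℕ) : G.key I u v = G.key I v u := by
  unfold key
  by_cases h : u < n ∧ v < n
  · rw [dif_pos h, dif_pos h.symm, entry_comm]
  · rw [dif_neg h, dif_neg (fun h' => h h'.symm)]

theorem key_pos (hI : 1 ≤ I) (u v : ℕ) : 1 ≤ G.key I u v := by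
  unfold key
  split_ifs <;> omega

theorem adj_of_key_lt {u v : Fin n} (h : G.key I u v < I) : G.graph.Adj u v := by
  by_contra hn
  simp [key, entry, hn] at h

/-- A loop counts as a non-edge. Hence a clash within a radius below `I` has two different ends. -/
theorem key_self (u : ℕ) : G.key I u u = I := by
  unfold key
  split_ifs with h1 h2
  · rfl
  · simp [entry] at h2
  · rfl

end WGraph

/-! ### Tree paths and cycles in the weighted graph -/

namespace TreeData.IsTree

variable {D : TreeData} {n s t I M : ℕ} {G : WGraph n}

/-- The list of ancestors of `v`, from `v` up to the root. -/
def _root_.MinCycle.TreeData.ancestors (D : TreeData) (v : ℕ) : List ℕ :=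
  (List.range (D.dep v + 1)).map fun i => D.par^[i] v

theorem ancestors_root (hD : D.IsTree n (G.key I) s t) : D.ancestors s = [s] := by
  simp [TreeData.ancestors, hD.dep_root]

theorem ancestors_eq_cons (hD : D.IsTree n (G.key I) s t) {v : ℕ} (hv : D.vis v) (hvs : v ≠ s) :
    D.ancestors v = v :: D.ancestors (D.par v) := by
  rw [TreeData.ancestors, hD.dep_eq v hv hvs, List.range_succ_eq_map]
  simp [TreeData.ancestors, Function.comp_def]

/-- Follow the parents up to the root; depths decrease strictly, so no node repeats. The last two
clauses are used to close cycles: all nodes except the root share the first hop of `v`, and all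
edges are tree edges. -/
theorem exists_path (hD : D.IsTree n (G.key I) s t) (hG : G.WeightsIn M) (hI : t < I)
    (s' : Fin n) (hs : s'.val = s) :
    ∀ k (v : Fin n), D.dep v = k → D.vis v → ∃ p : G.graph.Walk v s', p.IsPath ∧
      G.walkWeight p = D.dist v ∧ p.support.map Fin.val = D.ancestors v ∧
      (∀ x ∈ p.support, D.dep x ≤ D.dep v ∧ (x = s' ∨ D.fst x = D.fst v)) ∧
      (∀ x y : Fin n, s(x, y) ∈ p.edges → y.val = D.par x ∨ x.val = D.par y) := by
  intro k
  induction k with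
  | zero =>
    intro v hk hv
    have hvs : v = s' := by
      by_contra h
      have := hD.dep_pos hv (fun h' => h (Fin.ext (h'.trans hs.symm)))
      omega
    subst hvs
    exact ⟨Walk.nil, by simp, by simp [hs, hD.dist_root], by simp [hs, hD.ancestors_root],
      by simp, by simp⟩
  | succ k ih =>
    intro v hk hv
    have hvs : (v : ℕ) ≠ s := by
      intro h
      rw [h, hD.dep_root] at hk
      omega
    have hdep := hD.dep_eq v hv hvs
    have hdist := hD.dist_eq v hv hvs
    have hfst := hD.fst_eq v hv hvs
    have hpv := hD.vis_par v hv hvs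
    have hle := hD.dist_le v hv
    obtain ⟨y, hy⟩ : ∃ y : Fin n, y.val = D.par v := ⟨⟨_, hD.lt _ hpv⟩, rfl⟩
    have hanc := hD.ancestors_eq_cons hv hvs
    rw [← hy] at hdep hdist hfst hpv hanc
    obtain ⟨p, hp, hw, hsup, hx, he⟩ := ih y (by omega) hpv
    rw [WGraph.key_comm] at hdist
    -- The last step is no longer than the radius, which is below the key `I` of non-edges, so it is
    -- a real edge.
    have hadj : G.graph.Adj v y := WGraph.adj_of_key_lt (I := I) (by omega)
    refine ⟨Walk.cons hadj p, ?_, ?_, ?_, ?_, ?_⟩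
    · rw [Walk.cons_isPath_iff]
      refine ⟨hp, fun hvp => ?_⟩
      have := (hx v hvp).1
      omega
    · rw [WGraph.walkWeight_cons, hw, hdist, WGraph.key_of_adj hG hadj, add_comm]
    · simp [hsup, hanc]
    · intro x hx'
      rw [Walk.support_cons, List.mem_cons] at hx'
      rcases hx' with rfl | hx'
      · exact ⟨le_rfl, Or.inr rfl⟩
      · obtain ⟨h1, h2⟩ := hx x hx'
        refine ⟨by omega, ?_⟩
        rcases h2 with h2 | h2
        · exact Or.inl h2
        · by_cases hys : y.val = s
          · rw [hys, hD.dep_root] at h1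
            left
            by_contra hne
            have hpath := hp
            obtain rfl : y = s' := Fin.ext (hys.trans hs.symm)
            rw [Walk.isPath_iff_nil.1 hp |>.eq_nil] at hx'
            simp at hx'
            exact hne hx'
          · rw [if_neg hys] at hfst
            exact Or.inr (h2.trans hfst.symm)
    · intro a b hab
      rw [Walk.edges_cons, List.mem_cons] at hab
      rcases hab with hab | hab
      · rcases Sym2.eq_iff.1 hab with ⟨rfl, rfl⟩ | ⟨rfl, rfl⟩
        · exact Or.inl hy
        · exact Or.inr hy
      · exact he a b hab

/-- A non-tree edge between the subtrees of different children of the root closes a cycle. -/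
theorem exists_cycle (hD : D.IsTree n (G.key I) s t) (hG : G.WeightsIn M) (hI : t < I)
    (hs : s < n) {u v : Fin n} (hu : D.vis u) (hv : D.vis v) (huv : G.graph.Adj v u)
    (hpu : v.val ≠ D.par u) (hpv : u.val ≠ D.par v) (hf : D.fst u ≠ D.fst v) :
    ∃ C : G.graph.Walk v v, C.IsCycle ∧
      G.walkWeight C = D.dist u + G.weight s(u, v) + D.dist v ∧ C.length = D.dep u + D.dep v + 1 ∧
      C.support.tail.map Fin.val = D.ancestors u ++ (D.ancestors v).reverse.tail := by
  obtain ⟨p, hp, hpw, hps, hpx, hpe⟩ := hD.exists_path hG hI ⟨s, hs⟩ rfl _ u rfl hu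
  obtain ⟨q, hq, hqw, hqs, hqx, hqe⟩ := hD.exists_path hG hI ⟨s, hs⟩ rfl _ v rfl hv
  have hpath : (p.append q.reverse).IsPath := by
    rw [Walk.isPath_def, Walk.support_append, List.nodup_append']
    refine ⟨hp.support_nodup, hq.reverse.support_nodup.tail, fun x hx hx' => ?_⟩
    have hxs : x ≠ ⟨s, hs⟩ := by
      rintro rfl
      have := hq.reverse.support_nodup
      rw [← Walk.cons_tail_support, List.nodup_cons] at this
      exact this.1 hx'
    have hxq : x ∈ q.support := by
      have := List.mem_of_mem_tail hx'
      rwa [Walk.support_reverse, List.mem_reverse] at this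
    -- A common node other than the root would lie below two different children of the root.
    exact hf (((hpx x hx).2.resolve_left hxs).symm.trans ((hqx x hxq).2.resolve_left hxs))
  have hlen : ∀ {a : Fin n} {r : G.graph.Walk a ⟨s, hs⟩},
      r.support.map Fin.val = D.ancestors a → r.length = D.dep a := by
    intro a r hr
    have := congrArg List.length hr
    simpa [TreeData.ancestors] using this
  refine ⟨Walk.cons huv (p.append q.reverse), ?_, ?_, ?_, ?_⟩
  · rw [Walk.cons_isCycle_iff]
    refine ⟨hpath, ?_⟩
    rw [Walk.edges_append, Walk.edges_reverse, List.mem_append, List.mem_reverse]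
    rintro (h | h)
    · rcases hpe _ _ h with h | h
      · exact hpv h
      · exact hpu h
    · rcases hqe _ _ h with h | h
      · exact hpv h
      · exact hpu h
  · simp [hpw, hqw, Sym2.eq_swap (a := u)]
    omega
  · simp [hlen hps, hlen hqs]
  · rw [Walk.support_cons, List.tail_cons, Walk.support_append, List.map_append, hps,
      Walk.support_reverse, List.map_tail, List.map_reverse, hqs]

/-- A path of length at most the radius of a closed tree is a path of the tree. -/
theorem vis_of_path (hD : D.IsTree n (G.key I) s t) (hcl : D.Closed n (G.key I) t)
    (hG : G.WeightsIn M) {s' : Fin n} (hs : s'.val = s) {u : Fin n} (p : G.graph.Walk u s')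
    (hp : p.IsPath) (hw : G.walkWeight p ≤ t) :
    D.vis u ∧ D.dist u = G.walkWeight p ∧ (∃ x ∈ p.support, D.par u = x) ∧
      ∃ x ∈ p.support, D.fst u = x := by
  induction p with
  | nil =>
    subst hs
    exact ⟨hD.vis_root, by simp [hD.dist_root], ⟨_, by simp, hD.par_root⟩,
      ⟨_, by simp, hD.fst_root⟩⟩
  | @cons u y s' h p ih =>
    rw [Walk.cons_isPath_iff] at hp
    rw [WGraph.walkWeight_cons] at hw
    obtain ⟨h1, h2, ⟨x, hx, hxp⟩, ⟨z, hz, hzf⟩⟩ := ih hs hp.1 (by omega)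
    have hk := WGraph.key_of_adj (I := I) hG h
    rw [WGraph.key_comm] at hk
    obtain ⟨h3, h4⟩ := hcl y u h1 u.2 (by omega)
    have hus : (u : ℕ) ≠ s := by
      rintro h
      obtain rfl : u = s' := Fin.ext (h.trans hs.symm)
      exact hp.2 (Walk.end_mem_support _)
    have hpar : D.par u = y := by
      rcases h4 with h4 | h4
      · rw [hxp] at h4
        obtain rfl := Fin.ext h4
        exact absurd hx hp.2
      · exact h4
    refine ⟨h3, ?_, ⟨y, by simp, hpar⟩, ?_⟩
    · rw [hD.dist_eq u h3 hus, hpar, h2, WGraph.walkWeight_cons]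
      omega
    · rw [hD.fst_eq u h3 hus]
      split_ifs
      · exact ⟨u, by simp, rfl⟩
      · rw [hpar]
        exact ⟨z, by simp [hz], hzf⟩

end TreeData.IsTree

/-- Where no exploration of radius `t` meets a cycle, all cycles are heavy. -/
theorem Clear.lt_walkWeight {n M I t : ℕ} {G : WGraph n} (h : Clear n (G.key I) t)
    (hG : G.WeightsIn M) {r : Fin n} {C : G.graph.Walk r r} (hC : C.IsCycle) :
    2 * t < G.walkWeight C + M := by
  by_contra! hlt
  obtain ⟨s, u, v, p, q, hp, hq, huv, hus, hvs, hpq, hw, hwp, hwq⟩ :=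
    WGraph.exists_balanced_split hC
  obtain ⟨D, hD, hcl⟩ := h s s.2
  have hM := (hG _ ((SimpleGraph.mem_edgeSet _).2 huv)).2
  obtain ⟨hu, hdu, ⟨x, hx, hpx⟩, -⟩ := hD.vis_of_path hcl hG rfl p hp (by omega)
  obtain ⟨hv, hdv, ⟨y, hy, hpy⟩, -⟩ := hD.vis_of_path hcl hG rfl q hq (by omega)
  have hk := WGraph.key_of_adj (I := I) hG huv
  -- Traverse `uv` from the end of the lighter leg: twice that leg plus `2 * w(u,v)` is at most the
  -- cycle weight plus `M`, hence at most `2 * t`. So `uv` would be a tree edge and one of its ends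
  -- would lie on both legs.
  have hpar : v.val = D.par u ∨ D.par v = u.val := by
    rcases le_total (G.walkWeight p) (G.walkWeight q) with hle | hle
    · exact (hcl u v hu v.2 (by omega)).2
    · have hk' := hk
      rw [WGraph.key_comm] at hk'
      exact (hcl v u hv u.2 (by omega)).2.symm.imp Eq.symm Eq.symm
  rcases hpar with h | h
  · rw [hpx] at h
    obtain rfl := Fin.ext h
    exact hvs (hpq _ hx (Walk.start_mem_support _))
  · rw [hpy] at h
    obtain rfl := Fin.ext h
    exact hus (hpq _ (Walk.start_mem_support _) hy)

/-- With positive keys the one-node tree is closed at radius `0`. This provides the lower end of the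
binary search. -/
theorem clear_zero {n : ℕ} {key : ℕ → ℕ → ℕ} (hpos : ∀ x y, 1 ≤ key x y) : Clear n key 0 := by
  intro s hs
  refine ⟨⟨fun v => v = s, fun v => v, fun _ => 0, fun _ => 0, fun v => v⟩, ?_, ?_⟩
  · constructor <;> simp +contextual [hs]
  · intro u v hu hv h
    have := hpos u v
    simp at h
    omega


/-! ### Encoding cycles by triangles -/

/-- The matrix of a graph on three copies of the nodes: copy `0` is joined to copies `1` and `2`
by reduced distances `D - σ`, as selected by a binary digit of `F`, and the copies `1` and `2`
are joined by the matrix `A`. -/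
def triEntry (n σ pw : ℕ) (A D F : ℕ → ℕ) (x y : ℕ) : ℕ :=
  if x / n = y / n then 0
  else if x / n = 0 then
    if F (x % n * n + y % n) / pw % 2 + 1 = y / n then D (x % n * n + y % n) - σ else 0
  else if y / n = 0 then
    if F (y % n * n + x % n) / pw % 2 + 1 = x / n then D (y % n * n + x % n) - σ else 0
  else A (x % n * n + y % n)

section TriGraph

variable {n σ pw : ℕ} {A D F : ℕ → ℕ}

theorem triEntry_comm (hA : ∀ u < n, ∀ v < n, A (u * n + v) = A (v * n + u)) (hn : 0 < n)
    (x y : ℕ) : triEntry n σ pw A D F x y = triEntry n σ pw A D F y x := by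
  unfold triEntry
  rw [hA _ (Nat.mod_lt x hn) _ (Nat.mod_lt y hn)]
  split_ifs <;> first | rfl | omega

/-- The graph with matrix `triEntry`. -/
def triGraph (n σ pw : ℕ) (A D F : ℕ → ℕ)
    (h : ∀ x y, triEntry n σ pw A D F x y = triEntry n σ pw A D F y x) : WGraph (3 * n) where
  graph :=
    { Adj := fun x y => triEntry n σ pw A D F x y ≠ 0
      symm := ⟨fun x y hxy => by rwa [h]⟩
      loopless := ⟨fun x hx => hx (by simp [triEntry])⟩ }
  weight := Sym2.lift ⟨fun x y => triEntry n σ pw A D F x y, fun x y => h x y⟩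

variable (h : ∀ x y, triEntry n σ pw A D F x y = triEntry n σ pw A D F y x)

theorem triGraph_adj {x y : Fin (3 * n)} :
    (triGraph n σ pw A D F h).graph.Adj x y ↔ triEntry n σ pw A D F x y ≠ 0 := Iff.rfl

theorem triGraph_weight (x y : Fin (3 * n)) :
    (triGraph n σ pw A D F h).weight s(x, y) = triEntry n σ pw A D F x y := rfl

theorem triGraph_entry (x y : Fin (3 * n)) :
    (triGraph n σ pw A D F h).entry x y = triEntry n σ pw A D F x y := by
  unfold WGraph.entry
  rw [triGraph_adj, triGraph_weight]
  split_ifs with h'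
  · rfl
  · exact (not_not.1 h').symm

theorem triGraph_matrix : (triGraph n σ pw A D F h).matrix =
    (List.range (3 * n * (3 * n))).map
      fun i => triEntry n σ pw A D F (i / (3 * n)) (i % (3 * n)) := by
  unfold WGraph.matrix
  simp only [triGraph_entry]
  refine List.ext_getElem (by simp) fun i h1 h2 => ?_
  simp

theorem triGraph_weightsIn {B : ℕ} (hn : 0 < n)
    (hA : ∀ u < n, ∀ v < n, A (u * n + v) ≤ B)
    (hD : ∀ u < n, ∀ v < n, D (u * n + v) - σ ≤ B) :
    (triGraph n σ pw A D F h).WeightsIn B := by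
  intro e he
  induction e using Sym2.ind with
  | _ x y =>
  rw [SimpleGraph.mem_edgeSet, triGraph_adj] at he
  rw [triGraph_weight]
  refine ⟨Nat.one_le_iff_ne_zero.2 he, ?_⟩
  unfold triEntry
  have hx := Nat.mod_lt x hn
  have hy := Nat.mod_lt y hn
  split_ifs <;> first | exact Nat.zero_le _ | exact hD _ hx _ hy | exact hD _ hy _ hx |
    exact hA _ hx _ hy

theorem triEntry_leg {s u i : ℕ} (hs : s < n) (hu : u < n) (hi : i = 1 ∨ i = 2) :
    triEntry n σ pw A D F s (i * n + u) =
      if F (s * n + u) / pw % 2 + 1 = i then D (s * n + u) - σ else 0 := by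
  have h1 : (i * n + u) / n = i := by
    rw [mul_comm, Nat.mul_add_div (by omega), Nat.div_eq_of_lt hu, add_zero]
  have h2 : (i * n + u) % n = u := by
    rw [mul_comm, Nat.mul_add_mod, Nat.mod_eq_of_lt hu]
  rw [triEntry, h1, h2, Nat.div_eq_of_lt hs, Nat.mod_eq_of_lt hs, if_neg (by omega), if_pos rfl]

theorem triEntry_base {u v : ℕ} (hu : u < n) (hv : v < n) :
    triEntry n σ pw A D F (1 * n + u) (2 * n + v) = A (u * n + v) := by
  have h1 : ∀ i w, w < n → (i * n + w) / n = i ∧ (i * n + w) % n = w := by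
    intro i w hw
    rw [mul_comm, Nat.mul_add_div (by omega), Nat.div_eq_of_lt hw, Nat.mul_add_mod,
      Nat.mod_eq_of_lt hw]
    exact ⟨rfl, rfl⟩
  rw [triEntry, (h1 1 u hu).1, (h1 1 u hu).2, (h1 2 v hv).1, (h1 2 v hv).2]
  simp

/-- The sum over the edges of a triangle is the same in every order, so it may be taken with the
corners in the copies `0`, `1`, `2`. -/
theorem exists_of_triangle {x y z : ℕ} (hx : x < 3 * n) (hy : y < 3 * n) (hz : z < 3 * n)
    (hxy : triEntry n σ pw A D F x y ≠ 0) (hyz : triEntry n σ pw A D F y z ≠ 0)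
    (hzx : triEntry n σ pw A D F z x ≠ 0)
    (h : ∀ x y, triEntry n σ pw A D F x y = triEntry n σ pw A D F y x) :
    ∃ s < n, ∃ u < n, ∃ v < n, F (s * n + u) / pw % 2 = 0 ∧ F (s * n + v) / pw % 2 = 1 ∧
      D (s * n + u) - σ ≠ 0 ∧ D (s * n + v) - σ ≠ 0 ∧ A (u * n + v) ≠ 0 ∧
      triEntry n σ pw A D F x y + triEntry n σ pw A D F y z + triEntry n σ pw A D F z x =
        (D (s * n + u) - σ) + A (u * n + v) + (D (s * n + v) - σ) := by
  have key : ∀ a b c : ℕ, a < 3 * n → b < 3 * n → c < 3 * n → a / n = 0 → b / n = 1 → c / n = 2 →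
      triEntry n σ pw A D F a b ≠ 0 → triEntry n σ pw A D F b c ≠ 0 →
      triEntry n σ pw A D F a c ≠ 0 →
      ∃ s < n, ∃ u < n, ∃ v < n, F (s * n + u) / pw % 2 = 0 ∧ F (s * n + v) / pw % 2 = 1 ∧
      D (s * n + u) - σ ≠ 0 ∧ D (s * n + v) - σ ≠ 0 ∧ A (u * n + v) ≠ 0 ∧
      triEntry n σ pw A D F a b + triEntry n σ pw A D F b c + triEntry n σ pw A D F a c =
        (D (s * n + u) - σ) + A (u * n + v) + (D (s * n + v) - σ) := by
    intro a b c ha hb hc ha0 hb1 hc2 hab hbc hac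
    have hn : 0 < n := by omega
    have ea : a = a % n := by have := Nat.div_add_mod a n; rw [ha0] at this; omega
    have eb : b = 1 * n + b % n := by
      have := Nat.div_add_mod b n; rw [hb1] at this; omega
    have ec : c = 2 * n + c % n := by
      have := Nat.div_add_mod c n; rw [hc2] at this; omega
    have la := Nat.mod_lt a hn
    have lb := Nat.mod_lt b hn
    have lc := Nat.mod_lt c hn
    generalize a % n = s at *
    generalize b % n = u at *
    generalize c % n = v at *
    subst ea eb ec
    rw [triEntry_leg la lb (Or.inl rfl)] at *
    rw [triEntry_leg la lc (Or.inr rfl)] at *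
    rw [triEntry_base lb lc] at *
    split_ifs at * with h1 h2
    all_goals first | exact absurd rfl hab | exact absurd rfl hac | skip
    exact ⟨_, la, u, lb, v, lc, by omega, by omega, hab, hac, hbc, by omega⟩
  have hn : 0 < n := by omega
  have hdiv : ∀ a, a < 3 * n → a / n = 0 ∨ a / n = 1 ∨ a / n = 2 := by
    intro a ha
    have : a / n < 3 := Nat.div_lt_of_lt_mul (by rwa [mul_comm])
    generalize a / n = q at *
    omega
  have hne : ∀ {a b}, triEntry n σ pw A D F a b ≠ 0 → a / n ≠ b / n := by
    intro a b hab he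
    exact hab (by rw [triEntry, if_pos he])
  have n1 := hne hxy
  have n2 := hne hyz
  have n3 := hne hzx
  have hyx := h x y ▸ hxy
  have hzy := h y z ▸ hyz
  have hxz := h z x ▸ hzx
  -- Adjacent nodes lie in different copies, so of the 27 placements of the corners only the six
  -- permutations survive; each is brought to the standard order by symmetry.
  rcases hdiv x hx with dx | dx | dx <;> rcases hdiv y hy with dy | dy | dy <;>
    rcases hdiv z hz with dz | dz | dz <;>
    first
    | exact absurd (dx.trans dy.symm) n1
    | exact absurd (dy.trans dz.symm) n2
    | exact absurd (dz.trans dx.symm) n3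
    | skip
  · obtain ⟨s, hs, u, hu, v, hv, h1, h2, h3, h4, h5, h6⟩ :=
      key _ _ _ hx hy hz dx dy dz hxy hyz hxz
    exact ⟨s, hs, u, hu, v, hv, h1, h2, h3, h4, h5, by rw [h z x]; omega⟩
  · obtain ⟨s, hs, u, hu, v, hv, h1, h2, h3, h4, h5, h6⟩ :=
      key _ _ _ hx hz hy dx dz dy hxz hzy hxy
    exact ⟨s, hs, u, hu, v, hv, h1, h2, h3, h4, h5, by rw [h y z, h z x]; omega⟩
  · obtain ⟨s, hs, u, hu, v, hv, h1, h2, h3, h4, h5, h6⟩ :=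
      key _ _ _ hy hx hz dy dx dz hyx hxz hyz
    exact ⟨s, hs, u, hu, v, hv, h1, h2, h3, h4, h5, by rw [h x y, h z x]; omega⟩
  · obtain ⟨s, hs, u, hu, v, hv, h1, h2, h3, h4, h5, h6⟩ :=
      key _ _ _ hz hx hy dz dx dy hzx hxy hzy
    exact ⟨s, hs, u, hu, v, hv, h1, h2, h3, h4, h5, by rw [h y z]; omega⟩
  · obtain ⟨s, hs, u, hu, v, hv, h1, h2, h3, h4, h5, h6⟩ :=
      key _ _ _ hy hz hx dy dz dx hyz hzx hyx
    exact ⟨s, hs, u, hu, v, hv, h1, h2, h3, h4, h5, by rw [h x y]; omega⟩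
  · obtain ⟨s, hs, u, hu, v, hv, h1, h2, h3, h4, h5, h6⟩ :=
      key _ _ _ hz hy hx dz dy dx hzy hyx hzx
    exact ⟨s, hs, u, hu, v, hv, h1, h2, h3, h4, h5, by rw [h x y, h y z]; omega⟩

end TriGraph

/-- The tables `D` and `F` hold the distances and first hops of closed trees of radius `t`. -/
def IsTable (n : ℕ) (key : ℕ → ℕ → ℕ) (t : ℕ) (D F : ℕ → ℕ) (s : ℕ) : Prop :=
  ∃ E : TreeData, E.IsTree n key s t ∧ E.Closed n key t ∧ ∀ v < n,
    (E.vis v → D (s * n + v) = E.dist v ∧ F (s * n + v) = E.fst v) ∧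
    (¬ E.vis v → D (s * n + v) = 0)

theorem IsTable.clear {n t : ℕ} {key : ℕ → ℕ → ℕ} {D F : ℕ → ℕ}
    (h : ∀ s < n, IsTable n key t D F s) : Clear n key t := fun s hs =>
  let ⟨E, h1, h2, _⟩ := h s hs
  ⟨E, h1, h2⟩

theorem IsTable.le {n t s v : ℕ} {key : ℕ → ℕ → ℕ} {D F : ℕ → ℕ}
    (h : IsTable n key t D F s) (hv : v < n) : D (s * n + v) ≤ t := by
  obtain ⟨E, h1, -, h3⟩ := h
  by_cases h : E.vis v
  · rw [((h3 v hv).1 h).1]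
    exact h1.dist_le v h
  · rw [(h3 v hv).2 h]
    omega

/-- If the minimum weight cycle is lighter than `2 * (t + 1)`, it is encoded by a triangle. -/
theorem isLeast_triangleWeights {n M I t σ : ℕ} {G : WGraph n} {A D F : ℕ → ℕ}
    (hG : G.WeightsIn M) (hI : t < I)
    (hA : ∀ u v : Fin n, A (u * n + v) = G.entry u v)
    (hT : ∀ s < n, IsTable n (G.key I) t D F s)
    (hsym : ∀ pw x y, triEntry n σ pw A D F x y = triEntry n σ pw A D F y x)
    {r : Fin n} {C : G.graph.Walk r r} (hC : G.IsMinCycle C)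
    (hlt : G.walkWeight C < 2 * (t + 1)) (hσ : σ + 2 * M ≤ t ∨ σ = 0) :
    ∃ m, IsLeast (triangleWeights ((List.range n.size).map fun b =>
      ⟨3 * n, triGraph n σ (2 ^ b) A D F (hsym (2 ^ b))⟩)) m ∧
      m + 2 * σ = G.walkWeight C := by
  have hlow := (IsTable.clear hT).lt_walkWeight hG hC.1
  obtain ⟨s, u, v, p, q, hp, hq, huv, hus, hvs, hpq, hw, hwp, hwq⟩ :=
    WGraph.exists_balanced_split hC.1
  have hM := hG _ ((SimpleGraph.mem_edgeSet _).2 huv)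
  obtain ⟨E, hE, hcl, hDF⟩ := hT s s.2
  obtain ⟨hu, hdu, -, ⟨x, hx, hfx⟩⟩ := hE.vis_of_path hcl hG rfl p hp (by omega)
  obtain ⟨hv, hdv, -, ⟨y, hy, hfy⟩⟩ := hE.vis_of_path hcl hG rfl q hq (by omega)
  have hus' : u.val ≠ s := fun h => hus (Fin.ext h)
  have hvs' : v.val ≠ s := fun h => hvs (Fin.ext h)
  have hfu := (hE.vis_fst _ u rfl hu hus')
  have hfv := (hE.vis_fst _ v rfl hv hvs')
  have hne : E.fst u ≠ E.fst v := by
    rw [hfx, hfy]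
    intro hxy
    obtain rfl := Fin.ext hxy
    apply hfu.2.1
    rw [hfx, hpq _ hx hy]
  have hkpos := WGraph.key_pos (G := G) (I := I) (by omega)
  have hdpos : ∀ w : Fin n, E.vis w → w.val ≠ s → 1 ≤ E.dist w := by
    intro w hw hws
    have := hE.dist_eq w hw hws
    have := hkpos (E.par w) w
    omega
  -- If `σ = 0`, positivity of distances suffices. Otherwise `p` weighs at least half of the cycle
  -- minus `M`, and the cycle weighs more than `2 * t - M`, so `p` exceeds `t - 2 * M`.
  have hσp : σ < G.walkWeight p := by
    have := hdpos u hu hus'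
    omega
  have hσq : σ < G.walkWeight q := by
    have := hdpos v hv hvs'
    omega
  -- This digit selects the graph that contains the triangle.
  obtain ⟨b, hb⟩ : ∃ b, (E.fst u).testBit b ≠ (E.fst v).testBit b := by
    by_contra! h
    exact hne (Nat.eq_of_testBit_eq h)
  have hbit : ∀ m, m < n → n.size ≤ b → m.testBit b = false := fun m hm hle =>
    Nat.testBit_lt_two_pow (hm.trans (Nat.size_le.1 hle))
  have hbn : b < n.size := by
    by_contra! hle
    exact hb (by rw [hbit _ (hE.lt _ hfu.1) hle, hbit _ (hE.lt _ hfv.1) hle])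
  have hDu : D (s * n + u) = G.walkWeight p ∧ F (s * n + u) = E.fst u := by
    rw [← hdu]; exact (hDF u u.2).1 hu
  have hDv : D (s * n + v) = G.walkWeight q ∧ F (s * n + v) = E.fst v := by
    rw [← hdv]; exact (hDF v v.2).1 hv
  have hentry : ∀ {a b : Fin n}, G.graph.Adj a b → A (a * n + b) = G.weight s(a, b) := by
    intro a b hab
    rw [hA, WGraph.entry, if_pos hab]
  refine ⟨G.walkWeight C - 2 * σ, ⟨?_, ?_⟩, by omega⟩
  · rw [triangleWeights]
    refine ⟨⟨3 * n, triGraph n σ (2 ^ b) A D F (hsym (2 ^ b))⟩,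
      List.mem_map.2 ⟨b, List.mem_range.2 hbn, rfl⟩, ?_⟩
    -- Stated for both orientations of the edge, since the end whose first hop has digit `0` must be
    -- placed in copy `1`.
    have main : ∀ u v : Fin n, G.graph.Adj u v → σ < D (s * n + u) → σ < D (s * n + v) →
        F (s * n + u) / 2 ^ b % 2 = 0 → F (s * n + v) / 2 ^ b % 2 = 1 →
        ∃ x y z : Fin (3 * n),
          (triGraph n σ (2 ^ b) A D F (hsym (2 ^ b))).graph.Adj x y ∧
          (triGraph n σ (2 ^ b) A D F (hsym (2 ^ b))).graph.Adj y z ∧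
          (triGraph n σ (2 ^ b) A D F (hsym (2 ^ b))).graph.Adj z x ∧
          D (s * n + u) + G.weight s(u, v) + D (s * n + v) - 2 * σ =
          (triGraph n σ (2 ^ b) A D F (hsym (2 ^ b))).weight s(x, y) +
          (triGraph n σ (2 ^ b) A D F (hsym (2 ^ b))).weight s(y, z) +
          (triGraph n σ (2 ^ b) A D F (hsym (2 ^ b))).weight s(z, x) := by
      intro u v huv h1 h2 h3 h4
      have ls := s.2
      have lu := u.2
      have lv := v.2
      have hM := hG _ ((SimpleGraph.mem_edgeSet _).2 huv)
      refine ⟨⟨s, by omega⟩, ⟨1 * n + u, by omega⟩, ⟨2 * n + v, by omega⟩, ?_⟩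
      simp only [triGraph_adj, triGraph_weight]
      rw [hsym _ (2 * n + v) s, triEntry_leg ls lu (Or.inl rfl), triEntry_leg ls lv (Or.inr rfl),
        triEntry_base lu lv, hentry huv, h3, h4]
      simp only [zero_add, if_true, Nat.reduceAdd]
      omega
    have hcase : (F (s * n + u) / 2 ^ b % 2 = 0 ∧ F (s * n + v) / 2 ^ b % 2 = 1) ∨
        (F (s * n + v) / 2 ^ b % 2 = 0 ∧ F (s * n + u) / 2 ^ b % 2 = 1) := by
      rw [hDu.2, hDv.2]
      rw [Nat.testBit_eq_decide_div_mod_eq, Nat.testBit_eq_decide_div_mod_eq] at hb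
      have h1 := Nat.mod_two_eq_zero_or_one (E.fst u / 2 ^ b)
      have h2 := Nat.mod_two_eq_zero_or_one (E.fst v / 2 ^ b)
      rcases h1 with h1 | h1 <;> rcases h2 with h2 | h2 <;> simp [h1, h2] at hb ⊢
    rcases hcase with ⟨h3, h4⟩ | ⟨h3, h4⟩
    · obtain ⟨x, y, z, h1, h2, h3, h4⟩ := main u v huv (by omega) (by omega) h3 h4
      refine ⟨x, y, z, h1, h2, h3, ?_⟩
      rw [← h4]
      omega
    · obtain ⟨x, y, z, h1, h2, h3, h4⟩ := main v u huv.symm (by omega) (by omega) h3 h4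
      refine ⟨x, y, z, h1, h2, h3, ?_⟩
      rw [← h4, Sym2.eq_swap (a := v)]
      omega
  · rintro m ⟨H, hH, x, y, z, hxy, hyz, hzx, rfl⟩
    obtain ⟨b, -, rfl⟩ := List.mem_map.1 hH
    simp only [triGraph_adj, triGraph_weight] at hxy hyz hzx ⊢
    obtain ⟨s, hs, u, hu, v, hv, h1, h2, h3, h4, h5, h6⟩ :=
      exists_of_triangle x.2 y.2 z.2 hxy hyz hzx (hsym _)
    rw [h6]
    obtain ⟨E, hE, hcl, hDF⟩ := hT s hs
    -- A positive reduced entry excludes both the root and the unvisited nodes, whose table entries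
    -- are `0`.
    have hvis : ∀ w < n, D (s * n + w) - σ ≠ 0 → E.vis w ∧ D (s * n + w) = E.dist w ∧
        F (s * n + w) = E.fst w ∧ w ≠ s := by
      intro w hw h0
      have hv : E.vis w := by
        by_contra hv
        rw [(hDF w hw).2 hv] at h0
        omega
      obtain ⟨e1, e2⟩ := (hDF w hw).1 hv
      refine ⟨hv, e1, e2, ?_⟩
      rintro rfl
      rw [e1, hE.dist_root] at h0
      omega
    obtain ⟨vu, du, fu, us⟩ := hvis u hu h3
    obtain ⟨vv, dv, fv, vs⟩ := hvis v hv h4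
    have hfne : E.fst u ≠ E.fst v := by
      rw [← fu, ← fv]
      intro h
      rw [h] at h1
      omega
    have hadj : G.graph.Adj ⟨u, hu⟩ ⟨v, hv⟩ := by
      by_contra hn
      apply h5
      have := hA ⟨u, hu⟩ ⟨v, hv⟩
      simpa [WGraph.entry, hn] using this
    -- A node and its parent have the same first hop unless the parent is the root, so different
    -- first hops make `uv` a non-tree edge.
    have hpar : ∀ a b, E.vis a → E.vis b → a ≠ s → b ≠ s → E.fst a ≠ E.fst b →
        b ≠ E.par a := by
      rintro a b ha hb has hbs hf rfl
      exact hf (by rw [hE.fst_eq a ha has, if_neg hbs])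
    obtain ⟨C', hC', hw', -, -⟩ := hE.exists_cycle (u := ⟨u, hu⟩) (v := ⟨v, hv⟩) hG hI hs vu vv
      hadj.symm (hpar _ _ vu vv us vs hfne) (hpar _ _ vv vu vs us hfne.symm) hfne
    have := hC.2 _ _ hC'
    have hAuv := hentry hadj
    simp only at hw' hAuv
    rw [hAuv]
    omega


/-! ### Expressions and arrays -/

instance : Add Expr := ⟨Expr.op .add⟩
instance : Sub Expr := ⟨Expr.op .sub⟩
instance : Mul Expr := ⟨Expr.op .mul⟩
instance : Div Expr := ⟨Expr.op .div⟩

namespace Expr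

/-- The comparison `a < b`. -/
def less (a b : Expr) : Expr := .op .lt a b

/-- The comparison `a = b`. -/
def same (a b : Expr) : Expr := .op .eq a b

/-- The address of entry `i` of the `k`-th of sixteen interleaved arrays. -/
def addr (k : ℕ) (i : Expr) : Expr := .op .add (.op .mul (.const 16) i) (.const k)

/-- The entry `i` of the `k`-th array. -/
def get (k : ℕ) (i : Expr) : Expr := .load (addr k i)

end Expr

/-- The `k`-th of sixteen interleaved arrays. -/
def State.arr (s : State) (k i : ℕ) : ℕ := s.mem (16 * i + k)

def State.setv (s : State) (x a : ℕ) : State := { s with var := Function.update s.var x a }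

def State.put (s : State) (k i a : ℕ) : State :=
  { s with mem := Function.update s.mem (16 * i + k) a }

namespace State

variable (s : State) (x y a k l i : ℕ)

@[simp] theorem setv_var : (s.setv x a).var y = if y = x then a else s.var y := by
  simp [setv, Function.update_apply]

@[simp] theorem setv_arr : (s.setv x a).arr = s.arr := rfl

@[simp] theorem setv_mem : (s.setv x a).mem = s.mem := rfl

@[simp] theorem put_var : (s.put k i a).var = s.var := rfl

theorem put_arr (hk : k < 16) (hl : l < 16) :
    (s.put k i a).arr l = if l = k then Function.update (s.arr k) i a else s.arr l := by
  funext j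
  simp only [put, arr, Function.update_apply]
  split_ifs with h1 h2 h2 <;> simp only [Function.update_apply, arr]
  · rw [if_pos (by omega)]
  · omega
  · subst h2
    rw [if_neg (by omega)]

@[simp] theorem put_arr_self (hk : k < 16) :
    (s.put k i a).arr k = Function.update (s.arr k) i a := by
  rw [put_arr _ _ _ _ _ hk hk, if_pos rfl]

@[simp] theorem put_arr_ne (hk : k < 16) (hl : l < 16) (h : l ≠ k) :
    (s.put k i a).arr l = s.arr l := by
  rw [put_arr _ _ _ _ _ hk hl, if_neg h]

end State

open Classical in
/-- The truth value of `p` as a number. -/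
noncomputable def truth (p : Prop) : ℕ := if p then 1 else 0

@[simp] theorem truth_eq_zero {p : Prop} : truth p = 0 ↔ ¬ p := by simp [truth]

@[simp] theorem truth_true : truth True = 1 := by simp [truth]

@[simp] theorem truth_false : truth False = 0 := by simp [truth]

theorem truth_le (p : Prop) : truth p ≤ 1 := by
  unfold truth
  split_ifs <;> omega

namespace Expr

variable (s : State) (a b i : Expr) (k x : ℕ)

@[simp] theorem eval_const : (Expr.const k).eval s = k := rfl
@[simp] theorem eval_var : (Expr.var x).eval s = s.var x := rfl
@[simp] theorem eval_load : (Expr.load a).eval s = s.mem (a.eval s) := rfl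
@[simp] theorem eval_add : (a + b).eval s = a.eval s + b.eval s := rfl
@[simp] theorem eval_sub : (a - b).eval s = a.eval s - b.eval s := rfl
@[simp] theorem eval_mul : (a * b).eval s = a.eval s * b.eval s := rfl
@[simp] theorem eval_div : (a / b).eval s = a.eval s / b.eval s := rfl
@[simp] theorem eval_less : (a.less b).eval s = truth (a.eval s < b.eval s) := by
  simp only [less, eval, Op.apply, truth]
  congr
@[simp] theorem eval_same : (a.same b).eval s = truth (a.eval s = b.eval s) := by
  simp only [same, eval, Op.apply, truth]
  congr
@[simp] theorem eval_get : (get k i).eval s = s.arr k (i.eval s) := rfl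

@[simp] theorem cost_const : (Expr.const k).cost = 1 := rfl
@[simp] theorem cost_var : (Expr.var x).cost = 1 := rfl
@[simp] theorem cost_add : (a + b).cost = a.cost + b.cost + 1 := rfl
@[simp] theorem cost_sub : (a - b).cost = a.cost + b.cost + 1 := rfl
@[simp] theorem cost_mul : (a * b).cost = a.cost + b.cost + 1 := rfl
@[simp] theorem cost_div : (a / b).cost = a.cost + b.cost + 1 := rfl
@[simp] theorem cost_less : (a.less b).cost = a.cost + b.cost + 1 := rfl
@[simp] theorem cost_same : (a.same b).cost = a.cost + b.cost + 1 := rfl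
@[simp] theorem cost_get : (get k i).cost = i.cost + 5 := by
  simp only [get, addr, cost]
  omega

/-- The number of operands that are not inside an address. -/
def leaves : Expr → ℕ
  | .const _ => 1
  | .var _ => 1
  | .load a => a.leaves
  | .op _ a b => a.leaves + b.leaves

def maxConst : Expr → ℕ
  | .const k => k
  | .var _ => 0
  | .load a => a.maxConst
  | .op _ a b => max a.maxConst b.maxConst

theorem leaves_pos (e : Expr) : 1 ≤ e.leaves := by
  induction e <;> simp only [leaves] <;> omega

end Expr

/-- All words of a state are below `B`. -/
structure Bdd (B : ℕ) (s : State) : Prop where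
  le : 100 ≤ B
  var : ∀ x, s.var x < B
  mem : ∀ a, s.mem a < B

namespace Bdd

variable {B : ℕ} {s : State}

theorem arr (h : Bdd B s) (k i : ℕ) : s.arr k i < B := h.mem _

theorem setv (h : Bdd B s) {x a : ℕ} (ha : a < B) : Bdd B (s.setv x a) :=
  ⟨h.le, fun y => by rw [State.setv_var]; split_ifs; exacts [ha, h.var y], h.mem⟩

theorem put (h : Bdd B s) {k i a : ℕ} (ha : a < B) : Bdd B (s.put k i a) :=
  ⟨h.le, h.var, fun y => by
    simp only [State.put, Function.update_apply]; split_ifs; exacts [ha, h.mem y]⟩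

theorem two_le_pow (h : Bdd B s) (e : Expr) : 2 ≤ B ^ e.leaves :=
  (show 2 ≤ B ^ 1 by have := h.le; rw [pow_one]; omega).trans
    (Nat.pow_le_pow_right (by have := h.le; omega) e.leaves_pos)

/-- Every operation is bounded by the product of the bounds of its operands, since these are at
least `2`. A loaded value is again below `B`, however large its address. -/
theorem eval_lt (h : Bdd B s) {e : Expr} (he : e.maxConst < B) : e.eval s < B ^ e.leaves := by
  induction e with
  | const k => simpa [Expr.leaves, Expr.maxConst] using he
  | var x => simpa [Expr.leaves] using h.var x
  | load a _ =>
    have : B ^ 1 ≤ B ^ a.leaves := Nat.pow_le_pow_right (by have := h.le; omega) a.leaves_pos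
    have h2 := h.mem (a.eval s)
    rw [Expr.eval_load, Expr.leaves]
    rw [pow_one] at this
    omega
  | op o a b iha ihb =>
    simp only [Expr.maxConst, max_lt_iff] at he
    have h1 := iha he.1
    have h2 := ihb he.2
    have h3 := h.two_le_pow a
    have h4 := h.two_le_pow b
    rw [Expr.leaves, pow_add, Expr.eval]
    generalize a.eval s = x at *
    generalize b.eval s = y at *
    generalize B ^ a.leaves = X at *
    generalize B ^ b.leaves = Y at *
    cases o <;> simp only [Op.apply]
    · nlinarith
    · have := Nat.sub_le x y
      nlinarith
    · exact Nat.mul_lt_mul'' h1 h2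
    · have := Nat.div_le_self x y
      nlinarith
    · split_ifs <;> nlinarith
    · split_ifs <;> nlinarith

theorem fits (h : Bdd B s) {e : Expr} (he : e.maxConst < B) (hl : e.leaves ≤ 16) :
    e.Fits (B ^ 16) s := by
  have key : e.eval s < B ^ 16 :=
    (h.eval_lt he).trans_le (Nat.pow_le_pow_right (by have := h.le; omega) hl)
  induction e with
  | const k => exact key
  | var x => exact key
  | load a ih =>
    refine ⟨ih he hl ?_, key⟩
    exact (h.eval_lt (e := a) he).trans_le (Nat.pow_le_pow_right (by have := h.le; omega) hl)
  | op o a b iha ihb =>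
    simp only [Expr.maxConst, max_lt_iff] at he
    simp only [Expr.leaves] at hl
    refine ⟨iha he.1 (by omega) ?_, ihb he.2 (by omega) ?_, key⟩
    · exact (h.eval_lt he.1).trans_le (Nat.pow_le_pow_right (by have := h.le; omega) (by omega))
    · exact (h.eval_lt he.2).trans_le (Nat.pow_le_pow_right (by have := h.le; omega) (by omega))

end Bdd

/-! ### Written registers and arrays -/

/-- The array that an address expression belongs to, if it has the form `addr k i`. -/
def Expr.arrOf : Expr → Option ℕ
  | .op .add (.op .mul (.const 16) _) (.const k) => if k < 16 then some k else none
  | _ => none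

/-- The registers that a program may write. -/
def Cmd.wv : Cmd → List ℕ
  | .skip => []
  | .assign x _ => [x]
  | .store _ _ => []
  | .seq p q => p.wv ++ q.wv
  | .ite _ p q => p.wv ++ q.wv
  | .loop _ p => p.wv

/-- The arrays that a program may write. -/
def Cmd.wa : Cmd → List ℕ
  | .skip => []
  | .assign _ _ => []
  | .store a _ => match a.arrOf with
    | some k => [k]
    | none => List.range 16
  | .seq p q => p.wa ++ q.wa
  | .ite _ p q => p.wa ++ q.wa
  | .loop _ p => p.wa

/-- `s'` differs from `s` only in what `p` may write. -/
structure Frame (p : Cmd) (s s' : State) : Prop where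
  var : ∀ x, x ∉ p.wv → s'.var x = s.var x
  arr : ∀ k, k < 16 ∧ k ∉ p.wa → s'.arr k = s.arr k

theorem Frame.refl (p : Cmd) (s : State) : Frame p s s := ⟨fun _ _ => rfl, fun _ _ => rfl⟩

theorem Frame.trans {p : Cmd} {s s' s'' : State} (h : Frame p s s') (h' : Frame p s' s'') :
    Frame p s s'' :=
  ⟨fun x hx => (h'.var x hx).trans (h.var x hx), fun k hk => (h'.arr k hk).trans (h.arr k hk)⟩

theorem Frame.mono {p q : Cmd} {s s' : State} (h : Frame p s s') (hv : p.wv ⊆ q.wv)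
    (ha : p.wa ⊆ q.wa) : Frame q s s' :=
  ⟨fun x hx => h.var x fun h' => hx (hv h'), fun k hk => h.arr k ⟨hk.1, fun h' => hk.2 (ha h')⟩⟩

theorem Expr.arrOf_eq_some {a : Expr} {k : ℕ} (h : a.arrOf = some k) :
    k < 16 ∧ ∃ i, a = Expr.addr k i := by
  unfold Expr.arrOf at h
  split at h
  · split_ifs at h with hk
    cases h
    exact ⟨hk, _, rfl⟩
  · cases h

/-- The written registers and arrays are syntactic and computable. So the preservation of everything
else is settled by `decide`, and invariants only need to mention what changes. -/
theorem Exec.frame {W T : ℕ} {p : Cmd} {s s' : State} (h : Exec W p s T s') : Frame p s s' := by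
  induction h with
  | skip s => exact Frame.refl _ _
  | assign x e s he =>
    refine ⟨fun y hy => ?_, fun _ _ => rfl⟩
    simp only [Cmd.wv, List.mem_singleton] at hy
    exact Function.update_of_ne hy _ _
  | store a e s ha he =>
    refine ⟨fun _ _ => rfl, fun k hk => ?_⟩
    obtain ⟨hk, hk'⟩ := hk
    cases h : a.arrOf with
    | none => simp [Cmd.wa, h, hk] at hk'
    | some l =>
      simp only [Cmd.wa, h, List.mem_singleton] at hk'
      obtain ⟨hl, i, rfl⟩ := Expr.arrOf_eq_some h
      funext j
      refine Function.update_of_ne ?_ _ _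
      simp only [Expr.addr, Expr.eval, Op.apply]
      omega
  | seq _ _ ih ih' =>
    exact (ih.mono (List.subset_append_left _ _) (List.subset_append_left _ _)).trans
      (ih'.mono (List.subset_append_right _ _) (List.subset_append_right _ _))
  | ite_true _ _ _ ih =>
    exact ih.mono (List.subset_append_left _ _) (List.subset_append_left _ _)
  | ite_false _ _ _ ih =>
    exact ih.mono (List.subset_append_right _ _) (List.subset_append_right _ _)
  | loop_true _ _ _ _ ih ih' =>
    exact Frame.trans ⟨ih.var, ih.arr⟩ ih'
  | loop_false => exact Frame.refl _ _

/-! ### A program logic for total correctness with time bounds -/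

/-- Started in `s`, a state with words below `B`, the program `p` halts within `T` steps in such
a state that satisfies `Q`. -/
def Runs (B : ℕ) (p : Cmd) (s : State) (T : ℕ) (Q : State → Prop) : Prop :=
  Bdd B s → ∃ T' s', T' ≤ T ∧ Exec (B ^ 16) p s T' s' ∧ Bdd B s' ∧ Q s'

/-- The assignment of `e` to entry `i` of array `k`. -/
def Cmd.put (k : ℕ) (i e : Expr) : Cmd := .store (Expr.addr k i) e

/-- Counting the register `i` from `0` up to the value of `b`. -/
def Cmd.for (i : ℕ) (b : Expr) (p : Cmd) : Cmd :=
  .seq (.assign i (.const 0))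
    (.loop (.less (.var i) b) (.seq p (.assign i (.var i + .const 1))))

/-- Doubling the register `i`, starting from `1`, while it is at most the value of `b`. -/
def Cmd.double (i : ℕ) (b : Expr) (p : Cmd) : Cmd :=
  .seq (.assign i (.const 1))
    (.loop (.less (.var i) (b + .const 1)) (.seq p (.assign i (.var i * .const 2))))

infixr:60 " ;; " => Cmd.seq

/-- The constants of `e` are at most `64`, and it is not too long. -/
def Expr.Small (e : Expr) : Prop := e.leaves ≤ 16 ∧ e.maxConst ≤ 64

instance (e : Expr) : Decidable e.Small := inferInstanceAs (Decidable (_ ∧ _))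

theorem Bdd.fits_of_small {B : ℕ} {s : State} (h : Bdd B s) {e : Expr} (he : e.Small) :
    e.Fits (B ^ 16) s := h.fits (he.2.trans_lt (by have := h.le; omega)) he.1

/-! ### Proof rules for commands and loops -/

section Rules

variable {B T T₁ T₂ : ℕ} {s : State} {Q R : State → Prop} {p q : Cmd} {e : Expr}

theorem Runs.mono (h : Runs B p s T₁ R) (hT : T₁ ≤ T) (hQ : ∀ s', R s' → Q s') :
    Runs B p s T Q := fun hb =>
  let ⟨T', s', h1, h2, h3, h4⟩ := h hb
  ⟨T', s', h1.trans hT, h2, h3, hQ s' h4⟩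

theorem Runs.frame (h : Runs B p s T R) (hQ : ∀ s', Frame p s s' → R s' → Q s') :
    Runs B p s T Q := fun hb =>
  let ⟨T', s', h1, h2, h3, h4⟩ := h hb
  ⟨T', s', h1, h2, h3, hQ s' h2.frame h4⟩

theorem runs_skip (hT : 1 ≤ T) (hQ : Q s) : Runs B .skip s T Q := fun hb =>
  ⟨1, s, hT, .skip s, hb, hQ⟩

theorem runs_assign {x : ℕ} (he : e.Small) (hT : e.cost + 1 ≤ T) (hv : Bdd B s → e.eval s < B)
    (hQ : Q (s.setv x (e.eval s))) : Runs B (.assign x e) s T Q := fun hb =>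
  ⟨_, _, hT, .assign x e s (hb.fits_of_small he), hb.setv (hv hb), hQ⟩

theorem runs_put {k : ℕ} {i : Expr} (he : e.Small ∧ (Expr.addr k i).Small)
    (hT : e.cost + i.cost + 5 ≤ T) (hv : Bdd B s → e.eval s < B)
    (hQ : Q (s.put k (i.eval s) (e.eval s))) : Runs B (.put k i e) s T Q := fun hb =>
  ⟨_, _, (by simp only [Expr.addr, Expr.cost]; omega : (Expr.addr k i).cost + e.cost + 1 ≤ T),
    .store _ e s (hb.fits_of_small he.2) (hb.fits_of_small he.1), hb.put (hv hb), hQ⟩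

theorem Runs.seq (h : Runs B p s T₁ fun s' => Runs B q s' T₂ Q) (hT : T₁ + T₂ ≤ T) :
    Runs B (p ;; q) s T Q := fun hb => by
  obtain ⟨T', s', h1, h2, h3, h4⟩ := h hb
  obtain ⟨T'', s'', h5, h6, h7, h8⟩ := h4 h3
  exact ⟨_, _, by omega, .seq h2 h6, h7, h8⟩

theorem runs_assign_seq {x : ℕ} (he : e.Small) (hT : e.cost + 1 ≤ T)
    (hv : Bdd B s → e.eval s < B)
    (hQ : Runs B q (s.setv x (e.eval s)) (T - (e.cost + 1)) Q) :
    Runs B (.assign x e ;; q) s T Q :=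
  Runs.seq (runs_assign he le_rfl hv hQ) (by omega)

theorem runs_put_seq {k : ℕ} {i : Expr} (he : e.Small ∧ (Expr.addr k i).Small)
    (hT : e.cost + i.cost + 5 ≤ T) (hv : Bdd B s → e.eval s < B)
    (hQ : Runs B q (s.put k (i.eval s) (e.eval s)) (T - (e.cost + i.cost + 5)) Q) :
    Runs B (.put k i e ;; q) s T Q :=
  Runs.seq (runs_put he le_rfl hv hQ) (by omega)

theorem runs_ite (he : e.Small) (hT : e.cost + 1 ≤ T)
    (h1 : e.eval s ≠ 0 → Runs B p s (T - (e.cost + 1)) Q)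
    (h2 : e.eval s = 0 → Runs B q s (T - (e.cost + 1)) Q) : Runs B (.ite e p q) s T Q := by
  intro hb
  by_cases h : e.eval s = 0
  · obtain ⟨T', s', h3, h4, h5, h6⟩ := h2 h hb
    exact ⟨_, s', by omega, .ite_false (hb.fits_of_small he) h h4, h5, h6⟩
  · obtain ⟨T', s', h3, h4, h5, h6⟩ := h1 h hb
    exact ⟨_, s', by omega, .ite_true (hb.fits_of_small he) h h4, h5, h6⟩

/-- The natural number `μ` decreases in each round and so bounds the number of rounds. The frame
relative to the initial state `s` is carried along, so facts about untouched data need not be part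
of `I`. -/
theorem runs_while (I : State → Prop) (μ : State → ℕ) (Tb : ℕ) (he : e.Small) (hI : I s)
    (step : ∀ s', Frame p s s' → I s' → e.eval s' ≠ 0 →
      Runs B p s' Tb fun s'' => I s'' ∧ μ s'' < μ s')
    (hT : μ s * (Tb + e.cost + 1) + (e.cost + 1) ≤ T)
    (hQ : ∀ s', Frame p s s' → I s' → e.eval s' = 0 → Q s') : Runs B (.loop e p) s T Q := by
  suffices H : ∀ m s', μ s' = m → Frame p s s' → I s' → Bdd B s' →
      ∃ T' s'', T' ≤ m * (Tb + e.cost + 1) + (e.cost + 1) ∧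
        Exec (B ^ 16) (.loop e p) s' T' s'' ∧ Bdd B s'' ∧ Q s'' by
    intro hb
    obtain ⟨T', s'', h1, h2⟩ := H _ s rfl (Frame.refl _ _) hI hb
    exact ⟨T', s'', h1.trans hT, h2⟩
  intro m
  induction m using Nat.strong_induction_on with
  | _ m ih =>
  intro s' hm hf hI hb
  by_cases h : e.eval s' = 0
  · exact ⟨_, s', Nat.le_add_left _ _, .loop_false (hb.fits_of_small he) h, hb, hQ s' hf hI h⟩
  · obtain ⟨T₁, s₁, h1, h2, h3, h4, h5⟩ := step s' hf hI h hb
    obtain ⟨T₂, s₂, h6, h7, h8⟩ := ih _ (hm ▸ h5) s₁ rfl (hf.trans h2.frame) h4 h3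
    refine ⟨_, s₂, ?_, .loop_true (hb.fits_of_small he) h h2 h7, h8⟩
    have : (μ s₁ + 1) * (Tb + e.cost + 1) ≤ m * (Tb + e.cost + 1) :=
      Nat.mul_le_mul_right _ (hm ▸ h5)
    rw [add_mul, one_mul] at this
    omega

theorem runs_for {i n Tb : ℕ} {b : Expr} (I : ℕ → State → Prop) (hi : i ∉ p.wv)
    (hb : ((Expr.var i).less b).Small) (h0 : I 0 (s.setv i 0))
    (hn : ∀ s', Frame (.for i b p) s s' → b.eval s' = n)
    (hnB : n < B)
    (step : ∀ k < n, ∀ s', Frame (.for i b p) s s' → s'.var i = k → I k s' →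
      Runs B p s' Tb fun s'' => I (k + 1) (s''.setv i (k + 1)))
    (hT : n * (Tb + b.cost + 8) + b.cost + 8 ≤ T)
    (hQ : ∀ s', Frame (.for i b p) s s' → s'.var i = n → I n s' → Q s') :
    Runs B (.for i b p) s T Q := by
  have hsub : ∀ {s' : State}, Frame (.seq p (.assign i (.var i + .const 1))) (s.setv i 0) s' →
      Frame (.for i b p) s s' := by
    intro s' hf
    refine ⟨fun x hx => ?_, fun k hk => ?_⟩
    · simp only [Cmd.for, Cmd.wv, List.mem_append, List.mem_singleton] at hx
      rw [hf.var x (by simpa [Cmd.wv] using fun h => hx (Or.inr h)), State.setv_var,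
        if_neg (fun h => hx (Or.inl h))]
    · simp only [Cmd.for, Cmd.wa, List.nil_append, List.append_nil] at hk
      rw [hf.arr k (by simpa [Cmd.wa] using hk)]
      rfl
  refine runs_assign_seq (show (Expr.const 0).Small by decide) ?_
    (fun hb => by have := hb.le; simp; omega) ?_
  · simp only [Expr.cost]; omega
  refine runs_while (fun s' => s'.var i ≤ n ∧ I (s'.var i) s') (fun s' => n - s'.var i)
    (Tb + 4) hb (by simpa using h0) ?_ ?_ ?_
  · rintro s' hf ⟨hle, hI⟩ hlt
    have hbn := hn s' (hsub hf)
    simp only [Expr.eval_less, Expr.eval_var, hbn, ne_eq, truth_eq_zero, not_not] at hlt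
    refine Runs.seq (T₁ := Tb) (T₂ := 4) (Runs.frame (step _ hlt s' (hsub hf) rfl hI) ?_) le_rfl
    intro s'' hf' hI'
    have hi' := hf'.var i hi
    refine runs_assign ⟨show 1 + 1 ≤ 16 by decide, show max 0 _ ≤ 64 by decide⟩
      (show 1 + 1 + 1 + 1 ≤ 4 by decide) (fun _ => ?_) ?_
    · simp only [Expr.eval_add, Expr.eval_var, Expr.eval_const, hi']
      omega
    · simp only [Expr.eval_add, Expr.eval_var, Expr.eval_const, hi', State.setv_var, if_true]
      exact ⟨⟨by omega, hI'⟩, by omega⟩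
  · simp only [State.setv_var, Expr.eval_const, if_true, Expr.less, Expr.cost]
    have : n * (Tb + 4 + (1 + b.cost + 1) + 1) ≤ n * (Tb + b.cost + 8) :=
      Nat.mul_le_mul_left _ (by omega)
    rw [Nat.sub_zero]
    omega
  · rintro s' hf ⟨hle, hI⟩ hlt
    have hbn := hn s' (hsub hf)
    simp only [Expr.eval_less, Expr.eval_var, hbn, truth_eq_zero] at hlt
    obtain hin : s'.var i = n := by omega
    exact hQ s' (hsub hf) hin (hin ▸ hI)

/-- The powers `2 ^ k` that are at most `n` are exactly those with `k < n.size`, so the body runs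
once for each binary digit of `n`. -/
theorem runs_double {i n Tb : ℕ} {b : Expr} (I : ℕ → State → Prop) (hi : i ∉ p.wv)
    (hb : ((Expr.var i).less (b + .const 1)).Small) (h0 : I 0 (s.setv i 1))
    (hn : ∀ s', Frame (.double i b p) s s' → b.eval s' = n)
    (hnB : 2 * n < B)
    (step : ∀ k < n.size, ∀ s', Frame (.double i b p) s s' → s'.var i = 2 ^ k → I k s' →
      Runs B p s' Tb fun s'' => I (k + 1) (s''.setv i (2 ^ (k + 1))))
    (hT : n.size * (Tb + b.cost + 10) + b.cost + 10 ≤ T)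
    (hQ : ∀ s', Frame (.double i b p) s s' → s'.var i = 2 ^ n.size → I n.size s' → Q s') :
    Runs B (.double i b p) s T Q := by
  have hsub : ∀ {s' : State}, Frame (.seq p (.assign i (.var i * .const 2))) (s.setv i 1) s' →
      Frame (.double i b p) s s' := by
    intro s' hf
    refine ⟨fun x hx => ?_, fun k hk => ?_⟩
    · simp only [Cmd.double, Cmd.wv, List.mem_append, List.mem_singleton] at hx
      rw [hf.var x (by simpa [Cmd.wv] using fun h => hx (Or.inr h)), State.setv_var,
        if_neg (fun h => hx (Or.inl h))]
    · simp only [Cmd.double, Cmd.wa, List.nil_append, List.append_nil] at hk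
      rw [hf.arr k (by simpa [Cmd.wa] using hk)]
      rfl
  have hpow : ∀ k, 2 ^ k ≤ n ↔ k < n.size := fun k => Nat.lt_size.symm
  refine runs_assign_seq (show (Expr.const 1).Small by decide) ?_
    (fun hb => by have := hb.le; simp; omega) ?_
  · simp only [Expr.cost]; omega
  refine runs_while (fun s' => ∃ k ≤ n.size, s'.var i = 2 ^ k ∧ I k s')
    (fun s' => n.size - Nat.log 2 (s'.var i))
    (Tb + 4) hb ⟨0, by simpa using h0⟩ ?_ ?_ ?_
  · rintro s' hf ⟨k, hle, hk, hI⟩ hlt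
    have hbn := hn s' (hsub hf)
    simp only [Expr.eval_less, Expr.eval_var, Expr.eval_add, Expr.eval_const, hbn, ne_eq,
      truth_eq_zero, not_not] at hlt
    rw [hk, Nat.lt_succ_iff] at hlt
    have hks := (hpow k).1 hlt
    refine Runs.seq (T₁ := Tb) (T₂ := 4) (Runs.frame (step k hks s' (hsub hf) hk hI) ?_) le_rfl
    intro s'' hf' hI'
    have hi' := (hf'.var i hi).trans hk
    refine runs_assign ⟨show 1 + 1 ≤ 16 by decide, show max 0 _ ≤ 64 by decide⟩
      (show 1 + 1 + 1 + 1 ≤ 4 by decide) (fun _ => ?_) ?_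
    · simp only [Expr.eval_mul, Expr.eval_var, Expr.eval_const, hi']
      omega
    · simp only [Expr.eval_mul, Expr.eval_var, Expr.eval_const, hi', State.setv_var, if_true,
        ← pow_succ, hk, Nat.log_pow (Nat.one_lt_two)]
      exact ⟨⟨k + 1, by omega, rfl, hI'⟩, by omega⟩
  · simp only [State.setv_var, Expr.eval_const, if_true, Expr.less, Expr.cost,
      Nat.log_one_right, Nat.sub_zero]
    have : n.size * (Tb + 4 + (1 + (b.cost + 1 + 1) + 1) + 1) ≤ n.size * (Tb + b.cost + 10) :=
      Nat.mul_le_mul_left _ (by omega)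
    omega
  · rintro s' hf ⟨k, hle, hk, hI⟩ hlt
    have hbn := hn s' (hsub hf)
    simp only [Expr.eval_less, Expr.eval_var, Expr.eval_add, Expr.eval_const, hbn,
      truth_eq_zero] at hlt
    rw [hk, Nat.lt_succ_iff, hpow] at hlt
    obtain rfl : k = n.size := by omega
    exact hQ s' (hsub hf) hk hI

end Rules


/-! ### Exploration from a root -/

/-- Row `u` of `adj` lists the nodes below `n` by increasing key. -/
structure SortedRow (n : ℕ) (key adj : ℕ → ℕ → ℕ) (u : ℕ) : Prop where
  lt : ∀ j < n, adj u j < n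
  inj : ∀ i < n, ∀ j < n, adj u i = adj u j → i = j
  surj : ∀ v < n, ∃ j < n, adj u j = v
  mono : ∀ i j, i ≤ j → j < n → key u (adj u i) ≤ key u (adj u j)

/-- The invariant of the exploration: the visited nodes are queued in `Q` below `m`, the edges at
the nodes before position `h` have been examined, and so have the first `j` edges at `Q h`. -/
structure Exploring (n : ℕ) (key adj : ℕ → ℕ → ℕ) (s t : ℕ) (D : TreeData) (Q : ℕ → ℕ)
    (m h j : ℕ) : Prop where
  tree : D.IsTree n key s t
  h_le : h ≤ m
  j_le : j ≤ n
  queue_vis : ∀ i < m, D.vis (Q i)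
  queue_inj : ∀ i < m, ∀ i' < m, Q i = Q i' → i = i'
  vis_queue : ∀ v, D.vis v → ∃ i < m, Q i = v
  done : ∀ i < h, ∀ v < n, D.dist (Q i) + key (Q i) v ≤ t →
    D.vis v ∧ (v = D.par (Q i) ∨ D.par v = Q i)
  scanned : h < m → ∀ i < j, D.vis (adj (Q h) i) ∧
    (adj (Q h) i = D.par (Q h) ∨ D.par (adj (Q h) i) = Q h)
  child : ∀ v, D.vis v → v ≠ s → ∃ i < m, D.par v = Q i ∧
    (i < h ∨ i = h ∧ ∃ i' < j, adj (Q h) i' = v)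

/-- Whether the parent of the node being processed is still ahead in its row. -/
def parentAhead (adj : ℕ → ℕ → ℕ) (D : TreeData) (Q : ℕ → ℕ) (h j : ℕ) : Prop :=
  ∀ i < j, adj (Q h) i ≠ D.par (Q h)

open Classical in
/-- A bound for the number of steps that remain in the exploration. -/
noncomputable def potential (n : ℕ) (adj : ℕ → ℕ → ℕ) (D : TreeData) (Q : ℕ → ℕ)
    (m h j : ℕ) : ℕ :=
  2 * (n - m) + 2 * (n - h) + if parentAhead adj D Q h j then 1 else 0

/-- Recording `v` as a new child of `u` at distance `d`. -/
def TreeData.insert (D : TreeData) (s u v d : ℕ) : TreeData where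
  vis x := x = v ∨ D.vis x
  par := Function.update D.par v u
  dist := Function.update D.dist v d
  dep := Function.update D.dep v (D.dep u + 1)
  fst := Function.update D.fst v (if u = s then v else D.fst u)

/-- Depths are bounded by distances and therefore fit into a word. -/
theorem TreeData.IsTree.dep_le_dist {D : TreeData} {n s t : ℕ} {key : ℕ → ℕ → ℕ}
    (hD : D.IsTree n key s t) (hpos : ∀ x y, 1 ≤ key x y) (v : ℕ) (hv : D.vis v) :
    D.dep v ≤ D.dist v := by
  induction h : D.dep v generalizing v with
  | zero => omega
  | succ k ih =>
    have hvs : v ≠ s := by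
      rintro rfl
      rw [hD.dep_root] at h
      omega
    have h1 := hD.dep_eq v hv hvs
    have h2 := hD.dist_eq v hv hvs
    have h3 := ih _ (hD.vis_par v hv hvs) (by omega)
    have h4 := hpos (D.par v) v
    omega

/-! ### Transitions of the exploration and decrease of the potential -/

namespace Exploring

variable {n s t m h j : ℕ} {key adj : ℕ → ℕ → ℕ} {D : TreeData} {Q : ℕ → ℕ}

theorem m_le (hE : Exploring n key adj s t D Q m h j) : m ≤ n := by
  have := Finset.card_le_card_of_injOn (s := Finset.range m) (t := Finset.range n) Q
    (fun i hi => by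
      simpa using hE.tree.lt _ (hE.queue_vis i (by simpa using hi)))
    (fun i hi i' hi' h => hE.queue_inj i (by simpa using hi) i' (by simpa using hi') h)
  simpa using this

theorem lt_n (hE : Exploring n key adj s t D Q m h j) (hm : h < m) : Q h < n :=
  hE.tree.lt _ (hE.queue_vis h hm)

theorem vis_par (hE : Exploring n key adj s t D Q m h j) {i : ℕ} (hi : i < m) :
    D.vis (D.par (Q i)) := by
  by_cases hs : Q i = s
  · rw [hs, hE.tree.par_root]
    exact hE.tree.vis_root
  · exact hE.tree.vis_par _ (hE.queue_vis i hi) hs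

theorem closed (hE : Exploring n key adj s t D Q m m j) : D.Closed n key t := by
  intro u v hu hv hle
  obtain ⟨i, hi, rfl⟩ := hE.vis_queue u hu
  exact hE.done i hi v hv hle

/-- The row is sorted, so once one edge leads beyond `t`, all later ones do, and the node is
finished. Without the sorting, the rejected edges could not be charged to nodes. -/
theorem advance (hE : Exploring n key adj s t D Q m h j) (hm : h < m)
    (hadj : SortedRow n key adj (Q h))
    (hj : j < n → t < D.dist (Q h) + key (Q h) (adj (Q h) j)) :
    Exploring n key adj s t D Q m (h + 1) 0 where
  tree := hE.tree
  h_le := hm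
  j_le := Nat.zero_le _
  queue_vis := hE.queue_vis
  queue_inj := hE.queue_inj
  vis_queue := hE.vis_queue
  done := by
    intro i hi v hv hle
    rcases Nat.lt_succ_iff_lt_or_eq.1 hi with hi | rfl
    · exact hE.done i hi v hv hle
    · obtain ⟨k, hk, rfl⟩ := hadj.surj v hv
      have hkj : k < j := by
        by_contra! hjk
        have := hj (by omega)
        have := hadj.mono j k hjk hk
        omega
      exact hE.scanned hm k hkj
  scanned := fun _ i hi => absurd hi (Nat.not_lt_zero i)
  child := by
    intro v hv hvs
    obtain ⟨i, hi, hp, h'⟩ := hE.child v hv hvs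
    exact ⟨i, hi, hp, Or.inl (by omega)⟩

/-- Finishing a node gains `2`, which pays for the parent flag that may be set again at the next
node. -/
theorem potential_advance (hE : Exploring n key adj s t D Q m h j) (hm : h < m) :
    potential n adj D Q m (h + 1) 0 < potential n adj D Q m h j := by
  have := hE.m_le
  unfold potential
  split_ifs <;> omega

theorem skip (hE : Exploring n key adj s t D Q m h j) (hm : h < m) (hj : j < n)
    (hv : adj (Q h) j = D.par (Q h)) : Exploring n key adj s t D Q m h (j + 1) where
  tree := hE.tree
  h_le := hE.h_le
  j_le := hj
  queue_vis := hE.queue_vis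
  queue_inj := hE.queue_inj
  vis_queue := hE.vis_queue
  done := hE.done
  scanned := by
    intro _ i hi
    rcases Nat.lt_succ_iff_lt_or_eq.1 hi with hi | rfl
    · exact hE.scanned hm i hi
    · rw [hv]
      exact ⟨hE.vis_par hm, Or.inl rfl⟩
  child := by
    intro v hv hvs
    obtain ⟨i, hi, hp, h'⟩ := hE.child v hv hvs
    refine ⟨i, hi, hp, h'.imp_right fun ⟨h1, i', h2, h3⟩ => ⟨h1, i', by omega, h3⟩⟩

theorem potential_skip (hadj : SortedRow n key adj (Q h)) (hj : j < n)
    (hv : adj (Q h) j = D.par (Q h)) :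
    potential n adj D Q m h (j + 1) < potential n adj D Q m h j := by
  have h1 : parentAhead adj D Q h j := fun i hi he => by
    have := hadj.inj i (by omega) j hj (he.trans hv.symm)
    omega
  have h2 : ¬ parentAhead adj D Q h (j + 1) := fun h' => h' j (by omega) hv
  unfold potential
  rw [if_pos h1, if_neg h2]
  omega

theorem ne_of_le (hself : ∀ u, t < key u u) {u v : ℕ} (hle : D.dist u + key u v ≤ t) : u ≠ v := by
  rintro rfl
  have := hself u
  omega

/-- If the far end were a child of the current node, then by the field `child` it would have been
found at an earlier position of the same row, against injectivity. -/
theorem clash (hE : Exploring n key adj s t D Q m h j) (hm : h < m)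
    (hadj : SortedRow n key adj (Q h)) (hj : j < n) (hself : ∀ u, t < key u u)
    (hle : D.dist (Q h) + key (Q h) (adj (Q h) j) ≤ t) (hv : D.vis (adj (Q h) j))
    (hp : adj (Q h) j ≠ D.par (Q h)) : D.Clash key t (Q h) (adj (Q h) j) where
  vis_left := hE.queue_vis h hm
  vis_right := hv
  le := hle
  ne_par_left := hp
  ne_par_right := by
    intro he
    by_cases hs : adj (Q h) j = s
    · rw [hs, hE.tree.par_root, ← hs] at he
      exact ne_of_le hself hle he
    · obtain ⟨i, hi, hpi, h'⟩ := hE.child _ hv hs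
      have := hE.queue_inj h hm i hi (he.trans hpi)
      rcases h' with h' | ⟨-, i', hi', hi''⟩
      · omega
      · have := hadj.inj i' (by omega) j hj hi''
        omega

theorem isTree_insert (hD : D.IsTree n key s t) {u v d : ℕ} (hu : D.vis u) (hv : ¬ D.vis v)
    (hvn : v < n) (hd : d = D.dist u + key u v) (hdt : d ≤ t) :
    (D.insert s u v d).IsTree n key s t := by
  have hne : ∀ x, D.vis x → x ≠ v := fun x hx h => hv (h ▸ hx)
  have hsv := hne s hD.vis_root
  have huv := hne u hu
  constructor
  · rintro x (rfl | hx)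
    exacts [hvn, hD.lt x hx]
  · exact Or.inr hD.vis_root
  · simpa [TreeData.insert, hsv] using hD.par_root
  · simpa [TreeData.insert, hsv] using hD.dist_root
  · simpa [TreeData.insert, hsv] using hD.dep_root
  · simpa [TreeData.insert, hsv] using hD.fst_root
  · rintro x (rfl | hx) hxs
    · simp [TreeData.insert, hu]
    · have := hD.vis_par x hx hxs
      simp [TreeData.insert, hne x hx, this]
  · rintro x (rfl | hx) hxs
    · simp [TreeData.insert, huv, hd]
    · have := hD.vis_par x hx hxs
      simpa [TreeData.insert, hne x hx, hne _ this] using hD.dist_eq x hx hxs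
  · rintro x (rfl | hx) hxs
    · simp [TreeData.insert, huv]
    · have := hD.vis_par x hx hxs
      simpa [TreeData.insert, hne x hx, hne _ this] using hD.dep_eq x hx hxs
  · rintro x (rfl | hx) hxs
    · simp [TreeData.insert, huv]
    · have := hD.vis_par x hx hxs
      simpa [TreeData.insert, hne x hx, hne _ this] using hD.fst_eq x hx hxs
  · rintro x (rfl | hx)
    · simpa [TreeData.insert] using hdt
    · simpa [TreeData.insert, hne x hx] using hD.dist_le x hx

theorem append (hE : Exploring n key adj s t D Q m h j) (hm : h < m)
    (hadj : SortedRow n key adj (Q h)) (hj : j < n) {v d : ℕ} (hv : v = adj (Q h) j)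
    (hd : d = D.dist (Q h) + key (Q h) v) (hle : d ≤ t) (hvis : ¬ D.vis v) :
    Exploring n key adj s t (D.insert s (Q h) v d) (Function.update Q m v) (m + 1) h (j + 1) := by
  have hvn : v < n := hv ▸ hadj.lt j hj
  have hne : ∀ x, D.vis x → x ≠ v := fun x hx h => hvis (h ▸ hx)
  have hQ : ∀ i, i < m → Function.update Q m v i = Q i :=
    fun i hi => Function.update_of_ne (by omega) _ _
  have hQv : ∀ i, i < m → Q i ≠ v := fun i hi => hne _ (hE.queue_vis i hi)
  have hpar : ∀ x, x ≠ v → (D.insert s (Q h) v d).par x = D.par x :=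
    fun x hx => Function.update_of_ne hx _ _
  constructor
  · exact isTree_insert hE.tree (hE.queue_vis h hm) hvis hvn hd hle
  · omega
  · omega
  · intro i hi
    rcases Nat.lt_succ_iff_lt_or_eq.1 hi with hi | rfl
    · rw [hQ i hi]
      exact Or.inr (hE.queue_vis i hi)
    · rw [Function.update_self]
      exact Or.inl rfl
  · intro i hi i' hi' he
    rcases Nat.lt_succ_iff_lt_or_eq.1 hi with hi | rfl <;>
      rcases Nat.lt_succ_iff_lt_or_eq.1 hi' with hi' | rfl
    · rw [hQ i hi, hQ i' hi'] at he
      exact hE.queue_inj i hi i' hi' he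
    · rw [hQ i hi, Function.update_self] at he
      exact absurd he (hQv i hi)
    · rw [hQ i' hi', Function.update_self] at he
      exact absurd he.symm (hQv i' hi')
    · rfl
  · rintro x (rfl | hx)
    · exact ⟨m, by omega, Function.update_self _ _ _⟩
    · obtain ⟨i, hi, h'⟩ := hE.vis_queue x hx
      exact ⟨i, by omega, by rw [hQ i hi, h']⟩
  · intro i hi x hx hle'
    have him : i < m := by omega
    rw [hQ i him] at hle' ⊢
    rw [show (D.insert s (Q h) v d).dist (Q i) = D.dist (Q i) from
      Function.update_of_ne (hQv i him) _ _] at hle'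
    obtain ⟨h1, h2⟩ := hE.done i hi x hx hle'
    rw [hpar _ (hQv i him), hpar _ (hne x h1)]
    exact ⟨Or.inr h1, h2⟩
  · intro _ i hi
    rw [hQ h hm, hpar _ (hQv h hm)]
    rcases Nat.lt_succ_iff_lt_or_eq.1 hi with hi | rfl
    · obtain ⟨h1, h2⟩ := hE.scanned hm i hi
      rw [hpar _ (hne _ h1)]
      exact ⟨Or.inr h1, h2⟩
    · rw [← hv]
      exact ⟨Or.inl rfl, Or.inr (Function.update_self _ _ _)⟩
  · rintro x (rfl | hx) hxs
    · exact ⟨h, by omega, by rw [hQ h hm]; exact Function.update_self _ _ _,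
        Or.inr ⟨rfl, j, by omega, by rw [hQ h hm, hv]⟩⟩
    · obtain ⟨i, hi, hp, h'⟩ := hE.child x hx hxs
      rw [hpar _ (hne x hx)]
      refine ⟨i, by omega, by rw [hQ i hi, hp], ?_⟩
      rw [hQ h hm]
      exact h'.imp_right fun ⟨h1, i', h2, h3⟩ => ⟨h1, i', by omega, h3⟩

theorem potential_append (hE : Exploring n key adj s t D Q m h j) (hm : h < m) {v d : ℕ}
    (hv : v = adj (Q h) j) (hvis : ¬ D.vis v) (hvn : v < n) :
    potential n adj (D.insert s (Q h) v d) (Function.update Q m v) (m + 1) h (j + 1) <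
      potential n adj D Q m h j := by
  -- By pigeonhole: the `m` queued nodes are distinct, and `v` is a further node below `n`.
  have hlt : m < n := by
    by_contra! hnm
    have hmn := hE.m_le
    have hsurj := Finset.surj_on_of_inj_on_of_card_le (s := Finset.range m)
      (t := Finset.range n) (fun i _ => Q i)
      (fun i hi => by simpa using hE.tree.lt _ (hE.queue_vis i (by simpa using hi)))
      (fun i i' hi hi' h => hE.queue_inj i (by simpa using hi) i' (by simpa using hi') h)
      (by simpa using hnm) v (by simpa using hvn)
    obtain ⟨i, hi, rfl⟩ := hsurj
    exact hvis (hE.queue_vis i (by simpa using hi))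
  have hQ : Function.update Q m v h = Q h := Function.update_of_ne (by omega) _ _
  have hpar : (D.insert s (Q h) v d).par (Q h) = D.par (Q h) :=
    Function.update_of_ne (fun h' : Q h = v => hvis (h' ▸ hE.queue_vis h hm)) _ _
  -- The insertion changes neither the current node nor its parent, so the flag cannot switch on.
  have key : parentAhead adj (D.insert s (Q h) v d) (Function.update Q m v) h (j + 1) →
      parentAhead adj D Q h j := by
    intro h' i hi
    have := h' i (by omega)
    rwa [hQ, hpar] at this
  unfold potential
  split_ifs with h1 h2 h2
  · omega
  · exact absurd (key h1) h2
  · omega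
  · omega

end Exploring

/-! ### The exploration program -/

/-! Registers. -/

notation "rN" => (0 : ℕ)
notation "rM" => (1 : ℕ)
notation "rInf" => (2 : ℕ)
notation "rSrc" => (3 : ℕ)
notation "rRad" => (4 : ℕ)
notation "rHead" => (5 : ℕ)
notation "rTail" => (6 : ℕ)
notation "rPos" => (7 : ℕ)
notation "rHit" => (8 : ℕ)
notation "rHitU" => (9 : ℕ)
notation "rHitV" => (10 : ℕ)
notation "rU" => (11 : ℕ)
notation "rV" => (12 : ℕ)
notation "rD" => (13 : ℕ)
notation "rI" => (14 : ℕ)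

/-! Arrays. -/

notation "aMat" => (0 : ℕ)
notation "aKey" => (1 : ℕ)
notation "aAdj" => (2 : ℕ)
notation "aTmp" => (3 : ℕ)
notation "aQueue" => (4 : ℕ)
notation "aPar" => (5 : ℕ)
notation "aDist" => (6 : ℕ)
notation "aFst" => (7 : ℕ)
notation "aDep" => (8 : ℕ)
notation "aVis" => (9 : ℕ)

open MinCycle.Expr in
def exploreAdd : Cmd :=
  .put aPar (var rV) (var rU) ;;
  .put aDist (var rV) (var rD) ;;
  .put aDep (var rV) (get aDep (var rU) + const 1) ;;
  .put aFst (var rV) (same (var rU) (var rSrc) * var rV +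
    (const 1 - same (var rU) (var rSrc)) * get aFst (var rU)) ;;
  .put aVis (var rV) (const 1) ;;
  .put aQueue (var rTail) (var rV) ;;
  .assign rTail (var rTail + const 1)

open MinCycle.Expr in
def exploreNode : Cmd :=
  .assign rPos (var rPos + const 1) ;;
  .ite (same (var rV) (get aPar (var rU))) .skip
    (.ite (same (get aVis (var rV)) (const 1))
      (.assign rHit (const 1) ;; .assign rHitU (var rU) ;; .assign rHitV (var rV))
      exploreAdd)

open MinCycle.Expr in
def exploreAdvance : Cmd :=
  .assign rHead (var rHead + const 1) ;; .assign rPos (const 0)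

-- One step examines one edge. The queue is first in, first out and need not be ordered by distance:
-- as long as there is no clash, the explored part is a tree and its distances are forced.
open MinCycle.Expr in
def exploreStep : Cmd :=
  .assign rU (get aQueue (var rHead)) ;;
  .ite (less (var rPos) (var rN))
    (.assign rV (get aAdj (var rU * var rN + var rPos)) ;;
     .assign rD (get aDist (var rU) + get aKey (var rU * var rN + var rV)) ;;
     .ite (less (var rD) (var rRad + const 1)) exploreNode exploreAdvance)
    exploreAdvance

open MinCycle.Expr in
def exploreInit : Cmd :=
  .put aVis (var rSrc) (const 1) ;;
  .put aPar (var rSrc) (var rSrc) ;;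
  .put aDist (var rSrc) (const 0) ;;
  .put aDep (var rSrc) (const 0) ;;
  .put aFst (var rSrc) (var rSrc) ;;
  .put aQueue (const 0) (var rSrc) ;;
  .assign rHead (const 0) ;;
  .assign rTail (const 1) ;;
  .assign rPos (const 0) ;;
  .assign rHit (const 0)

open MinCycle.Expr in
/-- Explore from `rSrc` up to distance `rRad`; `rHit` tells whether a clash was found. -/
def explore : Cmd :=
  .for rI (var rN) (.put aVis (var rI) (const 0)) ;;
  exploreInit ;;
  .loop (less (var rHead) (var rTail) * same (var rHit) (const 0)) exploreStep

/-- The tree stored in the memory. -/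
def State.tree (n : ℕ) (s : State) : TreeData where
  vis v := v < n ∧ s.arr aVis v = 1
  par := s.arr aPar
  dist := s.arr aDist
  dep := s.arr aDep
  fst := s.arr aFst

/-- The outcome of an exploration. -/
def Explored (n : ℕ) (key : ℕ → ℕ → ℕ) (a t : ℕ) (s : State) : Prop :=
  (s.tree n).IsTree n key a t ∧
    (s.var rHit = 0 ∧ (s.tree n).Closed n key t ∨
     s.var rHit = 1 ∧ (s.tree n).Clash key t (s.var rHitU) (s.var rHitV) ∧
       s.var rHitU ≠ s.var rHitV)

/-- The memory holds the keys and the sorted rows of nodes. -/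
structure HasRows (n : ℕ) (key adj : ℕ → ℕ → ℕ) (s : State) : Prop where
  size : s.var rN = n
  key_eq : ∀ u < n, ∀ v < n, s.arr aKey (u * n + v) = key u v
  adj_eq : ∀ u < n, ∀ j < n, s.arr aAdj (u * n + j) = adj u j

theorem HasRows.of_frame {n : ℕ} {key adj : ℕ → ℕ → ℕ} {s s' : State} {p : Cmd}
    (h : HasRows n key adj s) (hf : Frame p s s')
    (hp : 0 ∉ p.wv ∧ 1 ∉ p.wa ∧ 2 ∉ p.wa) : HasRows n key adj s' where
  size := (hf.var 0 hp.1).trans h.size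
  key_eq := by rw [hf.arr 1 ⟨by decide, hp.2.1⟩]; exact h.key_eq
  adj_eq := by rw [hf.arr 2 ⟨by decide, hp.2.2⟩]; exact h.adj_eq

section Explore

variable {B n t a : ℕ} {key adj : ℕ → ℕ → ℕ} {s : State}

/-- The invariant of the main loop. -/
def ExploreInv (n : ℕ) (key adj : ℕ → ℕ → ℕ) (a t : ℕ) (s : State) : Prop :=
  s.var rHit = 0 ∧ Exploring n key adj a t (s.tree n) (s.arr aQueue) (s.var rTail) (s.var rHead)
      (s.var rPos) ∨
  s.var rHit = 1 ∧ (s.tree n).IsTree n key a t ∧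
    (s.tree n).Clash key t (s.var rHitU) (s.var rHitV) ∧ s.var rHitU ≠ s.var rHitV

open Classical in
noncomputable def exploreMeasure (n : ℕ) (adj : ℕ → ℕ → ℕ) (s : State) : ℕ :=
  if s.var rHit = 0 then
    1 + potential n adj (s.tree n) (s.arr aQueue) (s.var rTail) (s.var rHead) (s.var rPos)
  else 0

theorem runs_exploreAdvance (hn : n + 1 < B) (hhit : s.var rHit = 0)
    (hE : Exploring n key adj a t (s.tree n) (s.arr aQueue) (s.var rTail) (s.var rHead)
      (s.var rPos)) (hm : s.var rHead < s.var rTail)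
    (hadj : SortedRow n key adj (s.arr aQueue (s.var rHead)))
    (hj : s.var rPos < n → t < (s.tree n).dist (s.arr aQueue (s.var rHead)) +
      key (s.arr aQueue (s.var rHead))
        (adj (s.arr aQueue (s.var rHead)) (s.var rPos))) :
    Runs B exploreAdvance s 10 fun s' => ExploreInv n key adj a t s' ∧
      exploreMeasure n adj s' < exploreMeasure n adj s := by
  have hmn := hE.m_le
  refine runs_assign_seq (by decide) (by decide) (fun _ => by simp; omega) ?_
  refine runs_assign (by decide) (by decide) (fun _ => by simp; omega) ?_
  constructor
  · left
    refine ⟨by simpa using hhit, ?_⟩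
    simpa [State.tree] using hE.advance hm hadj hj
  · simpa [exploreMeasure, hhit, State.tree] using hE.potential_advance hm

theorem runs_exploreAdd {u v : ℕ} (hU : s.var rU = u) (hV : s.var rV = v) (hS : s.var rSrc = a)
    (huv : u ≠ v) (hdep : s.arr aDep u + 1 < B) (hmn : s.var rTail + 1 < B) :
    Runs B exploreAdd s 80 fun s' => (∀ x, s'.var x = if x = rTail then s.var rTail + 1 else s.var x) ∧
      s'.arr aQueue = Function.update (s.arr aQueue) (s.var rTail) v ∧
      s'.arr aPar = Function.update (s.arr aPar) v u ∧
      s'.arr aDist = Function.update (s.arr aDist) v (s.var rD) ∧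
      s'.arr aDep = Function.update (s.arr aDep) v (s.arr aDep u + 1) ∧
      s'.arr aFst = Function.update (s.arr aFst) v (if u = a then v else s.arr aFst u) ∧
      s'.arr aVis = Function.update (s.arr aVis) v 1 := by
  subst hU hV hS
  refine runs_put_seq (by decide) (by decide) (fun hb => hb.var _) ?_
  refine runs_put_seq (by decide) (by decide) (fun hb => hb.var _) ?_
  refine runs_put_seq (by decide) (by decide) (fun _ => by simp [hdep]) ?_
  refine runs_put_seq (by decide) (by decide) (fun hb => ?_) ?_
  · have := hb.arr aFst (s.var rU)
    have := hb.var rV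
    by_cases h : s.var rU = s.var rSrc
    · simpa [h] using hb.var rV
    · simpa [h] using hb.arr aFst (s.var rU)
  refine runs_put_seq (by decide) (by decide) (fun hb => by have := hb.le; simp; omega) ?_
  refine runs_put_seq (by decide) (by decide) (fun hb => hb.var _) ?_
  refine runs_assign (by decide) (by decide) (fun hb => by simp [hmn]) ?_
  by_cases h : s.var rU = s.var rSrc <;> simp [h]

theorem runs_exploreNode (hpos : ∀ x y, 1 ≤ key x y) (hself : ∀ x, t < key x x)
    (hB : n + 2 < B) (htB : t + 2 < B) (hhit : s.var rHit = 0) (hS : s.var rSrc = a)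
    (hE : Exploring n key adj a t (s.tree n) (s.arr aQueue) (s.var rTail) (s.var rHead)
      (s.var rPos)) (hm : s.var rHead < s.var rTail)
    (hadj : SortedRow n key adj (s.arr aQueue (s.var rHead))) (hj : s.var rPos < n)
    (hU : s.var rU = s.arr aQueue (s.var rHead))
    (hV : s.var rV = adj (s.arr aQueue (s.var rHead)) (s.var rPos))
    (hD : s.var rD = s.arr aDist (s.var rU) + key (s.var rU) (s.var rV)) (hle : s.var rD ≤ t) :
    Runs B exploreNode s 150 fun s' => ExploreInv n key adj a t s' ∧
      exploreMeasure n adj s' < exploreMeasure n adj s := by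
  have hmn := hE.m_le
  have hvn : s.var rV < n := hV ▸ hadj.lt _ hj
  have hun := hE.lt_n hm
  refine runs_assign_seq (by decide) (by decide) (fun _ => by simp; omega) ?_
  refine runs_ite (by decide) (by decide) (fun h => ?_) (fun h => ?_)
  · simp at h
    refine runs_skip (by decide) ?_
    rw [hU, hV] at h
    constructor
    · left
      refine ⟨by simpa using hhit, ?_⟩
      simpa [State.tree] using hE.skip hm hj h
    · simpa [exploreMeasure, hhit, State.tree] using
        Exploring.potential_skip (D := s.tree n) (m := s.var rTail) hadj hj h
  · simp at h
    have hne : s.var rU ≠ s.var rV := by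
      intro h'
      have := hself (s.var rU)
      rw [← h'] at hD
      omega
    refine runs_ite (by decide) (by decide) (fun h' => ?_) (fun h' => ?_)
    · simp at h'
      refine runs_assign_seq (by decide) (by decide) (fun _ => by simp; omega) ?_
      refine runs_assign_seq (by decide) (by decide) (fun hb => hb.var _) ?_
      refine runs_assign (by decide) (by decide) (fun hb => hb.var _) ?_
      constructor
      · right
        refine ⟨by simp, hE.tree, ?_, by simpa using hne⟩
        have := hE.clash hm hadj hj hself (by rw [← hV, ← hU]; exact hD ▸ hle)
          (by rw [← hV]; exact ⟨hvn, h'⟩) (by rw [← hV, ← hU]; exact h)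
        rw [← hV, ← hU] at this
        simpa [State.tree] using this
      · simp [exploreMeasure, hhit]
    · simp at h'
      -- The only remaining case: a new node within the radius.
      have hvis : ¬ (s.tree n).vis (s.var rV) := fun h'' => h' h''.2
      have hdist := hE.tree.dep_le_dist hpos _ (hE.queue_vis _ hm)
      rw [← hU] at hdist
      have hdd : s.arr aDep (s.var rU) ≤ s.arr aDist (s.var rU) := hdist
      refine Runs.mono (runs_exploreAdd (u := s.var rU) (v := s.var rV) (a := a) (by simp)
        (by simp) (by simpa using hS) hne (by simp; omega) (by simp; omega)) (by decide) ?_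
      rintro s' ⟨h1, h2, h3, h4, h5, h6, h7⟩
      have htree : s'.tree n = (s.tree n).insert a (s.var rU) (s.var rV) (s.var rD) := by
        simp only [State.tree, TreeData.insert, h3, h4, h5, h6, h7, State.setv_arr, State.setv_var]
        congr 1
        funext x
        by_cases hx : x = s.var rV <;> simp [hx, hvn]
      have happ := hE.append hm hadj hj hV (by rw [← hU]; exact hD) hle hvis
      have hpot := hE.potential_append (d := s.var rD) hm hV hvis hvn
      rw [← hU] at happ hpot
      have e1 : s'.var rHit = 0 := by rw [h1]; simpa using hhit
      have e2 : s'.var rTail = s.var rTail + 1 := by rw [h1]; simp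
      have e3 : s'.var rHead = s.var rHead := by rw [h1]; simp
      have e4 : s'.var rPos = s.var rPos + 1 := by rw [h1]; simp
      simp only [State.setv_arr, State.setv_var] at h2
      constructor
      · left
        rw [htree, h2, e2, e3, e4]
        exact ⟨e1, happ⟩
      · rw [exploreMeasure, exploreMeasure, if_pos e1, if_pos hhit, htree, h2, e2, e3, e4]
        exact Nat.add_lt_add_left hpot 1

theorem runs_exploreStep (hrows : HasRows n key adj s) (hpos : ∀ x y, 1 ≤ key x y)
    (hself : ∀ x, t < key x x) (hadj : ∀ u < n, SortedRow n key adj u) (hT : s.var rRad = t)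
    (hB : n + 2 < B) (htB : ∀ x y, t + key x y + 2 < B) (hhit : s.var rHit = 0)
    (hS : s.var rSrc = a)
    (hE : Exploring n key adj a t (s.tree n) (s.arr aQueue) (s.var rTail) (s.var rHead)
      (s.var rPos)) (hm : s.var rHead < s.var rTail) :
    Runs B exploreStep s 200 fun s' => ExploreInv n key adj a t s' ∧
      exploreMeasure n adj s' < exploreMeasure n adj s := by
  have hun := hE.lt_n hm
  have hadj' := hadj _ hun
  have hdist : s.arr aDist (s.arr aQueue (s.var rHead)) ≤ t :=
    hE.tree.dist_le _ (hE.queue_vis _ hm)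
  have hlast : ¬ s.var rPos < n → Runs B exploreAdvance
      (s.setv rU ((Expr.get aQueue (Expr.var rHead)).eval s)) 10 fun s' =>
        ExploreInv n key adj a t s' ∧ exploreMeasure n adj s' < exploreMeasure n adj s := by
    intro hj
    refine Runs.mono (runs_exploreAdvance (n := n) (key := key) (adj := adj) (a := a) (t := t)
      (by omega) (by simpa using hhit) (by simpa [State.tree] using hE) (by simpa using hm)
      (by simpa using hadj') (fun h => absurd (by simpa using h) hj)) le_rfl ?_
    rintro s' ⟨h1, h2⟩
    exact ⟨h1, by simpa [exploreMeasure, State.tree] using h2⟩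
  refine runs_assign_seq (by decide) (by decide) (fun hb => hb.arr _ _) ?_
  refine runs_ite (by decide) (by decide) (fun h => ?_) (fun h => ?_)
  · simp [hrows.size] at h
    have hK : s.arr aAdj (s.arr aQueue (s.var rHead) * n + s.var rPos) =
      adj (s.arr aQueue (s.var rHead)) (s.var rPos) := hrows.adj_eq _ hun _ h
    have hK' := hrows.key_eq _ hun _ (hadj'.lt _ h)
    refine runs_assign_seq (by decide) (by decide) (fun hb => hb.arr _ _) ?_
    refine runs_assign_seq (by decide) (by decide) (fun hb => ?_) ?_
    · have := htB (s.arr aQueue (s.var rHead)) (adj (s.arr aQueue (s.var rHead)) (s.var rPos))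
      simp [hrows.size, hK, hK']
      omega
    refine runs_ite (by decide) (by decide) (fun h' => ?_) (fun h' => ?_)
    · simp [hrows.size, hK, hK', hT] at h'
      refine Runs.mono (runs_exploreNode (n := n) (key := key) (adj := adj) (a := a) (t := t)
        hpos hself hB (by have := htB 0 0; omega) (by simpa using hhit) (by simpa using hS)
        (by simpa [State.tree] using hE) (by simpa using hm) (by simpa using hadj')
        (by simpa using h) (by simp) (by simp [hrows.size, hK]) (by simp [hrows.size, hK, hK'])
        (by simp [hrows.size, hK, hK']; omega)) (by decide) ?_
      rintro s' ⟨h1, h2⟩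
      exact ⟨h1, by simpa [exploreMeasure, State.tree] using h2⟩
    · simp [hrows.size, hK, hK', hT] at h'
      refine Runs.mono (runs_exploreAdvance (n := n) (key := key) (adj := adj) (a := a) (t := t)
        (by omega) (by simpa using hhit) (by simpa [State.tree] using hE) (by simpa using hm)
        (by simpa using hadj') (fun _ => by simpa [State.tree] using by omega)) (by decide) ?_
      rintro s' ⟨h1, h2⟩
      exact ⟨h1, by simpa [exploreMeasure, State.tree] using h2⟩
  · simp [hrows.size] at h
    exact Runs.mono (hlast (by omega)) (by decide) fun s' h => h

/-- Time is linear in `n`, because the loop stops at the first clash and otherwise each step lowers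
`potential`, which is initially at most `4 * n + 1`. -/
theorem runs_explore (hrows : HasRows n key adj s) (hpos : ∀ x y, 1 ≤ key x y)
    (hself : ∀ x, t < key x x) (hadj : ∀ u < n, SortedRow n key adj u) (hT : s.var rRad = t)
    (hB : n + 2 < B) (htB : ∀ x y, t + key x y + 2 < B) (hS : s.var rSrc = a) (ha : a < n) :
    Runs B explore s (2000 * n) (Explored n key a t) := by
  refine Runs.seq (T₁ := 20 * n + 10) (T₂ := 900 * n + 900) ?_ (by omega)
  refine runs_for (n := n) (Tb := 8) (fun k s' => ∀ i < k, s'.arr aVis i = 0) (by decide)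
    (by decide) (fun i hi => absurd hi (Nat.not_lt_zero i))
    (fun s' hf => (hf.var 0 (by decide)).trans hrows.size) (by omega) ?_ (by simp [Expr.cost]; omega)
    ?_
  · intro k hk s' hf hi hI
    refine runs_put (by decide) (by decide) (fun hb => by have := hb.le; simp; omega) ?_
    intro i hik
    simp only [State.setv_arr, Expr.eval_var, Expr.eval_const, hi]
    rw [State.put_arr_self _ _ _ _ (by decide), Function.update_apply]
    split_ifs with h
    · rfl
    · exact hI i (by omega)
  · intro s1 hf1 hi1 hvis
    have hrows1 := hrows.of_frame hf1 (by decide)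
    have hS1 := (hf1.var rSrc (by decide)).trans hS
    have hT1 := (hf1.var rRad (by decide)).trans hT
    refine Runs.seq (T₁ := 100) (T₂ := 850 * n + 800) (Runs.frame (R := fun s' =>
      s'.var rHit = 0 ∧ s'.var rTail = 1 ∧ s'.var rHead = 0 ∧ s'.var rPos = 0 ∧
      (s'.arr aQueue) 0 = a ∧ (∀ v, (s'.tree n).vis v ↔ v = a) ∧ s'.arr aPar a = a ∧
      s'.arr aDist a = 0 ∧ s'.arr aDep a = 0 ∧ s'.arr aFst a = a) ?_ ?_) (by omega)
    · refine runs_put_seq (by decide) (by decide) (fun hb => by have := hb.le; simp; omega) ?_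
      refine runs_put_seq (by decide) (by decide) (fun hb => hb.var _) ?_
      refine runs_put_seq (by decide) (by decide) (fun hb => by have := hb.le; simp; omega) ?_
      refine runs_put_seq (by decide) (by decide) (fun hb => by have := hb.le; simp; omega) ?_
      refine runs_put_seq (by decide) (by decide) (fun hb => hb.var _) ?_
      refine runs_put_seq (by decide) (by decide) (fun hb => hb.var _) ?_
      refine runs_assign_seq (by decide) (by decide) (fun hb => by have := hb.le; simp; omega) ?_
      refine runs_assign_seq (by decide) (by decide) (fun hb => by have := hb.le; simp; omega) ?_
      refine runs_assign_seq (by decide) (by decide) (fun hb => by have := hb.le; simp; omega) ?_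
      refine runs_assign (by decide) (by decide) (fun hb => by have := hb.le; simp; omega) ?_
      simp [State.tree, hS1]
      intro v
      by_cases hv : v = a
      · simp [hv, ha]
      · simp only [hv, iff_false, not_and, Function.update_of_ne, ne_eq, not_false_eq_true]
        intro hvn
        rw [hvis v hvn]
        decide
    · rintro s2 hf2 ⟨g1, g2, g3, g4, g5, g6, g7, g8, g9, g10⟩
      have hrows2 := hrows1.of_frame hf2 (by decide)
      have hS2 := (hf2.var rSrc (by decide)).trans hS1
      have hT2 := (hf2.var rRad (by decide)).trans hT1
      have hE : Exploring n key adj a t (s2.tree n) (s2.arr aQueue) 1 0 0 := by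
        constructor
        · constructor
          · exact fun v hv => hv.1
          · exact (g6 a).2 rfl
          · exact g7
          · exact g8
          · exact g9
          · exact g10
          all_goals intro v hv
          all_goals rw [g6] at hv
          · exact fun h => absurd hv h
          · exact fun h => absurd hv h
          · exact fun h => absurd hv h
          · exact fun h => absurd hv h
          · rw [hv, show (s2.tree n).dist a = 0 from g8]
            omega
        · omega
        · omega
        · intro i hi
          rw [Nat.lt_one_iff.1 hi, g5]
          exact (g6 a).2 rfl
        · omega
        · intro v hv
          exact ⟨0, by omega, by rw [g5, (g6 v).1 hv]⟩
        · intro i hi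
          omega
        · intro _ i hi
          omega
        · intro v hv hvs
          exact absurd ((g6 v).1 hv) hvs
      refine runs_while (ExploreInv n key adj a t) (exploreMeasure n adj) 200 (by decide)
        (Or.inl ⟨g1, by rw [g2, g3, g4]; exact hE⟩) ?_ ?_ ?_
      · intro s' hf hI he
        simp at he
        rcases hI with ⟨h1, h2⟩ | ⟨h1, -⟩
        · exact runs_exploreStep (hrows2.of_frame hf (by decide)) hpos hself hadj
            ((hf.var rRad (by decide)).trans hT2) hB htB h1
            ((hf.var rSrc (by decide)).trans hS2) h2 he.1
        · omega
      · have hpot : exploreMeasure n adj s2 ≤ 4 * n + 2 := by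
          unfold exploreMeasure potential
          split_ifs <;> omega
        have := Nat.mul_le_mul_right (200 + ((Expr.less (.var rHead) (.var rTail) *
          Expr.same (.var rHit) (.const 0)).cost) + 1) hpot
        rw [show (Expr.less (.var rHead) (.var rTail) *
          Expr.same (.var rHit) (.const 0)).cost = 7 from rfl] at this ⊢
        omega
      · intro s' hf hI he
        rcases hI with ⟨h1, h2⟩ | ⟨h1, h2, h3⟩
        · refine ⟨h2.tree, Or.inl ⟨h1, ?_⟩⟩
          simp [h1] at he
          have := h2.h_le
          rw [show s'.var rHead = s'.var rTail by omega] at h2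
          exact h2.closed
        · exact ⟨h2, Or.inr ⟨h1, h3⟩⟩

end Explore

/-! ### Binary search for the smallest radius with a clash -/

notation "rLow" => (15 : ℕ)
notation "rHigh" => (16 : ℕ)

open MinCycle.Expr in
/-- Explore from all nodes up to distance `rRad`, until a clash is found. -/
def probe : Cmd :=
  .assign rHit (const 0) ;;
  .assign rSrc (const 0) ;;
  .loop (less (var rSrc) (var rN) * same (var rHit) (const 0))
    (explore ;; .assign rSrc (var rSrc + same (var rHit) (const 0)))

-- The invariant is that `rLow` is clear and `rHigh` is not; monotonicity of clearness is never
-- needed. The final probe rebuilds a tree with a clash, as the last probe of the loop may have been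
-- a clear one.
open MinCycle.Expr in
def search : Cmd :=
  .assign rLow (const 0) ;;
  .assign rHigh (var rN * var rM) ;;
  .loop (less (var rLow + const 1) (var rHigh))
    (.assign rRad ((var rLow + var rHigh) / const 2) ;;
     probe ;;
     .ite (same (var rHit) (const 0)) (.assign rLow (var rRad)) (.assign rHigh (var rRad))) ;;
  .assign rRad (var rHigh) ;;
  probe

/-- The memory holds a tree with a clash. -/
def HasClash (n : ℕ) (key : ℕ → ℕ → ℕ) (t : ℕ) (s : State) : Prop :=
  ∃ a < n, (s.tree n).IsTree n key a t ∧
    (s.tree n).Clash key t (s.var rHitU) (s.var rHitV) ∧ s.var rHitU ≠ s.var rHitV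

/-- What the exploration programs rely on, for radii up to `R`. -/
structure KeysOK (B n R : ℕ) (key adj : ℕ → ℕ → ℕ) : Prop where
  pos : ∀ x y, 1 ≤ key x y
  self : ∀ x, R < key x x
  row : ∀ u < n, SortedRow n key adj u
  size : n + 2 < B
  bound : ∀ x y, R + key x y + 2 < B

section Search

variable {B n R t : ℕ} {key adj : ℕ → ℕ → ℕ} {s : State}

theorem runs_probe (hrows : HasRows n key adj s) (hok : KeysOK B n R key adj)
    (hT : s.var rRad = t) (htR : t ≤ R) (hn : 0 < n) :
    Runs B probe s (2100 * (n * n)) fun s' =>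
      s'.var rHit = 0 ∧ Clear n key t ∨ s'.var rHit = 1 ∧ HasClash n key t s' := by
  have hnn : n ≤ n * n := Nat.le_mul_self n
  refine runs_assign_seq (by decide) (by simp; omega)
    (fun hb => by have := hb.le; simp; omega) ?_
  refine runs_assign_seq (by decide) (by simp; omega)
    (fun hb => by have := hb.le; simp; omega) ?_
  refine runs_while (fun s' =>
      s'.var rHit = 0 ∧ s'.var rSrc ≤ n ∧
        (∀ a < s'.var rSrc, ∃ D : TreeData, D.IsTree n key a t ∧ D.Closed n key t) ∨
      s'.var rHit = 1 ∧ HasClash n key t s')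
    (fun s' => if s'.var rHit = 0 then n - s'.var rSrc else 0) (2000 * n + 10) (by decide)
    (Or.inl (by simp)) ?_ ?_ ?_
  · intro s' hf hI he
    have hrows' : HasRows n key adj s' := by
      refine HasRows.of_frame (s := (s.setv rHit 0).setv rSrc 0) ?_ hf (by decide)
      exact ⟨by simpa using hrows.size, hrows.key_eq, hrows.adj_eq⟩
    have hT' : s'.var rRad = t := by
      rw [hf.var rRad (by decide)]
      simpa using hT
    simp [hrows'.size] at he
    rcases hI with ⟨h1, h2, h3⟩ | ⟨h1, -⟩
    · refine Runs.seq (Runs.frame (runs_explore hrows' hok.pos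
        (fun x => htR.trans_lt (hok.self x)) hok.row hT' hok.size
        (fun x y => by have := hok.bound x y; omega) rfl he.1) ?_) le_rfl
      rintro s'' hf' ⟨hD, h4⟩
      have hsrc := hf'.var rSrc (by decide)
      refine runs_assign (by decide) (by decide) (fun _ => ?_) ?_
      · have := hok.size
        have := truth_le (s''.var rHit = 0)
        simp [hsrc]
        omega
      · rcases h4 with ⟨h4, hcl⟩ | ⟨h4, hcl⟩
        · refine ⟨Or.inl ?_, ?_⟩
          · simp [h4, hsrc]
            refine ⟨by omega, fun a ha => ?_⟩
            rcases ha.lt_or_eq with ha | rfl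
            · exact h3 a ha
            · exact ⟨_, hD, hcl⟩
          · simp [h4, hsrc, h1]
            omega
        · refine ⟨Or.inr ?_, ?_⟩
          · simp only [State.setv_var]
            exact ⟨by simpa using h4, s'.var rSrc, he.1, hD, by simpa [State.tree] using hcl⟩
          · simp [h4, h1]
            omega
    · omega
  · have : n * (2000 * n + 10 + 7 + 1) = 2000 * (n * n) + 18 * n := by ring
    simp
    omega
  · intro s' hf hI he
    have hrows' : s'.var rN = n := by
      rw [hf.var rN (by decide)]
      simpa using hrows.size
    simp [hrows'] at he
    rcases hI with ⟨h1, h2, h3⟩ | h1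
    · exact Or.inl ⟨h1, fun a ha => h3 a (by omega)⟩
    · exact Or.inr h1

/-- The search ends with a clash at some radius `t + 1`, while there is none at radius `t`. -/
theorem runs_search {M : ℕ} (hrows : HasRows n key adj s)
    (hok : KeysOK B n (n * M) key adj) (hM : s.var rM = M) (hn : 0 < n) (hM0 : 0 < M)
    (hclear : ¬ Clear n key (n * M)) :
    Runs B search s ((Nat.clog 2 (n * M) + 2) * (2200 * (n * n))) fun s' =>
      ∃ t, t + 1 ≤ n * M ∧ s'.var rLow = t ∧ Clear n key t ∧ HasClash n key (t + 1) s' := by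
  have hnn : n ≤ n * n := Nat.le_mul_self n
  have hnM : 0 < n * M := Nat.mul_pos hn hM0
  have hB := hok.bound 0 0
  have hT := add_mul (Nat.clog 2 (n * M)) 2 (2200 * (n * n))
  refine runs_assign_seq (by decide) (by simp; omega)
    (fun hb => by have := hb.le; simp; omega) ?_
  refine runs_assign_seq (by decide) (by simp; omega)
    (fun hb => by simp [hrows.size, hM]; omega) ?_
  refine Runs.seq (T₁ := Nat.clog 2 (n * M) * (2200 * (n * n)) + 20) (T₂ := 2200 * (n * n)) ?_ ?_
  rotate_left
  · simp
    omega
  have hrows1 : ∀ {p s'}, Frame p ((s.setv rLow 0).setv rHigh (n * M)) s' →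
      (0 ∉ p.wv ∧ 1 ∉ p.wa ∧ 2 ∉ p.wa) → HasRows n key adj s' := by
    intro p s' hf hp
    refine HasRows.of_frame (s := (s.setv rLow 0).setv rHigh (n * M)) ?_ hf hp
    exact ⟨by simpa using hrows.size, hrows.key_eq, hrows.adj_eq⟩
  simp only [Expr.eval_const, Expr.eval_mul, Expr.eval_var]
  rw [show (s.setv rLow 0).var rN = n by simpa using hrows.size,
    show (s.setv rLow 0).var rM = M by simpa using hM]
  refine runs_while (fun s' => s'.var rLow < s'.var rHigh ∧ s'.var rHigh ≤ n * M ∧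
      Clear n key (s'.var rLow) ∧ ¬ Clear n key (s'.var rHigh))
    (fun s' => Nat.clog 2 (s'.var rHigh - s'.var rLow)) (2100 * (n * n) + 40) (by decide)
    (by simpa [hn, hM0, hclear] using clear_zero hok.pos) ?_ ?_ ?_
  · rintro s' hf ⟨h1, h2, h3, h4⟩ he
    have hr := hrows1 hf (by decide)
    simp at he
    refine runs_assign_seq (by decide) (by simp)
      (fun hb => by simp; omega) ?_
    refine Runs.seq (T₁ := 2100 * (n * n)) (T₂ := 10) (Runs.frame (runs_probe (t :=
      (s'.var rLow + s'.var rHigh) / 2) (R := n * M) (adj := adj)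
      ⟨by simpa using hr.size, hr.key_eq, hr.adj_eq⟩ hok (by simp) (by omega) hn) ?_)
      (by simp)
    intro s'' hf' hres
    have e1 : s''.var rLow = s'.var rLow := by
      rw [hf'.var rLow (by decide)]; simp
    have e2 : s''.var rHigh = s'.var rHigh := by
      rw [hf'.var rHigh (by decide)]; simp
    have e3 : s''.var rRad = (s'.var rLow + s'.var rHigh) / 2 := by
      rw [hf'.var rRad (by decide)]; simp
    -- Both halves of an interval of length `d` have length at most `⌈d / 2⌉`, and passing from `d`
    -- to this value lowers `Nat.clog 2` by one.
    have hclog := Nat.clog_of_two_le (b := 2) (by norm_num)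
      (show 2 ≤ s'.var rHigh - s'.var rLow by omega)
    rw [show s'.var rHigh - s'.var rLow + 2 - 1 = s'.var rHigh - s'.var rLow + 1 by omega] at hclog
    have hmono : ∀ x, x ≤ (s'.var rHigh - s'.var rLow + 1) / 2 →
        Nat.clog 2 x < Nat.clog 2 (s'.var rHigh - s'.var rLow) := by
      intro x hx
      rw [hclog]
      exact Nat.lt_succ_of_le (Nat.clog_mono_right 2 hx)
    refine runs_ite (by decide) (by decide) (fun h => ?_) (fun h => ?_)
    · simp at h
      refine runs_assign (by decide) (by decide) (fun hb => hb.var _) ?_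
      simp [e2, e3]
      rcases hres with ⟨-, hc⟩ | ⟨h', -⟩
      · exact ⟨⟨by omega, h2, hc, h4⟩, hmono _ (by omega)⟩
      · omega
    · simp at h
      refine runs_assign (by decide) (by decide) (fun hb => hb.var _) ?_
      simp [e1, e3]
      rcases hres with ⟨h', -⟩ | ⟨-, a, ha, hD, hcl, hne⟩
      · omega
      · exact ⟨⟨by omega, by omega, h3, hD.not_clear_of_clash hcl hne⟩, hmono _ (by omega)⟩
  · simp
    have : Nat.clog 2 (n * M) * (2100 * (n * n) + 40 + 5 + 1) ≤
        Nat.clog 2 (n * M) * (2200 * (n * n)) := Nat.mul_le_mul_left _ (by omega)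
    omega
  · rintro s' hf ⟨h1, h2, h3, h4⟩ he
    have hr := hrows1 hf (by decide)
    simp at he
    have he' : s'.var rHigh = s'.var rLow + 1 := by omega
    refine runs_assign_seq (by decide) (by simp; omega)
      (fun hb => hb.var _) ?_
    refine Runs.mono (T₁ := 2100 * (n * n)) (Runs.frame (runs_probe (t := s'.var rLow + 1)
      (R := n * M) (adj := adj) ⟨by simpa using hr.size, hr.key_eq, hr.adj_eq⟩ hok
      (by simp [he']) (by omega) hn) ?_) (by simp; omega) fun _ h => h
    intro s'' hf' hres
    refine ⟨s'.var rLow, by omega, ?_, h3, ?_⟩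
    · rw [hf'.var rLow (by decide)]; simp
    · rcases hres with ⟨-, hc⟩ | ⟨-, h⟩
      · exact absurd (he' ▸ hc) h4
      · exact h

end Search

/-! ### Lists in arrays -/

/-- The entries of `f` from index `b` on form the list `L`. -/
def Holds (f : ℕ → ℕ) (b : ℕ) (L : List ℕ) : Prop :=
  ∀ (i : ℕ) (h : i < L.length), f (b + i) = L[i]

theorem Holds.append_update {f : ℕ → ℕ} {b : ℕ} {L : List ℕ} (h : Holds f b L) (x : ℕ) :
    Holds (Function.update f (b + L.length) x) b (L ++ [x]) := by
  intro i hi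
  rw [List.length_append, List.length_singleton] at hi
  rcases Nat.lt_succ_iff_lt_or_eq.1 hi with hi | rfl
  · rw [Function.update_of_ne (by omega), List.getElem_append_left hi, h i hi]
  · rw [Function.update_self, List.getElem_concat_length rfl]

theorem holds_nil (f : ℕ → ℕ) (b : ℕ) : Holds f b [] := fun i hi => absurd hi (Nat.not_lt_zero i)

/-! ### Sorting the rows by their keys, digit by digit -/

section Radix

variable {f : ℕ → ℕ} {L : List ℕ}

/-- One step of radix sort: first the entries with binary digit `0` at `p`, then the others. -/
def radixStep (f : ℕ → ℕ) (p : ℕ) (L : List ℕ) : List ℕ :=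
  L.filter (fun v => f v / p % 2 = 0) ++ L.filter (fun v => f v / p % 2 = 1)

theorem radixStep_perm (p : ℕ) : (radixStep f p L).Perm L := by
  have h : (fun v => decide (f v / p % 2 = 1)) = fun v => !decide (f v / p % 2 = 0) := by
    funext v
    rcases Nat.mod_two_eq_zero_or_one (f v / p) with h | h <;> simp [h]
  rw [radixStep, h]
  exact List.filter_append_perm _ _

/-- The step is stable: nodes with equal digit `k` keep their order by the lower digits, and digit
`k` outweighs all of those. -/
theorem radixStep_sorted {k : ℕ} (h : L.Pairwise fun a b => f a % 2 ^ k ≤ f b % 2 ^ k) :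
    (radixStep f (2 ^ k) L).Pairwise fun a b => f a % 2 ^ (k + 1) ≤ f b % 2 ^ (k + 1) := by
  have hmod : ∀ a, f a % 2 ^ (k + 1) = f a % 2 ^ k + 2 ^ k * (f a / 2 ^ k % 2) := fun a =>
    Nat.mod_pow_succ
  rw [radixStep, List.pairwise_append]
  refine ⟨?_, ?_, ?_⟩
  · refine (h.filter _).imp_of_mem fun {a b} ha hb hab => ?_
    simp only [List.mem_filter, decide_eq_true_eq] at ha hb
    rw [hmod, hmod, ha.2, hb.2]
    omega
  · refine (h.filter _).imp_of_mem fun {a b} ha hb hab => ?_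
    simp only [List.mem_filter, decide_eq_true_eq] at ha hb
    rw [hmod, hmod, ha.2, hb.2]
    omega
  · intro a ha b hb
    simp only [List.mem_filter, decide_eq_true_eq] at ha hb
    rw [hmod, hmod, ha.2, hb.2]
    have := Nat.mod_lt (f a) (show 0 < 2 ^ k by positivity)
    omega

end Radix

notation "rRow" => (17 : ℕ)
notation "rPow" => (18 : ℕ)
notation "rCnt" => (19 : ℕ)
notation "rJ" => (20 : ℕ)

open MinCycle.Expr in
/-- Append the nodes of the row whose key has the given digit to the temporary array. -/
def scatter (q : ℕ) : Cmd :=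
  .for rJ (var rN)
    (.assign rV (get aAdj (var rRow * var rN + var rJ)) ;;
     .assign rD (get aKey (var rRow * var rN + var rV) / var rPow) ;;
     .ite (same (var rD - var rD / const 2 * const 2) (const q))
       (.put aTmp (var rCnt) (var rV) ;; .assign rCnt (var rCnt + const 1)) .skip)

open MinCycle.Expr in
def sortRow : Cmd :=
  .double rPow (var rInf)
    (.assign rCnt (const 0) ;;
     scatter 0 ;;
     scatter 1 ;;
     .for rJ (var rN) (.put aAdj (var rRow * var rN + var rJ) (get aTmp (var rJ))))

open MinCycle.Expr in
def sortRows : Cmd := .for rRow (var rN) sortRow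

section RowSorting

variable {B n u p : ℕ} {s : State} {L : List ℕ}

/-- The list `L₀` is what the temporary array already holds, so the same statement serves the pass
for digit `0` and the later pass for digit `1`. -/
theorem runs_scatter {q : ℕ} (hq : q = 0 ∨ q = 1) (hn : s.var rN = n) (hu : s.var rRow = u)
    (hp : s.var rPow = p) (hB : n + 2 < B) (hL : Holds (s.arr aAdj) (u * n) L)
    (hlen : L.length = n) {L₀ : List ℕ} (hL₀ : Holds (s.arr aTmp) 0 L₀)
    (hc : s.var rCnt = L₀.length) (hlen₀ : L₀.length + (L.filter fun v =>
      s.arr aKey (u * n + v) / p % 2 = q).length ≤ n) :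
    Runs B (scatter q) s (100 * n + 20) fun s' =>
      Holds (s'.arr aTmp) 0 (L₀ ++ L.filter fun v => s.arr aKey (u * n + v) / p % 2 = q) ∧
      s'.var rCnt = (L₀ ++ L.filter fun v => s.arr aKey (u * n + v) / p % 2 = q).length := by
  refine runs_for (n := n) (Tb := 80)
    (fun k s' => Holds (s'.arr aTmp) 0 (L₀ ++ (L.take k).filter fun v =>
        s.arr aKey (u * n + v) / p % 2 = q) ∧
      s'.var rCnt = (L₀ ++ (L.take k).filter fun v =>
        s.arr aKey (u * n + v) / p % 2 = q).length)
    (by rcases hq with rfl | rfl <;> decide) (by decide) (by simpa [hc] using hL₀)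
    (fun s' hf => (hf.var 0 (by rcases hq with rfl | rfl <;> decide)).trans hn) (by omega) ?_
    (by simp; omega) ?_
  · rintro k hk s' hf hi ⟨h1, h2⟩
    have e1 : s'.var rN = n := (hf.var rN (by rcases hq with rfl | rfl <;> decide)).trans hn
    have e2 : s'.var rRow = u := (hf.var rRow (by rcases hq with rfl | rfl <;> decide)).trans hu
    have e3 : s'.var rPow = p := (hf.var rPow (by rcases hq with rfl | rfl <;> decide)).trans hp
    have e4 : s'.arr aAdj = s.arr aAdj := hf.arr _ (by rcases hq with rfl | rfl <;> decide)
    have e5 : s'.arr aKey = s.arr aKey := hf.arr _ (by rcases hq with rfl | rfl <;> decide)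
    have hk' : k < L.length := by omega
    have htake : L.take (k + 1) = L.take k ++ [L[k]] := (List.take_concat_get' L k hk').symm
    have hv : s.arr aAdj (u * n + k) = L[k] := hL k hk'
    refine runs_assign_seq (by decide) (by decide) (fun hb => hb.arr _ _) ?_
    refine runs_assign_seq (by decide) (by decide) (fun hb => ?_) ?_
    · exact (Nat.div_le_self _ _).trans_lt (hb.arr _ _)
    have hmod : ∀ x : ℕ, x - x / 2 * 2 = x % 2 := fun x => by omega
    have hmono : ((L.take (k + 1)).filter fun v =>
        s.arr aKey (u * n + v) / p % 2 = q).length ≤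
        (L.filter fun v => s.arr aKey (u * n + v) / p % 2 = q).length :=
      ((List.take_sublist _ _).filter _).length_le
    refine runs_ite (by rcases hq with rfl | rfl <;> decide)
      (by rcases hq with rfl | rfl <;> decide) (fun h => ?_) (fun h => ?_)
    · simp [e1, e2, e3, e4, e5, hi, hv, hmod] at h
      rw [htake, List.filter_append] at hmono ⊢
      simp [h] at hmono
      refine runs_put_seq (by decide) (by rcases hq with rfl | rfl <;> decide)
        (fun hb => hb.var _) ?_
      refine runs_assign (by decide) (by rcases hq with rfl | rfl <;> decide) (fun hb => ?_) ?_
      · simp [h2]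
        omega
      · simp [e1, e2, e4, hi, hv, h, h2]
        have := h1.append_update L[k]
        exact ⟨by simpa using this, by omega⟩
    · simp [e1, e2, e3, e4, e5, hi, hv, hmod] at h
      refine runs_skip (by rcases hq with rfl | rfl <;> decide) ?_
      rw [htake, List.filter_append]
      simp [h]
      exact ⟨h1, by simpa using h2⟩
  · rintro s' hf hi ⟨h1, h2⟩
    rw [List.take_of_length_le hlen.le] at h1 h2
    exact ⟨h1, h2⟩

theorem runs_sortRow {I : ℕ} (hn : s.var rN = n) (hu : s.var rRow = u) (hI : s.var rInf = I)
    (hB : n + 2 < B) (hIB : 2 * I < B) (hrow : Holds (s.arr aAdj) (u * n) (List.range n))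
    (hkey : ∀ v < n, s.arr aKey (u * n + v) ≤ I) :
    Runs B sortRow s (I.size * (300 * n + 200) + 20) fun s' =>
      (∃ L, Holds (s'.arr aAdj) (u * n) L ∧ L.Perm (List.range n) ∧
        L.Pairwise fun a b => s.arr aKey (u * n + a) ≤ s.arr aKey (u * n + b)) ∧
      ∀ x, x < u * n ∨ u * n + n ≤ x → s'.arr aAdj x = s.arr aAdj x := by
  refine runs_double (n := I) (Tb := 300 * n + 150)
    (fun k s' => (∃ L, Holds (s'.arr aAdj) (u * n) L ∧ L.Perm (List.range n) ∧
        L.Pairwise fun a b =>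
          s.arr aKey (u * n + a) % 2 ^ k ≤ s.arr aKey (u * n + b) % 2 ^ k) ∧
      ∀ x, x < u * n ∨ u * n + n ≤ x → s'.arr aAdj x = s.arr aAdj x)
    (by decide) (by decide) ⟨⟨_, hrow, List.Perm.refl _, ?_⟩, fun _ _ => rfl⟩
    (fun s' hf => (hf.var rInf (by decide)).trans hI) hIB ?_ ?_ ?_
  · simp [Nat.mod_one, List.pairwise_iff_forall_sublist]
  · rintro k hk s' hf hi ⟨⟨L, h1, h2, h3⟩, h4⟩
    have e1 : s'.var rN = n := (hf.var rN (by decide)).trans hn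
    have e2 : s'.var rRow = u := (hf.var rRow (by decide)).trans hu
    have e5 : s'.arr aKey = s.arr aKey := hf.arr _ (by decide)
    have hlen : L.length = n := by simpa using h2.length_eq
    have hlen' : (radixStep (fun v => s.arr aKey (u * n + v)) (2 ^ k) L).length = n :=
      (radixStep_perm _).length_eq.trans hlen
    have hsum := hlen'
    rw [radixStep, List.length_append] at hsum
    refine runs_assign_seq (by decide) (by simp)
      (fun hb => by have := hb.le; simp; omega) ?_
    refine Runs.seq (T₁ := 100 * n + 20) (T₂ := 200 * n + 100) (Runs.frame
      (runs_scatter (s := s'.setv rCnt 0) (q := 0) (n := n) (u := u) (p := 2 ^ k) (L := L) (L₀ := []) (Or.inl rfl)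
      (by simpa using e1) (by simpa using e2) (by simpa using hi) hB h1 hlen (holds_nil _ _)
      (by simp) (by simp only [State.setv_arr, e5, List.length_nil]; omega)) ?_)
      (by simp; omega)
    rintro s1 hf1 ⟨g1, g2⟩
    simp only [State.setv_arr, e5, List.nil_append] at g1 g2
    refine Runs.seq (T₁ := 100 * n + 20) (T₂ := 100 * n + 80) (Runs.frame
      (runs_scatter (q := 1) (n := n) (u := u) (p := 2 ^ k) (L := L) (Or.inr rfl)
      ((hf1.var rN (by decide)).trans (by simpa using e1))
      ((hf1.var rRow (by decide)).trans (by simpa using e2))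
      ((hf1.var rPow (by decide)).trans (by simpa using hi)) hB
      (by rw [hf1.arr aAdj (by decide)]; exact h1) hlen g1 g2
      (by rw [hf1.arr aKey (by decide)]; simp only [State.setv_arr, e5]; omega)) ?_)
      (by omega)
    rintro s2 hf2 ⟨g3, g4⟩
    rw [hf1.arr aKey (by decide)] at g3 g4
    simp only [State.setv_arr, e5] at g3 g4
    change Holds _ 0 (radixStep (fun v => s.arr aKey (u * n + v)) (2 ^ k) L) at g3
    have e6 : s2.var rN = n := (hf2.var rN (by decide)).trans
      ((hf1.var rN (by decide)).trans (by simpa using e1))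
    have e7 : s2.var rRow = u := (hf2.var rRow (by decide)).trans
      ((hf1.var rRow (by decide)).trans (by simpa using e2))
    have e8 : s2.arr aAdj = s'.arr aAdj := (hf2.arr aAdj (by decide)).trans
      (hf1.arr aAdj (by decide))
    refine runs_for (n := n) (Tb := 30)
      (fun i s' => (∀ j < i, s'.arr aAdj (u * n + j) = s2.arr aTmp j) ∧
        ∀ x, x < u * n ∨ u * n + n ≤ x → s'.arr aAdj x = s.arr aAdj x)
      (by decide) (by decide) ⟨fun j hj => absurd hj (Nat.not_lt_zero j), ?_⟩
      (fun s' hf => (hf.var 0 (by decide)).trans e6) (by omega) ?_ (by simp; omega) ?_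
    · simpa [e8] using h4
    · rintro i hi' s3 hf3 hi3 ⟨g5, g6⟩
      have e9 := (hf3.var rN (by decide)).trans e6
      have e10 := (hf3.var rRow (by decide)).trans e7
      have e11 := hf3.arr aTmp (by decide)
      refine runs_put (by decide) (by decide) (fun hb => hb.arr _ _) ?_
      simp only [State.setv_arr, Expr.eval_add, Expr.eval_mul, Expr.eval_var, Expr.eval_get, e9,
        e10, e11, hi3]
      rw [State.put_arr_self _ _ _ _ (by decide)]
      refine ⟨fun j hj => ?_, fun x hx => ?_⟩
      · by_cases hji : j = i
        · rw [hji, Function.update_self]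
        · rw [Function.update_of_ne (by omega), g5 j (by omega)]
      · rw [Function.update_of_ne (by omega), g6 x hx]
    · rintro s3 hf3 hi3 ⟨g5, g6⟩
      refine ⟨⟨_, ?_, (radixStep_perm _).trans h2, radixStep_sorted h3⟩, g6⟩
      intro i hi'
      have := g3 i hi'
      rw [hlen'] at hi'
      rw [State.setv_arr, g5 i hi', ← this, zero_add]
  · have : I.size * (300 * n + 150 + (Expr.var rInf).cost + 10) ≤ I.size * (300 * n + 200) :=
      Nat.mul_le_mul_left _ (by simp)
    simp only [Expr.cost_var] at this ⊢
    omega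
  · rintro s' hf hi ⟨⟨L, h1, h2, h3⟩, h4⟩
    refine ⟨⟨L, h1, h2, h3.imp_of_mem fun {a b} ha hb hab => ?_⟩, h4⟩
    -- All keys are at most `I`, so after `I.size` digits the residues are the keys themselves.
    have hlt : ∀ v ∈ L, s.arr aKey (u * n + v) < 2 ^ I.size := fun v hv =>
      (hkey v (by simpa using h2.mem_iff.1 hv)).trans_lt (Nat.lt_size_self I)
    rwa [Nat.mod_eq_of_lt (hlt a ha), Nat.mod_eq_of_lt (hlt b hb)] at hab

theorem row_index_lt {a b n j : ℕ} (hab : a < b) (hj : j < n) : a * n + j < b * n := by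
  have : (a + 1) * n ≤ b * n := Nat.mul_le_mul_right _ hab
  rw [add_mul, one_mul] at this
  omega

theorem runs_sortRows {I : ℕ} {key : ℕ → ℕ → ℕ} (hn : s.var rN = n) (hI : s.var rInf = I)
    (hB : n + 2 < B) (hIB : 2 * I < B) (hrow : ∀ u < n, ∀ j < n, s.arr aAdj (u * n + j) = j)
    (hkey : ∀ u < n, ∀ v < n, s.arr aKey (u * n + v) = key u v ∧ key u v ≤ I) :
    Runs B sortRows s (n * (I.size * (300 * n + 200) + 50) + 20) fun s' =>
      ∃ adj, HasRows n key adj s' ∧ ∀ u < n, SortedRow n key adj u := by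
  refine runs_for (n := n) (Tb := I.size * (300 * n + 200) + 20)
    (fun k s' => (∀ u < k, ∃ L, Holds (s'.arr aAdj) (u * n) L ∧ L.Perm (List.range n) ∧
        L.Pairwise fun a b => key u a ≤ key u b) ∧
      ∀ u, k ≤ u → u < n → ∀ j < n, s'.arr aAdj (u * n + j) = j)
    (by decide) (by decide) ⟨fun u hu => absurd hu (Nat.not_lt_zero u), fun u _ => hrow u⟩
    (fun s' hf => (hf.var 0 (by decide)).trans hn) (by omega) ?_ ?_ ?_
  · rintro k hk s' hf hi ⟨h1, h2⟩
    have e5 : s'.arr aKey = s.arr aKey := hf.arr _ (by decide)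
    refine (runs_sortRow ((hf.var 0 (by decide)).trans hn) hi ((hf.var rInf (by decide)).trans hI)
      hB hIB ?_ ?_).mono le_rfl ?_
    · intro j hj
      rw [List.length_range] at hj
      rw [List.getElem_range, h2 k le_rfl hk j hj]
    · intro v hv
      rw [e5, (hkey k hk v hv).1]
      exact (hkey k hk v hv).2
    · rintro s1 ⟨⟨L, g1, g2, g3⟩, g4⟩
      have hout : ∀ u j, j < n → u ≠ k → s1.arr aAdj (u * n + j) = s'.arr aAdj (u * n + j) := by
        intro u j hj huk
        apply g4
        rcases Nat.lt_or_gt_of_ne huk with h | h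
        · exact Or.inl (row_index_lt h hj)
        · have : (k + 1) * n ≤ u * n := Nat.mul_le_mul_right _ h
          rw [add_mul, one_mul] at this
          exact Or.inr (by omega)
      refine ⟨fun u hu => ?_, fun u hku hu j hj => ?_⟩
      · rcases Nat.lt_succ_iff_lt_or_eq.1 hu with hu | rfl
        · obtain ⟨L', l1, l2, l3⟩ := h1 u hu
          refine ⟨L', fun i hi' => ?_, l2, l3⟩
          have hin : i < n := by
            have := l2.length_eq
            rw [List.length_range] at this
            omega
          rw [State.setv_arr, hout u i hin (by omega), l1 i hi']
        · refine ⟨L, g1, g2, g3.imp_of_mem fun {a b} ha hb hab => ?_⟩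
          have hlt : ∀ v ∈ L, v < n := fun v hv => by simpa using g2.mem_iff.1 hv
          rwa [e5, (hkey u hk a (hlt a ha)).1, (hkey u hk b (hlt b hb)).1] at hab
      · rw [State.setv_arr, hout u j hj (by omega), h2 u (by omega) hu j hj]
  · have : n * (I.size * (300 * n + 200) + 20 + (Expr.var rN).cost + 8) ≤
        n * (I.size * (300 * n + 200) + 50) := Nat.mul_le_mul_left _ (by simp)
    simp only [Expr.cost_var] at this ⊢
    omega
  · rintro s' hf hi ⟨h1, -⟩
    have e5 : s'.arr aKey = s.arr aKey := hf.arr _ (by decide)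
    refine ⟨fun u j => s'.arr aAdj (u * n + j), ⟨(hf.var 0 (by decide)).trans hn,
      fun u hu v hv => by rw [e5, (hkey u hu v hv).1], fun _ _ _ _ => rfl⟩, fun u hu => ?_⟩
    obtain ⟨L, l1, l2, l3⟩ := h1 u hu
    have hlen : L.length = n := by simpa using l2.length_eq
    have hget : ∀ j (hj : j < n), s'.arr aAdj (u * n + j) = L[j]'(hlen ▸ hj) := fun j hj => l1 j _
    have hnd : L.Nodup := l2.nodup_iff.2 List.nodup_range
    constructor
    · intro j hj
      simp only [hget j hj]
      simpa using l2.mem_iff.1 (List.getElem_mem (l := L) (hlen ▸ hj))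
    · intro i hi' j hj h
      simp only [hget i hi', hget j hj] at h
      exact (hnd.getElem_inj_iff).1 h
    · intro v hv
      obtain ⟨j, hj, h⟩ := List.getElem_of_mem (l2.mem_iff.2 (List.mem_range.2 hv))
      exact ⟨j, hlen ▸ hj, by simp only [hget j (hlen ▸ hj), h]⟩
    · intro i j hij hj
      rcases hij.lt_or_eq with hij | rfl
      · simp only [hget i (by omega), hget j hj]
        exact List.pairwise_iff_getElem.1 l3 i j _ _ hij
      · exact le_rfl

end RowSorting

/-! ### Preparing the input -/

notation "aD" => (10 : ℕ)
notation "aF" => (11 : ℕ)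
notation "aOut" => (12 : ℕ)

open MinCycle.Expr in
/-- Spread the input matrix, from its last entry to the first, over the array `aMat`. -/
def spread : Cmd :=
  .for rI (var rN * var rN)
    (.assign rJ (var rN * var rN - (var rI + const 1)) ;; .put aMat (var rJ) (load (var rJ)))

open MinCycle.Expr in
/-- Compute the keys, and list the nodes of each row in their natural order. -/
def initRows : Cmd :=
  .assign rInf (var rN * var rM + const 1) ;;
  .for rI (var rN * var rN)
    (.put aKey (var rI) (get aMat (var rI) + same (get aMat (var rI)) (const 0) * var rInf) ;;
     .put aAdj (var rI) (var rI - var rI / var rN * var rN))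

open MinCycle.Expr in
/-- Record the distances up to `rLow` and the first hops from all nodes. -/
def tables : Cmd :=
  .assign rRad (var rLow) ;;
  .for rRow (var rN)
    (.assign rSrc (var rRow) ;;
     explore ;;
     .for rI (var rN)
      (.put aD (var rRow * var rN + var rI) (same (get aVis (var rI)) (const 1) *
          get aDist (var rI)) ;;
       .put aF (var rRow * var rN + var rI) (get aFst (var rI))))

section Prepare

variable {B n : ℕ} {s : State}

/-- Entry `i` moves from cell `i` to cell `16 * i`. Going downwards, the entries not yet moved lie
in cells below `i`, so none of them is overwritten. -/
theorem runs_spread {A : ℕ → ℕ} (hn : s.var rN = n) (hB : n * n + 2 < B)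
    (hA : ∀ i < n * n, s.mem i = A i) :
    Runs B spread s (50 * (n * n) + 20) fun s' => ∀ i < n * n, s'.arr aMat i = A i := by
  refine runs_for (n := n * n) (Tb := 30)
    (fun k s' => ∀ i < n * n, (i + k < n * n → s'.mem i = A i) ∧
      (n * n ≤ i + k → s'.arr aMat i = A i))
    (by decide) (by decide) (fun i hi => ⟨fun _ => hA i hi, fun h => by omega⟩)
    (fun s' hf => by simp [(hf.var rN (by decide)).trans hn]) (by omega) ?_
    (by simp; omega) ?_
  · intro k hk s' hf hi hI
    have e1 : s'.var rN = n := (hf.var rN (by decide)).trans hn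
    refine runs_assign_seq (by decide) (by decide) (fun _ => by simp [e1]; omega) ?_
    refine runs_put (by decide) (by decide) (fun hb => hb.mem _) ?_
    simp only [Expr.eval_sub, Expr.eval_mul, Expr.eval_add, Expr.eval_var, Expr.eval_const,
      Expr.eval_load, e1, hi, State.setv_var, if_true, State.setv_arr, State.setv_mem]
    have hj : s'.mem (n * n - (k + 1)) = A (n * n - (k + 1)) :=
      (hI _ (by omega)).1 (by omega)
    rw [State.put_arr_self _ _ _ _ (by decide), hj]
    intro i hi'
    constructor
    · intro h
      have : ((s'.setv rJ (n * n - (k + 1))).put aMat (n * n - (k + 1))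
          (A (n * n - (k + 1)))).mem i = s'.mem i := Function.update_of_ne (by omega) _ _
      rw [this]
      exact (hI i hi').1 (by omega)
    · intro h
      by_cases h' : i = n * n - (k + 1)
      · rw [h', Function.update_self]
      · rw [Function.update_of_ne h']
        exact (hI i hi').2 (by omega)
  · intro s' hf hi hI i hi'
    exact (hI i hi').2 (by omega)

theorem sub_div_mul_self (x n : ℕ) : x - x / n * n = x % n := by
  have := Nat.div_add_mod x n
  rw [mul_comm] at this
  omega

theorem runs_initRows {M : ℕ} (hn : s.var rN = n) (hM : s.var rM = M) (hB : n * n + 2 < B)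
    (hB' : n * M + 1 < B) (hA : ∀ i < n * n, s.arr aMat i ≤ M) (hMI : n ≠ 0) :
    Runs B initRows s (80 * (n * n) + 40) fun s' => s'.var rInf = n * M + 1 ∧
      ∀ i < n * n, s'.arr aAdj i = i % n ∧
        s'.arr aKey i = if s.arr aMat i = 0 then n * M + 1 else s.arr aMat i := by
  have hMn : M ≤ n * M := Nat.le_mul_of_pos_left M (by omega)
  refine runs_assign_seq (by decide) (by simp) (fun _ => by simp [hn, hM]; omega) ?_
  simp only [Expr.eval_add, Expr.eval_mul, Expr.eval_var, Expr.eval_const, hn, hM]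
  refine runs_for (n := n * n) (Tb := 60)
    (fun k s' => ∀ i < k, s'.arr aAdj i = i % n ∧
        s'.arr aKey i = if s.arr aMat i = 0 then n * M + 1 else s.arr aMat i)
    (by decide) (by decide) (fun i hi => absurd hi (Nat.not_lt_zero i))
    (fun s' hf => by simp [hf.var rN (by decide), hn]) (by omega) ?_
    (by simp; omega) ?_
  · intro k hk s' hf hi hI
    have e1 : s'.var rN = n := by simp [hf.var rN (by decide), hn]
    have e2 : s'.var rInf = n * M + 1 := by simp [hf.var rInf (by decide)]
    have e3 : s'.arr aMat = s.arr aMat := by simp [hf.arr aMat (by decide)]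
    have hk' := hA k hk
    refine runs_put_seq (by decide) (by decide) (fun hb => ?_) ?_
    · by_cases h : s.arr aMat k = 0 <;> simp [hi, e2, e3, h] <;> omega
    refine runs_put (by decide) (by decide) (fun hb => ?_) ?_
    · simp [hi, e1]
      omega
    · intro i hi'
      simp [hi, e1, e2, e3, sub_div_mul_self, Function.update_apply]
      by_cases hik : i = k
      · subst hik
        by_cases h : s.arr aMat i = 0 <;> simp [h]
      · simpa [hik] using hI i (by omega)
  · intro s' hf hi hI
    exact ⟨by simp [hf.var rInf (by decide)], hI⟩

theorem IsTable.congr {t a : ℕ} {key : ℕ → ℕ → ℕ} {D F D' F' : ℕ → ℕ}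
    (h : IsTable n key t D F a) (hD : ∀ v < n, D' (a * n + v) = D (a * n + v))
    (hF : ∀ v < n, F' (a * n + v) = F (a * n + v)) : IsTable n key t D' F' a := by
  obtain ⟨E, h1, h2, h3⟩ := h
  refine ⟨E, h1, h2, fun v hv => ?_⟩
  rw [hD v hv, hF v hv]
  exact h3 v hv

/-- At a clear radius no exploration can end with a clash, so each one yields a closed tree. The
factor `same (get aVis ..) 1` writes `0` for unvisited nodes, whose stored distances are left over
from earlier roots. -/
theorem runs_tables {R t : ℕ} {key adj : ℕ → ℕ → ℕ} (hrows : HasRows n key adj s)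
    (hok : KeysOK B n R key adj) (ht : s.var rLow = t) (htR : t ≤ R) (hclear : Clear n key t) :
    Runs B tables s (2200 * (n * n) + 200 * n + 20) fun s' =>
      ∀ a < n, IsTable n key t (s'.arr aD) (s'.arr aF) a := by
  refine runs_assign_seq (by decide) (by simp) (fun hb => hb.var _) ?_
  refine runs_for (n := n) (Tb := 2100 * n + 100)
    (fun k s' => ∀ a < k, IsTable n key t (s'.arr aD) (s'.arr aF) a)
    (by decide) (by decide) (fun i hi => absurd hi (Nat.not_lt_zero i))
    (fun s' hf => by simp [hf.var rN (by decide), hrows.size]) (by have := hok.size; omega) ?_ ?_ ?_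
  · intro k hk s1 hf1 hi1 hI
    have hr1 : HasRows n key adj s1 := by
      refine HasRows.of_frame (s := s.setv rRad (s.var rLow)) ?_ hf1 (by decide)
      exact ⟨by simpa using hrows.size, hrows.key_eq, hrows.adj_eq⟩
    have e1 : s1.var rRad = t := by simp [hf1.var rRad (by decide), ht]
    refine runs_assign_seq (by decide) (by simp) (fun hb => hb.var _) ?_
    refine Runs.seq (T₁ := 2000 * n) (T₂ := 100 * n + 50) (Runs.frame
      (runs_explore (n := n) (a := k) (t := t) (key := key) (adj := adj)
        ⟨by simpa using hr1.size, hr1.key_eq, hr1.adj_eq⟩ hok.pos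
        (fun x => htR.trans_lt (hok.self x)) hok.row (by simpa using e1) hok.size
        (fun x y => by have := hok.bound x y; omega) (by simpa using hi1) hk) ?_)
      (by simp; omega)
    rintro s2 hf2 ⟨hD, hres⟩
    have hcl : (s2.tree n).Closed n key t := by
      rcases hres with ⟨-, h⟩ | ⟨-, h, h'⟩
      · exact h
      · exact absurd hclear (hD.not_clear_of_clash h h')
    have e2 : s2.var rN = n := (hf2.var rN (by decide)).trans (by simpa using hr1.size)
    have e3 : s2.var rRow = k := (hf2.var rRow (by decide)).trans (by simpa using hi1)
    have e4 : s2.arr aD = s1.arr aD := hf2.arr _ (by decide)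
    have e5 : s2.arr aF = s1.arr aF := hf2.arr _ (by decide)
    refine runs_for (n := n) (Tb := 60)
      (fun i s' => (∀ j < i, s'.arr aD (k * n + j) = truth (s2.arr aVis j = 1) * s2.arr aDist j ∧
          s'.arr aF (k * n + j) = s2.arr aFst j) ∧
        ∀ x < k * n, s'.arr aD x = s1.arr aD x ∧ s'.arr aF x = s1.arr aF x)
      (by decide) (by decide) ⟨fun i hi => absurd hi (Nat.not_lt_zero i), ?_⟩
      (fun s' hf => by simp [hf.var rN (by decide), e2]) (by have := hok.size; omega) ?_
      (by simp; omega) ?_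
    · intro x hx
      simp [e4, e5]
    · rintro i hi s3 hf3 hi3 ⟨h1, h2⟩
      have e6 : s3.var rN = n := (hf3.var rN (by decide)).trans e2
      have e7 : s3.var rRow = k := (hf3.var rRow (by decide)).trans e3
      have e8 : s3.arr aVis = s2.arr aVis := hf3.arr _ (by decide)
      have e9 : s3.arr aDist = s2.arr aDist := hf3.arr _ (by decide)
      have e10 : s3.arr aFst = s2.arr aFst := hf3.arr _ (by decide)
      refine runs_put_seq (by decide) (by decide) (fun hb => ?_) ?_
      · have h3 := hb.arr aDist i
        rw [e9] at h3
        have h4 := truth_le (s2.arr aVis i = 1)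
        simp [hi3, e8, e9]
        nlinarith
      refine runs_put (by decide) (by decide) (fun hb => hb.arr _ _) ?_
      simp [hi3, e6, e7, e8, e9, e10, Function.update_apply]
      refine ⟨fun j hj => ?_, fun x hx => ?_⟩
      · by_cases hji : j = i
        · simp [hji]
        · simpa [hji] using h1 j (by omega)
      · have : x ≠ k * n + i := by omega
        simpa [this] using h2 x hx
    · rintro s3 hf3 hi3 ⟨h1, h2⟩ a ha
      rcases Nat.lt_succ_iff_lt_or_eq.1 ha with ha | rfl
      · refine (hI a ha).congr (fun v hv => ?_) (fun v hv => ?_)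
        · simpa using (h2 _ (row_index_lt ha hv)).1
        · simpa using (h2 _ (row_index_lt ha hv)).2
      · refine ⟨_, hD, hcl, fun v hv => ?_⟩
        obtain ⟨h3, h4⟩ := h1 v hv
        simp only [State.setv_arr, h3, h4]
        refine ⟨fun hvis => ?_, fun hvis => ?_⟩
        · simp [show s2.arr aVis v = 1 from hvis.2, State.tree]
        · have : s2.arr aVis v ≠ 1 := fun h => hvis ⟨hv, h⟩
          simp [this]
  · have : n * (2100 * n + 100 + 1 + 8) = 2100 * (n * n) + 109 * n := by ring
    simp
    omega
  · intro s' hf hi hI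
    exact hI

end Prepare

/-! ### Writing the output -/

notation "rLen" => (21 : ℕ)
notation "rP" => (22 : ℕ)
notation "rQ" => (23 : ℕ)
notation "rA" => (24 : ℕ)
notation "rB" => (25 : ℕ)
notation "rSig" => (26 : ℕ)
notation "rNum" => (27 : ℕ)
notation "rT" => (28 : ℕ)

open MinCycle.Expr in
/-- Append a word to the output. -/
def emit (e : Expr) : Cmd := .put aOut (var rLen) e ;; .assign rLen (var rLen + const 1)

/-- The list `L` has been written to the output array. -/
def Written (s : State) (L : List ℕ) : Prop := Holds (s.arr aOut) 0 L ∧ s.var rLen = L.length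

section Emit

variable {B T : ℕ} {s : State} {L : List ℕ} {e : Expr} {q : Cmd} {Q : State → Prop}

theorem runs_emit (hL : Written s L) (he : e.Small) (hT : e.cost + 10 ≤ T)
    (hv : Bdd B s → e.eval s < B) (hB : L.length + 1 < B) :
    Runs B (emit e) s T fun s' => Written s' (L ++ [e.eval s]) ∧
      ∀ x, x ≠ rLen → s'.var x = s.var x := by
  refine runs_put_seq ⟨he, by decide⟩ (by simp; omega) hv ?_
  refine runs_assign (by decide) (by simp; omega) (fun _ => by simp [hL.2]; omega) ?_
  refine ⟨⟨?_, by simp [hL.2]⟩, fun x hx => by simp [hx]⟩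
  have := hL.1.append_update (e.eval s)
  simpa [hL.2] using this

end Emit

open MinCycle.Expr in
/-- Write the cycle that the clash closes: its length, the path from `rHitU` up to the root, and
the path from the root down to `rHitV`. -/
def writeCycle : Cmd :=
  .assign rLen (const 0) ;;
  emit (get aDep (var rHitU) + get aDep (var rHitV) + const 1) ;;
  .assign rV (var rHitU) ;;
  .assign rD (get aDep (var rHitU) + const 1) ;;
  .for rI (var rD) (emit (var rV) ;; .assign rV (get aPar (var rV))) ;;
  .assign rV (var rHitV) ;;
  .assign rD (get aDep (var rHitV)) ;;
  .for rI (var rD)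
    (.put aOut (var rLen + (var rD - (var rI + const 1))) (var rV) ;;
     .assign rV (get aPar (var rV))) ;;
  .assign rLen (var rLen + var rD)

theorem iterate_tail_reverse (f : ℕ → ℕ) (v d : ℕ) :
    ((List.range (d + 1)).map fun i => f^[i] v).reverse.tail =
      ((List.range d).map fun i => f^[i] v).reverse := by
  rw [List.range_succ, List.map_append, List.reverse_append]
  rfl

theorem Holds.append {f : ℕ → ℕ} {b : ℕ} {L L' : List ℕ} (h : Holds f b L)
    (h' : Holds f (b + L.length) L') : Holds f b (L ++ L') := by
  intro i hi
  rw [List.length_append] at hi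
  by_cases hiL : i < L.length
  · rw [List.getElem_append_left hiL, h i hiL]
  · rw [List.getElem_append_right (by omega), ← h' (i - L.length) (by omega)]
    congr 1
    omega

/-- The first path is written in the order in which parents are followed. The second is needed from
the root downwards, so its nodes are stored from the last cell backwards; the loop runs `dep` times
rather than `dep + 1`, which leaves out the root, already written. -/
theorem runs_writeCycle {B n : ℕ} {s : State} {D : TreeData} (hD : s.tree n = D)
    (hB : D.dep (s.var rHitU) + D.dep (s.var rHitV) + 5 < B) :
    Runs B writeCycle s
      (100 * (D.dep (s.var rHitU) + D.dep (s.var rHitV)) + 200) fun s' =>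
      Written s' ((D.dep (s.var rHitU) + D.dep (s.var rHitV) + 1) ::
        (D.ancestors (s.var rHitU) ++ (D.ancestors (s.var rHitV)).reverse.tail)) := by
  have edep : s.arr aDep = D.dep := by rw [← hD]; rfl
  have epar : s.arr aPar = D.par := by rw [← hD]; rfl
  clear hD
  generalize hu : s.var rHitU = u at *
  generalize hv : s.var rHitV = v at *
  refine runs_assign_seq (by decide) (by simp) (fun hb => by simp; omega) ?_
  refine Runs.seq (T₁ := 40) (T₂ := 100 * (D.dep u + D.dep v) + 150) (Runs.frame
    (runs_emit (L := []) ⟨holds_nil _ _, by simp⟩ (by decide) (by decide)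
      (fun _ => by simp [hu, hv, edep]; omega) (by simp; omega)) ?_) (by simp; omega)
  rintro s1 hf1 ⟨hw1, hv1⟩
  have u1 : s1.var rHitU = u := by rw [hv1 _ (by decide)]; simpa using hu
  have v1 : s1.var rHitV = v := by rw [hv1 _ (by decide)]; simpa using hv
  have d1 : s1.arr aDep = D.dep := (hf1.arr aDep (by decide)).trans edep
  have p1 : s1.arr aPar = D.par := (hf1.arr aPar (by decide)).trans epar
  simp only [State.setv_arr, State.setv_var, Expr.eval_add, Expr.eval_get, Expr.eval_var,
    Expr.eval_const, List.nil_append] at hw1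
  simp [hu, hv, edep] at hw1
  refine runs_assign_seq (by decide) (by simp) (fun hb => hb.var _) ?_
  refine runs_assign_seq (by decide) (by simp) (fun hb => by simp [u1, d1]; omega) ?_
  refine Runs.seq (T₁ := 50 * (D.dep u + 1) + 20) (T₂ := 100 * D.dep v + 60) ?_ (by simp; omega)
  refine runs_for (n := D.dep u + 1) (Tb := 20)
    (fun i s' => s'.var rV = D.par^[i] u ∧ Written s' ((D.dep u + D.dep v + 1) ::
      (List.range i).map fun i => D.par^[i] u))
    (by decide) (by decide) ⟨by simp [u1], by simpa [Written] using hw1⟩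
    (fun s' hf => by simp [hf.var rD (by decide), u1, d1]) (by omega) ?_ (by simp; omega) ?_
  · rintro i hi s2 hf2 hi2 ⟨hV, hW⟩
    have p2 : s2.arr aPar = D.par := (hf2.arr aPar (by decide)).trans p1
    refine Runs.seq (T₁ := 12) (T₂ := 8) (Runs.frame
      (runs_emit hW (by decide) (by decide) (fun hb => hb.var _) (by simp; omega)) ?_) le_rfl
    rintro s3 hf3 ⟨hw3, hv3⟩
    have p3 : s3.arr aPar = D.par := (hf3.arr aPar (by decide)).trans p2
    have V3 : s3.var rV = D.par^[i] u := (hv3 rV (by decide)).trans hV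
    refine runs_assign (by decide) (by decide) (fun hb => hb.arr _ _) ?_
    refine ⟨by simp [V3, p3, Function.iterate_succ_apply'], ?_⟩
    simpa [Written, List.range_succ, hV] using hw3
  · rintro s2 hf2 hi2 ⟨-, hW⟩
    have v2 : s2.var rHitV = v := by simp [hf2.var rHitV (by decide), v1]
    have d2 : s2.arr aDep = D.dep := by simp [hf2.arr aDep (by decide), d1]
    have p2 : s2.arr aPar = D.par := by simp [hf2.arr aPar (by decide), p1]
    change Written s2 ((D.dep u + D.dep v + 1) :: D.ancestors u) at hW
    rw [← List.cons_append, show (D.ancestors v).reverse.tail = _ from iterate_tail_reverse _ _ _]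
    have hlen : ((D.dep u + D.dep v + 1) :: D.ancestors u).length = D.dep u + 2 := by
      simp [TreeData.ancestors]
    generalize (D.dep u + D.dep v + 1) :: D.ancestors u = H at hW hlen
    obtain ⟨hW, hl⟩ := hW
    rw [hlen] at hl
    refine runs_assign_seq (by decide) (by simp) (fun hb => hb.var _) ?_
    refine runs_assign_seq (by decide) (by simp) (fun hb => by simp [v2, d2]; omega) ?_
    refine Runs.seq (T₁ := 50 * D.dep v + 20) (T₂ := 10) ?_ (by simp; omega)
    refine runs_for (n := D.dep v) (Tb := 30)
      (fun i s' => s'.var rV = D.par^[i] v ∧ Holds (s'.arr aOut) 0 H ∧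
        ∀ j < i, s'.arr aOut (D.dep u + 2 + (D.dep v - (j + 1))) = D.par^[j] v)
      (by decide) (by decide) ⟨by simp [v2], by simpa using hW, by simp⟩
      (fun s' hf => by simp [hf.var rD (by decide), v2, d2]) (by omega) ?_ (by simp; omega) ?_
    · rintro i hi s3 hf3 hi3 ⟨hV3, hH, hj⟩
      have p3 : s3.arr aPar = D.par := by simp [hf3.arr aPar (by decide), p2]
      have l3 : s3.var rLen = D.dep u + 2 := by simp [hf3.var rLen (by decide), hl]
      have d3 : s3.var rD = D.dep v := by simp [hf3.var rD (by decide), v2, d2]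
      refine runs_put_seq (by decide) (by decide) (fun hb => hb.var _) ?_
      refine runs_assign (by decide) (by decide) (fun hb => hb.arr _ _) ?_
      simp only [Expr.eval_add, Expr.eval_sub, Expr.eval_var, Expr.eval_const, l3, d3, hi3]
      refine ⟨by simp [hV3, p3, Function.iterate_succ_apply'], fun j hj' => ?_, fun j hj' => ?_⟩
      · simp only [State.setv_arr]
        rw [State.put_arr_self _ _ _ _ (by decide), Function.update_of_ne (by omega), hH j hj']
      · simp only [State.setv_arr]
        rw [State.put_arr_self _ _ _ _ (by decide), hV3]
        by_cases hji : j = i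
        · rw [hji, Function.update_self]
        · rw [Function.update_of_ne (by omega), hj j (by omega)]
    · rintro s3 hf3 hi3 ⟨-, hH, hj⟩
      have l3 : s3.var rLen = D.dep u + 2 := by simp [hf3.var rLen (by decide), hl]
      have d3 : s3.var rD = D.dep v := by simp [hf3.var rD (by decide), v2, d2]
      refine runs_assign (by decide) (by decide) (fun _ => by simp [l3, d3]; omega) ?_
      refine ⟨?_, by simp [l3, d3, hlen]⟩
      simp only [State.setv_arr]
      refine hH.append fun i hi => ?_
      simp only [List.length_reverse, List.length_map, List.length_range] at hi
      have := hj (D.dep v - (i + 1)) (by omega)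
      rw [hlen, zero_add]
      simp only [List.getElem_reverse, List.getElem_map, List.getElem_range, List.length_map,
        List.length_range]
      rw [show D.dep v - 1 - i = D.dep v - (i + 1) by omega, ← this]
      congr 1
      omega


open MinCycle.Expr in
/-- The entry for the leg from node `i` of copy `0` to node `j` of copy `q`. -/
def leg (i j q : ℕ) : Cmd :=
  .assign rT (var i * var rN + var j) ;;
  .assign rJ (get aF (var rT) / var rPow) ;;
  .assign rD (same (var rJ - var rJ / const 2 * const 2 + const 1) (var q) *
    (get aD (var rT) - var rSig))

open MinCycle.Expr in
/-- Compute entry `rI` of the matrix of a triangle graph. -/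
def entryOf : Cmd :=
  .assign rP (var rI / (const 3 * var rN)) ;;
  .assign rQ (var rI - var rP * (const 3 * var rN)) ;;
  .assign rA (var rP - var rP / var rN * var rN) ;;
  .assign rB (var rQ - var rQ / var rN * var rN) ;;
  .assign rP (var rP / var rN) ;;
  .assign rQ (var rQ / var rN) ;;
  .ite (same (var rP) (var rQ)) (.assign rD (const 0))
    (.ite (same (var rP) (const 0)) (leg rA rB rQ)
      (.ite (same (var rQ) (const 0)) (leg rB rA rP)
        (.assign rD (get aMat (var rA * var rN + var rB)))))

open MinCycle.Expr in
/-- Write the offset, the number of graphs, and the triangle graphs. -/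
def writeGraphs (K : ℕ) : Cmd :=
  .assign rSig (var rLow + const 1 - const (K + 3) * var rM) ;;
  emit (const 2 * var rSig) ;;
  .assign rNum (const 0) ;;
  .double rPow (var rN) (.assign rNum (var rNum + const 1)) ;;
  emit (var rNum) ;;
  .double rPow (var rN)
    (emit (const 3 * var rN) ;;
     .for rI (const 3 * var rN * (const 3 * var rN)) (entryOf ;; emit (var rD)))

section WriteGraphs

variable {B n σ pw : ℕ} {s : State}

theorem runs_leg {i j q : ℕ} (hij : i ≠ rT ∧ j ≠ rT ∧ q ≠ rT ∧ q ≠ rJ) (hn : s.var rN = n)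
    (hσ : s.var rSig = σ) (hpw : s.var rPow = pw) (hB : s.var i * n + s.var j < B) :
    Runs B (leg i j q) s 50 fun s' => s'.var rD =
      if s.arr aF (s.var i * n + s.var j) / pw % 2 + 1 = s.var q then
        s.arr aD (s.var i * n + s.var j) - σ else 0 := by
  refine runs_assign_seq ⟨Nat.le_of_ble_eq_true rfl, Nat.le_of_ble_eq_true rfl⟩ (by simp)
    (fun _ => by simpa [hn] using hB) ?_
  refine runs_assign_seq (by decide) (by simp)
    (fun hb => (Nat.div_le_self _ _).trans_lt (hb.arr _ _)) ?_
  refine runs_assign ⟨Nat.le_of_ble_eq_true rfl, Nat.le_of_ble_eq_true rfl⟩ (by simp) (fun hb => ?_) ?_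
  · have h1 := hb.arr aD (s.var i * n + s.var j)
    have h2 : ∀ p : Prop, truth p * (s.arr aD (s.var i * n + s.var j) - σ) < B := by
      intro p
      have := truth_le p
      simp only [State.setv_arr] at h1
      have h3 := Nat.sub_le (s.arr aD (s.var i * n + s.var j)) σ
      nlinarith
    simpa [hn, hσ] using h2 _
  · obtain ⟨-, h2, h3, h4⟩ := hij
    simp [hn, hσ, hpw, h3, h4, sub_div_mul_self]
    split_ifs with h <;> simp [h]

theorem runs_entryOf {i : ℕ} (hn : s.var rN = n) (hσ : s.var rSig = σ) (hpw : s.var rPow = pw)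
    (hi : s.var rI = i) (hn0 : 0 < n) (hB : n * n < B) :
    Runs B entryOf s 200 fun s' => s'.var rD =
      triEntry n σ pw (s.arr aMat) (s.arr aD) (s.arr aF) (i / (3 * n)) (i % (3 * n)) := by
  refine runs_assign_seq (by decide) (by simp) (fun hb => ?_) ?_
  · exact (Nat.div_le_self _ _).trans_lt (hb.var _)
  refine runs_assign_seq (by decide) (by simp) (fun hb => ?_) ?_
  · exact (Nat.sub_le _ _).trans_lt (hb.var _)
  refine runs_assign_seq (by decide) (by simp) (fun hb => ?_) ?_
  · exact (Nat.sub_le _ _).trans_lt (hb.var _)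
  refine runs_assign_seq (by decide) (by simp) (fun hb => ?_) ?_
  · exact (Nat.sub_le _ _).trans_lt (hb.var _)
  refine runs_assign_seq (by decide) (by simp) (fun hb => ?_) ?_
  · exact (Nat.div_le_self _ _).trans_lt (hb.var _)
  refine runs_assign_seq (by decide) (by simp) (fun hb => ?_) ?_
  · exact (Nat.div_le_self _ _).trans_lt (hb.var _)
  simp only [Expr.eval_sub, Expr.eval_mul, Expr.eval_div, Expr.eval_var,
    Expr.eval_const, Expr.cost_sub, Expr.cost_mul, Expr.cost_div, Expr.cost_var,
    Expr.cost_const]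
  simp only [hn, hi, sub_div_mul_self, State.setv_var, if_true, if_false, Nat.reduceEqDiff,
    Nat.reduceAdd]
  generalize i / (3 * n) = x
  generalize i % (3 * n) = y
  have hlt : ∀ a b, a % n * n + b % n < B := fun a b => by
    have h1 := Nat.mod_lt a hn0
    have h2 := Nat.mod_lt b hn0
    nlinarith
  refine runs_ite (by decide) (by simp) (fun h => ?_) (fun h => ?_)
  · simp at h
    refine runs_assign (by decide) (by simp) (fun hb => by have := hb.le; simp; omega) ?_
    simp [triEntry, h]
  refine runs_ite (by decide) (by simp) (fun h2 => ?_) (fun h2 => ?_)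
  · simp only [Expr.eval_same, Expr.eval_var, Expr.eval_const, State.setv_var,
      Nat.reduceEqDiff, if_true, if_false, ne_eq, truth_eq_zero, not_not] at h h2
    refine (runs_leg (n := n) (σ := σ) (pw := pw) (by decide) (by simp [hn]) (by simp [hσ])
      (by simp [hpw]) (by simpa using hlt x y)).mono (by simp) fun s' hs' => ?_
    rw [hs', triEntry, if_neg h, if_pos h2]
    simp
  refine runs_ite (by decide) (by simp) (fun h3 => ?_) (fun h3 => ?_)
  · simp only [Expr.eval_same, Expr.eval_var, Expr.eval_const, State.setv_var,
      Nat.reduceEqDiff, if_true, if_false, ne_eq, truth_eq_zero, not_not] at h h2 h3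
    refine (runs_leg (n := n) (σ := σ) (pw := pw) (by decide) (by simp [hn]) (by simp [hσ])
      (by simp [hpw]) (by simpa using hlt y x)).mono (by simp) fun s' hs' => ?_
    rw [hs', triEntry, if_neg h, if_neg h2, if_pos h3]
    simp
  · simp only [Expr.eval_same, Expr.eval_var, Expr.eval_const, State.setv_var,
      Nat.reduceEqDiff, if_true, if_false, truth_eq_zero] at h h2 h3
    refine runs_assign (by decide) (by simp) (fun hb => hb.arr _ _) ?_
    rw [triEntry, if_neg h, if_neg h2, if_neg h3]
    simp [hn]

/-- The first `k` of a sequence of square matrices of size `N`, each preceded by its size. -/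
def blocks (N : ℕ) (f : ℕ → ℕ → ℕ) (k : ℕ) : List ℕ :=
  (List.range k).flatMap fun b => N :: (List.range (N * N)).map (f b)

theorem blocks_succ (N : ℕ) (f : ℕ → ℕ → ℕ) (k : ℕ) :
    blocks N f (k + 1) = blocks N f k ++ N :: (List.range (N * N)).map (f k) := by
  simp [blocks, List.range_succ]

theorem length_blocks (N : ℕ) (f : ℕ → ℕ → ℕ) (k : ℕ) :
    (blocks N f k).length = k * (N * N + 1) := by
  induction k with
  | zero => simp [blocks]
  | succ k ih => rw [blocks_succ, List.length_append, ih]; simp; ring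

theorem runs_writeGraphs {K M t : ℕ} {L : List ℕ} (hn : s.var rN = n) (hM : s.var rM = M)
    (ht : s.var rLow = t) (hn0 : 0 < n) (hL : Written s L)
    (hB : L.length + n.size * (3 * n * (3 * n) + 1) + 9 * (n * n) + 4 < B) (hK : K + 3 < B)
    (htB : 2 * (t + 1) < B)
    (hσ : σ = t + 1 - (K + 3) * M) :
    Runs B (writeGraphs K) s (n.size * (2500 * (n * n) + 100) + 200) fun s' =>
      Written s' (L ++ 2 * σ :: n.size :: blocks (3 * n) (fun b i =>
        triEntry n σ (2 ^ b) (s.arr aMat) (s.arr aD) (s.arr aF) (i / (3 * n)) (i % (3 * n)))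
        n.size) := by
  have hsz : n.size ≤ n.size * (3 * n * (3 * n) + 1) := Nat.le_mul_of_pos_right _ (by omega)
  have hT1 : n.size * (2500 * (n * n) + 100) = n.size * (2500 * (n * n) + 80) + n.size * 20 := by
    ring
  have hT2 : n.size * (2500 * (n * n) + 60 + 1 + 10) ≤ n.size * (2500 * (n * n) + 80) :=
    Nat.mul_le_mul_left _ (by omega)
  have hnn : n ≤ n * n := Nat.le_mul_of_pos_left _ hn0
  refine Runs.seq (T₁ := 8) (T₂ := n.size * (2500 * (n * n) + 100) + 192) (fun hb => ?_)
    (by omega)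
  have hle := hb.le
  -- The constant `K + 3` can exceed the limit of `Expr.Small`, so `Bdd.fits` is applied with the
  -- bound `hK`.
  refine ⟨_, _, le_rfl, .assign _ _ s (hb.fits ?_ (Nat.le_of_ble_eq_true rfl)), hb.setv ?_, ?_⟩
  · change max (max 0 1) (max (K + 3) 0) < B
    omega
  · simp [hM, ht]
    omega
  have eσ : (Expr.var rLow + Expr.const 1 - Expr.const (K + 3) * Expr.var rM).eval s = σ := by
    simp [hM, ht, hσ]
  rw [eσ]
  change Runs B _ (s.setv rSig σ) _ _
  generalize hf : (fun b i => triEntry n σ (2 ^ b) (s.arr aMat) (s.arr aD) (s.arr aF)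
    (i / (3 * n)) (i % (3 * n))) = f
  refine Runs.seq (T₁ := 20) (T₂ := n.size * (2500 * (n * n) + 100) + 170) (Runs.frame
    (runs_emit (L := L) (by simpa [Written] using hL) (by decide) (by decide)
      (fun _ => by simp; omega) (by omega)) ?_) (by omega)
  rintro s1 hf1 ⟨hw1, -⟩
  have n1 : s1.var rN = n := by simp [hf1.var rN (by decide), hn]
  have g1 : s1.var rSig = σ := by simp [hf1.var rSig (by decide)]
  simp only [Expr.eval_mul, Expr.eval_const, Expr.eval_var, State.setv_var, if_true] at hw1
  refine runs_assign_seq (by decide) (by simp) (fun hb => by simp; omega) ?_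
  refine Runs.seq (T₁ := n.size * 20 + 20) (T₂ := n.size * (2500 * (n * n) + 80) + 140) ?_
    (by simp; omega)
  refine runs_double (n := n) (Tb := 4) (fun k s' => s'.var rNum = k) (by decide) (by decide)
    (by simp) (fun s' hf => by simp [hf.var rN (by decide), n1]) (by omega) ?_ (by simp; omega) ?_
  · intro k hk s' hf' hi' hI
    refine runs_assign (by decide) (by decide) (fun _ => by simp [hI]; omega) ?_
    simp [hI]
  intro s2 hf2 hi2 hI2
  have n2 : s2.var rN = n := by simp [hf2.var rN (by decide), n1]
  have g2 : s2.var rSig = σ := by simp [hf2.var rSig (by decide), g1]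
  have w2 : Written s2 (L ++ [2 * σ]) := by
    simpa [Written, hf2.var rLen (by decide), hf2.arr aOut (by decide)] using hw1
  refine Runs.seq (T₁ := 20) (T₂ := n.size * (2500 * (n * n) + 80) + 120) (Runs.frame
    (runs_emit w2 (by decide) (by decide) (fun hb => hb.var _) (by simp; omega)) ?_) (by omega)
  rintro s3 hf3 ⟨hw3, -⟩
  rw [Expr.eval_var, hI2] at hw3
  have n3 : s3.var rN = n := (hf3.var rN (by decide)).trans n2
  have g3 : s3.var rSig = σ := (hf3.var rSig (by decide)).trans g2
  have m3 : ∀ k, k = aMat ∨ k = aD ∨ k = aF → s3.arr k = s.arr k := by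
    rintro k (rfl | rfl | rfl) <;>
      rw [hf3.arr _ (by decide), hf2.arr _ (by decide), State.setv_arr, hf1.arr _ (by decide),
        State.setv_arr]
  set L' := L ++ [2 * σ] ++ [n.size] with hL'
  have hlen' : L'.length = L.length + 2 := by simp [hL']
  refine runs_double (n := n) (Tb := 2500 * (n * n) + 60)
    (fun k s' => Written s' (L' ++ blocks (3 * n) f k)) (by decide) (by decide)
    (by simpa [Written, blocks] using hw3) (fun s' hf => by simp [hf.var rN (by decide), n3])
    (by omega) ?_ (by simp; omega) ?_
  · intro k hk s4 hf4 hi4 hI4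
    have n4 : s4.var rN = n := (hf4.var rN (by decide)).trans n3
    have hkm : (k + 1) * (3 * n * (3 * n) + 1) ≤ n.size * (3 * n * (3 * n) + 1) :=
      Nat.mul_le_mul_right _ hk
    rw [add_mul, one_mul] at hkm
    refine Runs.seq (T₁ := 20) (T₂ := 2500 * (n * n) + 40) (Runs.frame
      (runs_emit hI4 (by decide) (by decide) (fun _ => by simp [n4]; omega)
      (by rw [List.length_append, length_blocks]; omega)) ?_) (by omega)
    rintro s5 hf5 ⟨hw5, -⟩
    have n5 : s5.var rN = n := (hf5.var rN (by decide)).trans n4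
    have g5 : s5.var rSig = σ := by rw [hf5.var rSig (by decide), hf4.var rSig (by decide), g3]
    have p5 : s5.var rPow = 2 ^ k := (hf5.var rPow (by decide)).trans hi4
    have m5 : ∀ j, j = aMat ∨ j = aD ∨ j = aF → s5.arr j = s.arr j := by
      intro j hj
      rw [← m3 j hj]
      rcases hj with rfl | rfl | rfl <;>
        rw [hf5.arr _ (by decide), hf4.arr _ (by decide)]
    have e : (Expr.const 3 * Expr.var rN).eval s4 = 3 * n := by simp [n4]
    rw [e] at hw5
    refine runs_for (n := 3 * n * (3 * n)) (Tb := 220)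
      (fun i s' => Written s' (L' ++ blocks (3 * n) f k ++ [3 * n] ++ (List.range i).map (f k)))
      (by decide) (by decide) (by simpa [Written] using hw5)
      (fun s' hf => by simp [hf.var rN (by decide), n5]) ?_ ?_ ?_ ?_
    · omega
    · intro i hi s6 hf6 hi6 hI6
      have n6 : s6.var rN = n := (hf6.var rN (by decide)).trans n5
      refine Runs.seq (T₁ := 200) (T₂ := 20) (Runs.frame
        (runs_entryOf (n := n) (σ := σ) (pw := 2 ^ k) n6 ((hf6.var rSig (by decide)).trans g5)
          ((hf6.var rPow (by decide)).trans p5) hi6 hn0 (by omega)) ?_) (by omega)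
      rintro s7 hf7 hD7
      rw [hf6.arr aMat (by decide), hf6.arr aD (by decide), hf6.arr aF (by decide),
        m5 aMat (by simp), m5 aD (by simp), m5 aF (by simp)] at hD7
      have w7 : Written s7 (L' ++ blocks (3 * n) f k ++ [3 * n] ++ (List.range i).map (f k)) := by
        simpa [Written, hf7.var rLen (by decide), hf7.arr aOut (by decide)] using hI6
      refine (runs_emit w7 (by decide) (by decide) (fun hb => hb.var _) ?_).mono le_rfl ?_
      · simp only [List.length_append, length_blocks, List.length_map, List.length_range,
          List.length_singleton]
        omega
      · rintro s8 ⟨hw8, -⟩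
        have hfi : f k i = s7.var rD := by rw [hD7, ← hf]
        simpa [Written, List.range_succ, hfi] using hw8
    · have : 3 * n * (3 * n) = 9 * (n * n) := by ring
      simp only [this, Expr.cost_mul, Expr.cost_const, Expr.cost_var]
      omega
    · intro s6 hf6 hi6 hI6
      rw [blocks_succ]
      simpa [Written] using hI6
  · intro s4 hf4 hi4 hI4
    simpa [hL'] using hI4

end WriteGraphs

/-! ### The complete program -/

open MinCycle.Expr in
/-- Move the output to the beginning of the memory. -/
def compact : Cmd :=
  .for rI (var rLen) (.store (var rI) (get aOut (var rI))) ;;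
  .assign rN (const 0)

/-- Cell `k` is written when output word `k`, stored at `16 * k + 12`, is read; later words lie at
still larger addresses and are safe. Register `0` is then reset, because it must hold the output
address. -/
theorem runs_compact {B : ℕ} {s : State} {L : List ℕ} (hL : Written s L) (hB : L.length < B) :
    Runs B compact s (20 * L.length + 20) fun s' => StoredAt s' (s'.var 0) L := by
  refine Runs.seq (T₁ := 20 * L.length + 10) (T₂ := 10) ?_ (by omega)
  refine runs_for (n := L.length) (Tb := 8)
    (fun k s' => ∀ (j : ℕ) (h : j < L.length), (j < k → s'.mem j = L[j]) ∧
      (k ≤ j → s'.arr aOut j = L[j]))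
    (by decide) (by decide) (fun j hj => ⟨fun h => absurd h (Nat.not_lt_zero j), fun _ => ?_⟩)
    (fun s' hf => by simp [hf.var rLen (by decide), hL.2]) hB ?_ (by simp; omega) ?_
  · simpa using hL.1 j hj
  · intro k hk s' hf hi hI hb
    refine ⟨_, _, by decide, .store _ _ s' (hb.fits_of_small (by decide))
      (hb.fits_of_small (by decide)), ⟨hb.le, hb.var, fun x => ?_⟩, fun j hj => ?_⟩
    · simp only [Function.update_apply]
      split_ifs
      exacts [hb.arr _ _, hb.mem x]
    · simp only [Expr.eval_var, Expr.eval_get, hi, State.setv_mem, State.arr]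
      refine ⟨fun h => ?_, fun h => ?_⟩
      · by_cases hjk : j = k
        · subst hjk
          rw [Function.update_self]
          exact (hI j hj).2 le_rfl
        · rw [Function.update_of_ne hjk]
          exact (hI j hj).1 (by omega)
      · rw [Function.update_of_ne (by omega)]
        exact (hI j hj).2 (by omega)
  · intro s' hf hi hI
    refine runs_assign (by decide) (by decide) (fun hb => by have := hb.le; simp; omega) ?_
    intro j hj
    simpa using (hI j hj).1 hj

/-- The program that reduces minimum weight cycles to minimum weight triangles. -/
def program (K : ℕ) : Cmd :=
  spread ;; initRows ;; sortRows ;; search ;; writeCycle ;; tables ;; writeGraphs K ;; compact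

/-- One leg together with the clashing edge is at most `t + 1` by the clash, and the other leg is at
most `t + 1` by the radius of the tree. -/
theorem TreeData.IsTree.exists_cycle_of_clash {n M I t a u v : ℕ} {G : WGraph n} {D : TreeData}
    (hG : G.WeightsIn M) (hI : t + 1 < I) (hclear : Clear n (G.key I) t)
    (hD : D.IsTree n (G.key I) a (t + 1)) (huv : D.Clash (G.key I) (t + 1) u v) (hne : u ≠ v) :
    ∃ (r : Fin n) (C : G.graph.Walk r r), C.IsCycle ∧ G.walkWeight C ≤ 2 * (t + 1) ∧
      C.length = D.dep u + D.dep v + 1 ∧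
      C.support.tail.map Fin.val = D.ancestors u ++ (D.ancestors v).reverse.tail := by
  have hf := hD.fst_ne_of_clash huv hne (WGraph.key_pos (by omega)) hclear
  have hle := huv.le
  have hadj : G.graph.Adj ⟨u, hD.lt u huv.vis_left⟩ ⟨v, hD.lt v huv.vis_right⟩ :=
    WGraph.adj_of_key_lt (I := I) (by simp only; omega)
  obtain ⟨C, h1, h2, h3, h4⟩ := hD.exists_cycle (u := ⟨u, _⟩) (v := ⟨v, _⟩) hG hI
    (hD.lt a hD.vis_root) huv.vis_left huv.vis_right hadj.symm huv.ne_par_left huv.ne_par_right hf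
  have hkey := WGraph.key_of_adj (I := I) hG hadj
  have := hD.dist_le v huv.vis_right
  simp only at hkey h2
  exact ⟨_, C, h1, by omega, h3, h4⟩

theorem _root_.SimpleGraph.Walk.IsCycle.length_le {n : ℕ} {G : SimpleGraph (Fin n)} {r : Fin n}
    {C : G.Walk r r} (hC : C.IsCycle) : C.length ≤ n := by
  have := hC.support_nodup.length_le_card
  simpa using this

/-! ### The initial memory -/

section InputState

variable {n M : ℕ} {G : WGraph n}

theorem inputState_mem {u v : ℕ} (hu : u < n) (hv : v < n) :
    (inputState G M).mem (u * n + v) = G.entry ⟨u, hu⟩ ⟨v, hv⟩ := by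
  have h : u * n + v < n * n := row_index_lt hu hv
  have h1 : (u * n + v) / n = u := by
    rw [mul_comm, Nat.mul_add_div (by omega), Nat.div_eq_of_lt hv, add_zero]
  have h2 : (u * n + v) % n = v := by rw [mul_comm, Nat.mul_add_mod, Nat.mod_eq_of_lt hv]
  simp only [inputState, WGraph.matrix]
  rw [List.getD_eq_getElem _ _ (by simpa using h), List.getElem_ofFn]
  simp [Fin.divNat, Fin.modNat, h1, h2]

theorem WGraph.entry_le (hG : G.WeightsIn M) (u v : Fin n) : G.entry u v ≤ M := by
  unfold WGraph.entry
  split_ifs with h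
  · exact (hG _ ((SimpleGraph.mem_edgeSet _).2 h)).2
  · exact Nat.zero_le M

theorem inputState_mem_le (hG : G.WeightsIn M) (x : ℕ) : (inputState G M).mem x ≤ M := by
  simp only [inputState, WGraph.matrix]
  rw [List.getD_eq_getElem?_getD, List.getElem?_ofFn]
  split_ifs
  · exact G.entry_le hG _ _
  · exact Nat.zero_le M

theorem bdd_inputState {B : ℕ} (hG : G.WeightsIn M) (hB : 100 ≤ B) (hn : n < B) (hM : M < B) :
    Bdd B (inputState G M) := by
  refine ⟨hB, fun x => ?_, fun x => (inputState_mem_le hG x).trans_lt hM⟩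
  simp only [inputState]
  split_ifs <;> omega

end InputState

theorem clog_le_size (n : ℕ) : Nat.clog 2 n ≤ n.size :=
  Nat.clog_le_of_le_pow (Nat.lt_size_self n).le

-- The phases are chained, each taking its share of the time budget. The cubic bound on `B` is there
-- for the output, which consists of `n.size` matrices and so has `O(n ^ 3)` words.
set_option maxHeartbeats 1000000 in
theorem runs_program {B K n M : ℕ} {G : WGraph n} (hG : G.WeightsIn M) (hn : 3 ≤ n) (hM : 0 < M)
    (hclear : ¬ Clear n (G.key (n * M + 1)) (n * M)) (hB : 100 * (n * M) ^ 3 ≤ B)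
    (hK : K + 3 < B) :
    Runs B (program K) (inputState G M) (20000 * (n * n * (n * M + 1).size)) fun s' =>
      ∃ (t : ℕ) (r : Fin n) (C : G.graph.Walk r r) (A D F : ℕ → ℕ),
        t + 1 ≤ n * M ∧ Clear n (G.key (n * M + 1)) t ∧ C.IsCycle ∧
        G.walkWeight C ≤ 2 * (t + 1) ∧
        (∀ u v : Fin n, A (u * n + v) = G.entry u v) ∧
        (∀ a < n, IsTable n (G.key (n * M + 1)) t D F a) ∧
        StoredAt s' (s'.var 0) (C.length :: C.support.tail.map Fin.val ++
          2 * (t + 1 - (K + 3) * M) :: n.size :: blocks (3 * n) (fun b i =>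
          triEntry n (t + 1 - (K + 3) * M) (2 ^ b) A D F (i / (3 * n)) (i % (3 * n))) n.size) := by
  set X := n * M with hX
  have hnX : n ≤ X := Nat.le_mul_of_pos_right n hM
  have hMX : M ≤ X := Nat.le_mul_of_pos_left M (by omega)
  have hX2 : X * X * 3 ≤ X ^ 3 := by
    rw [pow_succ, pow_two]
    exact Nat.mul_le_mul_left _ (by omega)
  have hX1 : X * 3 ≤ X * X := Nat.mul_le_mul_left _ (by omega)
  have hnn : n * n ≤ X * X := Nat.mul_le_mul hnX hnX
  have hn3 : n * (n * n) ≤ X ^ 3 := by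
    calc n * (n * n) = n ^ 3 := by ring
      _ ≤ X ^ 3 := Nat.pow_le_pow_left hnX 3
  have hsn : n.size ≤ n := Nat.size_le.2 Nat.lt_two_pow_self
  have hsX : n.size ≤ (X + 1).size := Nat.size_le_size (by omega)
  have hsX0 : 0 < (X + 1).size := Nat.size_pos.2 (by omega)
  have h99 : 3 * n * (3 * n) = 9 * (n * n) := by ring
  have hnn0 : n * 3 ≤ n * n := Nat.mul_le_mul_left n hn
  have hlen : n.size * (3 * n * (3 * n) + 1) ≤ 10 * (n * (n * n)) := by
    calc n.size * (3 * n * (3 * n) + 1) ≤ n * (10 * (n * n)) := Nat.mul_le_mul hsn (by omega)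
      _ = _ := by ring
  set I := X + 1 with hI
  set S := I.size with hS
  set N := n * n with hN
  have hNn : 3 * n ≤ N := Nat.mul_le_mul_right n hn
  have hNS : N ≤ N * S := Nat.le_mul_of_pos_right _ hsX0
  have hN9 : 9 ≤ N := by omega
  refine Runs.seq (T₁ := 50 * N + 20) (T₂ := 19900 * (N * S))
    (Runs.frame (runs_spread (n := n) (A := (inputState G M).mem) rfl (by omega)
      fun _ _ => rfl) ?_) (by omega)
  intro s1 hf1 hA1
  have n1 : s1.var rN = n := hf1.var rN (by decide)
  have M1 : s1.var rM = M := hf1.var rM (by decide)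
  refine Runs.seq (T₁ := 80 * N + 40) (T₂ := 19800 * (N * S))
    (Runs.frame (runs_initRows (n := n) n1 M1 (by omega) (by omega)
      (fun i hi => by rw [hA1 i hi]; exact inputState_mem_le hG i) (by omega)) ?_) (by omega)
  rintro s2 hf2 ⟨I2, hr2⟩
  have n2 : s2.var rN = n := (hf2.var rN (by decide)).trans n1
  have M2 : s2.var rM = M := (hf2.var rM (by decide)).trans M1
  have hkey : ∀ u < n, ∀ v < n, s2.arr aKey (u * n + v) = G.key I u v ∧ G.key I u v ≤ I := by
    intro u hu v hv
    have hlt := row_index_lt hu hv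
    rw [(hr2 _ hlt).2, hA1 _ hlt, inputState_mem hu hv, WGraph.key, dif_pos ⟨hu, hv⟩]
    refine ⟨rfl, ?_⟩
    have := G.entry_le hG ⟨u, hu⟩ ⟨v, hv⟩
    split_ifs <;> omega
  have hkey' : ∀ u v, G.key I u v ≤ I := by
    intro u v
    by_cases h : u < n ∧ v < n
    · exact (hkey u h.1 v h.2).2
    · rw [WGraph.key, dif_neg h]
  have hsort : n * (S * (300 * n + 200) + 50) ≤ 500 * (N * S) + 50 * (N * S) := by
    calc n * (S * (300 * n + 200) + 50) = 300 * (N * S) + 200 * (n * S) + 50 * n := by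
          rw [hN]; ring
      _ ≤ 500 * (N * S) + 50 * (N * S) := by
          have : n * S ≤ N * S := Nat.mul_le_mul_right _ (by omega)
          omega
  refine Runs.seq (T₁ := n * (S * (300 * n + 200) + 50) + 20) (T₂ := 19200 * (N * S))
    (Runs.frame (runs_sortRows (n := n) n2 I2 (by omega) (by omega) (fun u hu j hj => by
      rw [(hr2 _ (row_index_lt hu hj)).1, mul_comm, Nat.mul_add_mod, Nat.mod_eq_of_lt hj])
      hkey) ?_) (by linarith)
  rintro s3 hf3 ⟨adj, hr3, hsr⟩
  have M3 : s3.var rM = M := (hf3.var rM (by decide)).trans M2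
  have hok : KeysOK B n X (G.key I) adj := by
    refine ⟨WGraph.key_pos (by omega), fun x => by rw [WGraph.key_self]; omega, hsr, by omega,
      fun x y => ?_⟩
    have := hkey' x y
    omega
  have hclog : (Nat.clog 2 X + 2) * (2200 * N) ≤ 6600 * (N * S) := by
    have h1 := (Nat.clog_mono_right 2 (show X ≤ I by omega)).trans (clog_le_size I)
    calc (Nat.clog 2 X + 2) * (2200 * N) ≤ (3 * S) * (2200 * N) :=
          Nat.mul_le_mul_right _ (by omega)
      _ = _ := by ring
  refine Runs.seq (T₁ := (Nat.clog 2 X + 2) * (2200 * N)) (T₂ := 12500 * (N * S))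
    (Runs.frame (runs_search hr3 hok M3 (by omega) hM hclear) ?_) (by omega)
  rintro s4 hf4 ⟨t, htX, t4, hcl, a, ha, hD, hclash, hne⟩
  have hr4 := hr3.of_frame hf4 (by decide)
  have M4 : s4.var rM = M := (hf4.var rM (by decide)).trans M3
  obtain ⟨r, C, hC, hCw, hCl, hCs⟩ := hD.exists_cycle_of_clash hG (by omega) hcl hclash hne
  have hCn := hC.length_le
  refine Runs.seq (T₁ := 100 * n + 200) (T₂ := 12300 * (N * S))
    (Runs.frame ((runs_writeCycle (n := n) rfl (by omega)).mono (by omega) fun _ h => h) ?_)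
    (by omega)
  intro s5 hf5 hw5
  rw [← hCs, ← hCl] at hw5
  have hr5 := hr4.of_frame hf5 (by decide)
  have t5 : s5.var rLow = t := (hf5.var rLow (by decide)).trans t4
  have M5 : s5.var rM = M := (hf5.var rM (by decide)).trans M4
  refine Runs.seq (T₁ := 2200 * N + 200 * n + 20) (T₂ := 9000 * (N * S))
    (Runs.frame (runs_tables hr5 hok t5 (by omega) hcl) ?_) (by omega)
  intro s6 hf6 hT
  have n6 : s6.var rN = n := (hf6.var rN (by decide)).trans hr5.size
  have t6 : s6.var rLow = t := (hf6.var rLow (by decide)).trans t5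
  have M6 : s6.var rM = M := (hf6.var rM (by decide)).trans M5
  have A6 : s6.arr aMat = s1.arr aMat := by
    rw [hf6.arr _ (by decide), hf5.arr _ (by decide), hf4.arr _ (by decide), hf3.arr _ (by decide),
      hf2.arr _ (by decide)]
  have hw6 : Written s6 (C.length :: C.support.tail.map Fin.val) := by
    simpa [Written, hf6.var rLen (by decide), hf6.arr aOut (by decide)] using hw5
  have hLn : (C.length :: C.support.tail.map Fin.val).length ≤ n + 1 := by
    simp
    omega
  have hgr : n.size * (2500 * N + 100) ≤ 2600 * (N * S) := by
    calc n.size * (2500 * N + 100) ≤ S * (2600 * N) := Nat.mul_le_mul hsX (by omega)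
      _ = _ := by ring
  refine Runs.seq (T₁ := n.size * (2500 * N + 100) + 200) (T₂ := 6000 * (N * S))
    (Runs.frame (runs_writeGraphs (n := n) n6 M6 t6 (by omega) hw6 (by omega) hK (by omega) rfl)
      ?_) (by omega)
  intro s7 hf7 hw7
  have h9 : n.size * (3 * n * (3 * n) + 1) ≤ 10 * (N * S) := by
    calc n.size * (3 * n * (3 * n) + 1) ≤ S * (10 * N) :=
          Nat.mul_le_mul hsX (by omega)
      _ = _ := by ring
  have hL7 : ∀ f, (C.length :: C.support.tail.map Fin.val ++ 2 * (t + 1 - (K + 3) * M) :: n.size ::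
      blocks (3 * n) f n.size).length ≤ n + 3 + n.size * (3 * n * (3 * n) + 1) := by
    intro f
    rw [List.length_append, List.length_cons (a := 2 * _), List.length_cons (a := n.size),
      length_blocks]
    omega
  refine Runs.mono (runs_compact hw7 ((hL7 _).trans_lt (by omega))) ?_ ?_
  · refine (Nat.add_le_add_right (Nat.mul_le_mul_left 20 (hL7 _)) 20).trans ?_
    linarith
  · intro s8 h8
    refine ⟨t, r, C, s6.arr aMat, s6.arr aD, s6.arr aF, htX, hcl, hC, hCw, ?_, hT, h8⟩
    intro u v
    rw [A6, hA1 _ (row_index_lt u.2 v.2), inputState_mem u.2 v.2]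


/-! ### Logarithms and the final assembly -/

theorem one_le_log {m : ℕ} (hm : 3 ≤ m) : 1 ≤ Real.log m := by
  have h3 : (3 : ℝ) ≤ m := by exact_mod_cast hm
  rw [Real.le_log_iff_exp_le (by linarith)]
  linarith [Real.exp_one_lt_d9]

theorem size_succ_le_log {m : ℕ} (hm : 3 ≤ m) : ((m + 1).size : ℝ) ≤ 4 * Real.log m := by
  have h0 : 0 < (m + 1).size := Nat.size_pos.2 (Nat.succ_pos m)
  obtain ⟨k, hk⟩ := Nat.exists_eq_succ_of_ne_zero h0.ne'
  have h1 : 2 ^ k ≤ m * 2 := (Nat.lt_size.1 (hk ▸ Nat.lt_succ_self k)).trans (by omega)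
  have hm0 : (0 : ℝ) < m := by exact_mod_cast (by omega : 0 < m)
  have h2 : (2 : ℝ) ^ k ≤ m * 2 := by exact_mod_cast h1
  have h3 := Real.log_le_log (by positivity) h2
  rw [Real.log_pow, Real.log_mul hm0.ne' two_ne_zero] at h3
  have h4 := Real.log_two_gt_d9
  have h5 := one_le_log hm
  rw [hk]
  push_cast
  nlinarith [Real.log_two_lt_d9]

theorem weight_bound_pos {n M : ℕ} {G : WGraph n} (hG : G.WeightsIn M) {r : Fin n}
    {C : G.graph.Walk r r} (hC : C.IsCycle) : 0 < M := by
  have h3 : 0 < C.edges.length := by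
    rw [SimpleGraph.Walk.length_edges]
    exact (by norm_num : 0 < 3).trans_le hC.three_le_length
  obtain ⟨h, h'⟩ := hG _ (C.edges_subset_edgeSet (List.getElem_mem h3))
  omega

theorem outputList_triGraph {n σ τ : ℕ} {A D F : ℕ → ℕ}
    (h : ∀ pw x y, triEntry n σ pw A D F x y = triEntry n σ pw A D F y x) {G : WGraph n}
    {r : Fin n} (C : G.graph.Walk r r) :
    outputList C τ ((List.range n.size).map fun b => ⟨3 * n, triGraph n σ (2 ^ b) A D F (h (2 ^ b))⟩) =
      C.length :: C.support.tail.map Fin.val ++ τ :: n.size :: blocks (3 * n) (fun b i =>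
          triEntry n σ (2 ^ b) A D F (i / (3 * n)) (i % (3 * n))) n.size := by
  simp only [outputList, blocks, List.length_map, List.length_range, List.flatMap_map,
    triGraph_matrix]

end MinCycle

theorem theorem1 (K : ℕ) :
    ∃ (P : Cmd) (c : ℕ), ∀ (n M : ℕ) (G : WGraph n), G.WeightsIn M →
      ∀ (r : Fin n) (C : G.graph.Walk r r), G.IsMinCycle C →
        ∃ (T : ℕ) (s : State) (r' : Fin n) (C' : G.graph.Walk r' r') (τ : ℕ)
          (Gs : List (Σ N : ℕ, WGraph N)),
          Exec ((n * M) ^ c) P (inputState G M) T s ∧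
          (T : ℝ) ≤ c * (n : ℝ) ^ 2 * Real.log ((n : ℝ) * M) * Real.log n ∧
          StoredAt s (s.var 0) (outputList C' τ Gs) ∧
          C'.IsCycle ∧
          (Gs.length : ℝ) ≤ c * Real.log n ∧
          (∀ H ∈ Gs, n ≤ c * H.1 ∧ H.1 ≤ c * n ∧ H.2.WeightsIn (c * M)) ∧
          (G.walkWeight C' = G.walkWeight C ∨
            ∃ m, IsLeast (triangleWeights Gs) m ∧ m + τ = G.walkWeight C) ∧
          (G.walkWeight C ≤ K * M → τ = 0) := by
  -- Here `B = (n * M) ^ (K + 5000)` and words are below `B ^ 16`. The same constant covers the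
  -- time: `20000` steps per unit, times `4` from comparing `Nat.size` with `Real.log`, gives `80000
  -- = 5000 * 16`.
  refine ⟨program K, (K + 5000) * 16, fun n M G hG r C hC => ?_⟩
  have hM := weight_bound_pos hG hC.1
  have hn : 3 ≤ n := hC.1.three_le_length.trans hC.1.length_le
  have hnX : n ≤ n * M := Nat.le_mul_of_pos_right n hM
  have hMX : M ≤ n * M := Nat.le_mul_of_pos_left M (by omega)
  -- A cycle weighs at most `n * M`, whereas clearness at `n * M` would force more than `2 * n * M -
  -- M`.
  have hclear : ¬ Clear n (G.key (n * M + 1)) (n * M) := by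
    intro h
    have h1 := h.lt_walkWeight hG hC.1
    have h2 := (WGraph.walkWeight_le_length_mul hG C).trans (Nat.mul_le_mul_right M hC.1.length_le)
    omega
  have hpow : K + 4997 < (n * M) ^ (K + 4997) :=
    Nat.lt_two_pow_self.trans_le (Nat.pow_le_pow_left (by omega) _)
  have hB : 100 * (n * M) ^ 3 ≤ (n * M) ^ (K + 5000) := by
    rw [show K + 5000 = (K + 4997) + 3 by ring, pow_add]
    exact Nat.mul_le_mul_right _ (by omega)
  have hB' : (n * M) ^ (K + 4997) ≤ (n * M) ^ (K + 5000) :=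
    Nat.pow_le_pow_right (by omega) (by omega)
  have hX3 : n * M ≤ (n * M) ^ 3 := Nat.le_self_pow (by norm_num) _
  obtain ⟨T, s, hT, hex, -, t, r', C', A, D, F, htX, hcl, hC', hCw, hA, hTab, hst⟩ :=
    runs_program (K := K) hG hn hM hclear hB (by omega)
      (bdd_inputState hG (by omega) (by omega) (by omega))
  rw [← pow_mul] at hex
  set σ := t + 1 - (K + 3) * M with hσ
  have hKM : (K + 3) * M = K * M + 3 * M := add_mul _ _ _
  have hA' : ∀ u < n, ∀ v < n, A (u * n + v) = A (v * n + u) := fun u hu v hv => by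
    rw [hA ⟨u, hu⟩ ⟨v, hv⟩, hA ⟨v, hv⟩ ⟨u, hu⟩, WGraph.entry_comm]
  have hsym := fun pw => triEntry_comm (σ := σ) (pw := pw) (D := D) (F := F) hA' (by omega)
  have hlow := hcl.lt_walkWeight hG hC.1
  have hlogn := one_le_log hn
  have hlogX := one_le_log (hn.trans hnX)
  have hsz := size_succ_le_log (hn.trans hnX)
  push_cast at hlogX hsz
  refine ⟨T, s, r', C', 2 * σ, (List.range n.size).map fun b =>
    ⟨3 * n, triGraph n σ (2 ^ b) A D F (hsym (2 ^ b))⟩, hex, ?_, ?_, hC', ?_, ?_, ?_, ?_⟩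
  · have h1 : (T : ℝ) ≤ 20000 * (n * n * (n * M + 1).size) := by exact_mod_cast hT
    have h2 : (0 : ℝ) ≤ (K : ℝ) := Nat.cast_nonneg K
    calc (T : ℝ) ≤ 20000 * (n * n * (4 * Real.log (n * M))) := h1.trans (by gcongr)
      _ = 80000 * (n : ℝ) ^ 2 * Real.log (n * M) * 1 := by ring
      _ ≤ _ := by
        push_cast
        gcongr
        linarith
  · rwa [outputList_triGraph hsym]
  · have h1 : (n.size : ℝ) ≤ (n + 1).size := by exact_mod_cast Nat.size_le_size (Nat.le_succ n)
    have h2 := size_succ_le_log hn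
    have h3 : (0 : ℝ) ≤ (K : ℝ) := Nat.cast_nonneg K
    rw [List.length_map, List.length_range]
    push_cast
    nlinarith
  · intro H hH
    obtain ⟨b, -, rfl⟩ := List.mem_map.1 hH
    refine ⟨?_, ?_, ?_⟩
    · nlinarith
    · exact Nat.mul_le_mul_right n (by omega)
    · have hle : (K + 3) * M ≤ (K + 5000) * 16 * M := Nat.mul_le_mul_right M (by omega)
      refine triGraph_weightsIn (hsym (2 ^ b)) (by omega) (fun u hu v hv => ?_) (fun u hu v hv => ?_)
      · rw [hA ⟨u, hu⟩ ⟨v, hv⟩]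
        exact (G.entry_le hG _ _).trans (by omega)
      -- Distances are at most `t`, so after subtracting `σ` they are at most `(K + 3) * M`.
      · have := (hTab u hu).le hv
        omega
  -- The minimum is either equal to `2 * (t + 1)`, and the cycle found attains it, or smaller, and
  -- the triangles encode it.
  · rcases (show G.walkWeight C ≤ 2 * (t + 1) from (hC.2 _ _ hC').trans hCw).eq_or_lt with h | h
    · exact Or.inl (le_antisymm (h ▸ hCw) (hC.2 _ _ hC'))
    · exact Or.inr (isLeast_triangleWeights hG (by omega) hA hTab hsym hC h (by omega))
  -- From `2 * t < w(C) + M ≤ (K + 1) * M` one gets `t + 1 ≤ (K + 3) * M`, so the truncated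
  -- subtraction makes `σ` vanish.
  · intro h
    omega
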